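/- Let $d\in\{2,3\}$, let $b_1,\dots,b_d$ be a basis of $\mathbb R^d$ and let $V=\{\sum_i t_i b_i: 0\le t_i<1\}$ be the period cell of the lattice it generates. For a symmetric second-order tensor $\tau$ put $\operatorname{dev}\tau=\tau-\frac1d\operatorname{tr}(\tau)I$, $\sigma:\tau=\sum_{i,j}\sigma_{ij}\tau_{ij}$, $\|\tau\|^2=\tau:\tau$, $\tau_0=\frac1d\operatorname{tr}\tau$ (hydrostatic part) and $\tau_{\rm eq}=\big(\frac{d-1}{d}\operatorname{dev}\tau:\operatorname{dev}\tau\big)^{1/2}$. Let $\mathcal J=\frac1d I\otimes I$, $\mathcal I_{ijkl}=\frac12(\delta_{ik}\delta_{jl}+\delta_{il}\delta_{jk})$, $\mathcal K=\mathcal I-\mathcal J$, and $n_K=\frac{d(d+1)}2-1$ (so $n_K=2$ for $d=2$ and $n_K=5$ for $d=3$). A medium is a pair of $V$-periodic, bounded, almost everywhere positive modulus fields $\kappa,\mu\in L^\infty_{\rm per}(V)$, with elasticity tensor $\mathcal L(x)=d\kappa(x)\mathcal J+2\mu(x)\mathcal K$. The strain field of the medium for a macroscopic strain $\bar\varepsilon$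 is the periodic field of symmetric tensors $\varepsilon\in L^2_{\rm per}(V)$ with $\varepsilon=\bar\varepsilon+\nabla_s u$ for a $V$-periodic displacement $u$ and $\nabla\cdot(\mathcal L:\varepsilon)=0$, both in the sense of periodic distributions. Fix constants $\kappa_0,\mu_0>0$ and set $$\|\delta\mathcal L\|=\operatorname*{ess\,sup}_{x\in V}\max\big(|d(\kappa(x)-\kappa_0)|,\,|2(\mu(x)-\mu_0)|\big).$$ Let $\bar\varepsilon^{(1)},\dots,\bar\varepsilon^{(n_K)}$ be nonzero purely deviatoric (symmetric, trace-free) strains such that $$\mathcal K=\sum_{i=1}^{n_K}\frac{\bar\varepsilon^{(i)}\otimes\bar\varepsilon^{(i)}}{\|\bar\varepsilon^{(i)}\|^2},\qquad \bar\varepsilon^{(i)}:\bar\varepsilon^{(j)}=\|\bar\varepsilon^{(i)}\|\,\|\bar\varepsilon^{(j)}\|\,\delta_{ij},$$ and, for a medium whose shear modulus has mean value $\langle\mu\rangle=\mu_0$ over $V$, let $\varepsilon^{(i)}$ be its strain field for $\bar\varepsilon^{(i)}$. Then, with $$\lambda_K^{-1}=\frac{2\mu_0\,(d\kappa_0+2(d-1)\mu_0)}{d(d-1)(\kappa_0+2\mu_0)},$$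 one has as $\|\delta\mathcal L\|\to0$ $$\mu(x)=\mu_0+\frac{\lambda_K^{-1}}2\sum_{i=1}^{n_K}\Big[1-\frac{\operatorname{dev}\varepsilon^{(i)}(x):\operatorname{dev}\bar\varepsilon^{(i)}}{\|\bar\varepsilon^{(i)}\|^2}\Big]+o(\|\delta\mathcal L\|),$$ $$\mu(x)=\mu_0+\frac{\lambda_K^{-1}}2\sum_{i=1}^{n_K}\Big[1-\frac{\varepsilon^{(i)}_{\rm eq}(x)}{\bar\varepsilon^{(i)}_{\rm eq}}\Big]+o(\|\delta\mathcal L\|),$$ and $\varepsilon^{(i)}_0(x)=O(\|\delta\mathcal L\|)$ for every $i$. These estimates hold in the following two senses. (a) In $L^2(V)$, uniformly in the medium: for every $\eta>0$ there is $\delta>0$ such that for all media as above with $\|\delta\mathcal L\|\le\delta$ the $L^2(V)$ norms of the two remainders are at most $\eta\|\delta\mathcal L\|$; and there are $C,\delta>0$ such that for all such media with $\|\delta\mathcal L\|\le\delta$ one has $\|\varepsilon_0^{(i)}\|_{L^2(V)}\le C\|\delta\mathcal L\|$ for all $i$. (b) At almost every point, for fluctuations of fixed shape: if $(\kappa_n,\mu_n)=(\kappa_0+t_n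 k,\ \mu_0+t_n m)$, $n\in\mathbb N$, are media as above with fixed functions $k,m$ and real numbers $t_n\to0$, then for almost every $x$ the two remainders at $x$ are $o(\|\delta\mathcal L_n\|)$, and each $\varepsilon^{(i)}_{n,0}(x)$ is $O(\|\delta\mathcal L_n\|)$, as $n\to\infty$. -/

import Mathlib

open MeasureTheory Filter Asymptotics
open scoped ENNReal ContDiff

noncomputable section

/-- The physical space `ℝ^d` with its Euclidean structure. -/
abbrev Space (d : ℕ) := EuclideanSpace ℝ (Fin d)

/-- Second-order tensors on `ℝ^d`, in components. -/
abbrev Tensor2 (d : ℕ) := Matrix (Fin d) (Fin d) ℝ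

/-- Fourth-order tensors on `ℝ^d`, in components. -/
abbrev Tensor4 (d : ℕ) := Fin d → Fin d → Fin d → Fin d → ℝ

/-! ### Tensor algebra -/

/-- The identity on symmetric second-order tensors,
`I_{ijkl} = (δ_{ik} δ_{jl} + δ_{il} δ_{jk}) / 2`. -/
def symId (d : ℕ) : Tensor4 d := fun i j k l =>
  ((if i = k then 1 else 0) * (if j = l then 1 else 0) +
    (if i = l then 1 else 0) * (if j = k then 1 else 0)) / 2

/-- The spherical projector `J = (1/d) I ⊗ I`. -/
def sphProj (d : ℕ) : Tensor4 d := fun i j k l =>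
  (1 / (d : ℝ)) * ((if i = j then 1 else 0) * (if k = l then 1 else 0))

/-- The deviatoric projector `K = I - J`. -/
def devProj (d : ℕ) : Tensor4 d := symId d - sphProj d

/-- The dimension `n_K = d (d + 1) / 2 - 1` of the space of symmetric trace-free tensors
(`2` for `d = 2`, `5` for `d = 3`). -/
def nK (d : ℕ) : ℕ := d * (d + 1) / 2 - 1

/-- The action `A : τ` of a fourth-order tensor on a second-order tensor. -/
def Tensor4.app {d : ℕ} (A : Tensor4 d) (τ : Tensor2 d) : Tensor2 d :=
  Matrix.of fun i j => ∑ k, ∑ l, A i j k l * τ k l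

/-- The tensor product `σ ⊗ τ` of second-order tensors. -/
def tensorProd {d : ℕ} (σ τ : Tensor2 d) : Tensor4 d := fun i j k l => σ i j * τ k l

/-- The doubly contracted product `σ : τ`. -/
def ddot {d : ℕ} (σ τ : Tensor2 d) : ℝ := ∑ i, ∑ j, σ i j * τ i j

/-- The norm `‖τ‖ = (τ : τ)^{1/2}`. -/
def tnorm {d : ℕ} (τ : Tensor2 d) : ℝ := Real.sqrt (ddot τ τ)

/-- The deviatoric part `dev τ = τ - (1/d) tr(τ) I`. -/
def dev {d : ℕ} (τ : Tensor2 d) : Tensor2 d := τ - (τ.trace / (d : ℝ)) • (1 : Tensor2 d)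

/-- The hydrostatic strain `ε₀ = tr(ε) / d`. -/
def hydroStrain {d : ℕ} (ε : Tensor2 d) : ℝ := ε.trace / (d : ℝ)

/-- The von Mises equivalent strain `ε_eq = ((d-1)/d  dev ε : dev ε)^{1/2}`. -/
def eqStrain {d : ℕ} (ε : Tensor2 d) : ℝ :=
  Real.sqrt (((d : ℝ) - 1) / (d : ℝ) * ddot (dev ε) (dev ε))

/-- The isotropic elasticity tensor `d κ J + 2 μ K`. -/
def isoElasticity (d : ℕ) (κ μ : ℝ) : Tensor4 d :=
  ((d : ℝ) * κ) • sphProj d + (2 * μ) • devProj d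

/-- A family of nonzero purely deviatoric (symmetric, trace-free) strains that is an orthogonal
eigenbasis of the deviatoric projector `K`. -/
structure IsDeviatoricBasis {d : ℕ} (ebar : Fin (nK d) → Tensor2 d) : Prop where
  symm : ∀ a, (ebar a).IsSymm
  trace_eq_zero : ∀ a, (ebar a).trace = 0
  ne_zero : ∀ a, ebar a ≠ 0
  sum_eq : devProj d = ∑ a, (1 / tnorm (ebar a) ^ 2) • tensorProd (ebar a) (ebar a)
  orthogonal : ∀ a a', ddot (ebar a) (ebar a') =
    tnorm (ebar a) * tnorm (ebar a') * (if a = a' then 1 else 0)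

/-! ### Periodic media and strain fields -/

/-- Periodicity with respect to the lattice generated by the basis `b` of `ℝ^d`. -/
def IsPeriodic {d : ℕ} {α : Type*} (b : Module.Basis (Fin d) ℝ (Space d))
    (f : Space d → α) : Prop :=
  ∀ i x, f (x + b i) = f x

/-- Lebesgue measure on the period cell `V = {∑ tᵢ bᵢ : 0 ≤ tᵢ < 1}`. -/
def cellMeasure {d : ℕ} (b : Module.Basis (Fin d) ℝ (Space d)) : Measure (Space d) :=
  volume.restrict (ZSpan.fundamentalDomain b)

/-- The partial derivative `∂_j φ`. -/
def partialDeriv {d : ℕ} (j : Fin d) (φ : Space d → ℝ) (x : Space d) : ℝ :=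
  fderiv ℝ φ x (EuclideanSpace.single j 1)

/-- Smooth periodic scalar test functions. -/
structure IsTestFunction {d : ℕ} (b : Module.Basis (Fin d) ℝ (Space d))
    (φ : Space d → ℝ) : Prop where
  smooth : ContDiff ℝ ∞ φ
  periodic : IsPeriodic b φ

/-- Bulk and shear modulus fields `κ, μ ∈ L^∞_per(V, ℝ_+^*)`. -/
structure IsMedium {d : ℕ} (b : Module.Basis (Fin d) ℝ (Space d)) (κ μ : Space d → ℝ) : Prop where
  periodic_bulk : IsPeriodic b κ
  periodic_shear : IsPeriodic b μ
  memLp_bulk : MemLp κ ∞ (cellMeasure b)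
  memLp_shear : MemLp μ ∞ (cellMeasure b)
  pos_bulk : ∀ᵐ x, 0 < κ x
  pos_shear : ∀ᵐ x, 0 < μ x

/-- `e` is the symmetrized gradient, in the sense of periodic distributions, of the vector field
`u`, i.e. `e_{ij} = (∂_j u_i + ∂_i u_j) / 2`. -/
def IsWeakSymGrad {d : ℕ} (b : Module.Basis (Fin d) ℝ (Space d))
    (u : Space d → Space d) (e : Space d → Tensor2 d) : Prop :=
  ∀ φ, IsTestFunction b φ → ∀ i j,
    ∫ x, e x i j * φ x ∂(cellMeasure b) =
      -∫ x, (u x i * partialDeriv j φ x + u x j * partialDeriv i φ x) / 2 ∂(cellMeasure b)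

/-- `∇ · σ = 0` in the sense of periodic distributions. -/
def IsWeakDivFree {d : ℕ} (b : Module.Basis (Fin d) ℝ (Space d))
    (σ : Space d → Tensor2 d) : Prop :=
  ∀ φ, IsTestFunction b φ → ∀ i,
    ∫ x, ∑ j, σ x i j * partialDeriv j φ x ∂(cellMeasure b) = 0

/-- `ε` is a strain field solution of the periodic elasticity problem for the moduli `κ, μ` and
the macroscopic strain `ebar`: it is a periodic square-integrable field of symmetric tensors,
`ε = ebar + ∇ₛ u` for a periodic square-integrable displacement `u`, and the stress
`(d κ J + 2 μ K) : ε` is divergence-free. -/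
structure IsStrainSolution {d : ℕ} (b : Module.Basis (Fin d) ℝ (Space d)) (κ μ : Space d → ℝ)
    (ebar : Tensor2 d) (ε : Space d → Tensor2 d) : Prop where
  periodic : IsPeriodic b ε
  symm : ∀ x, (ε x).IsSymm
  memLp : ∀ i j, MemLp (fun x => ε x i j) 2 (cellMeasure b)
  compatible : ∃ u : Space d → Space d, IsPeriodic b u ∧
    (∀ i, MemLp (fun x => u x i) 2 (cellMeasure b)) ∧ IsWeakSymGrad b u (fun x => ε x - ebar)
  equilibrium : IsWeakDivFree b (fun x => (isoElasticity d (κ x) (μ x)).app (ε x))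

/-- The contrast `‖δL‖ = ess sup_{x ∈ V} max (|d δκ(x)|, |2 δμ(x)|)` with respect to the
reference moduli `κ0, μ0`. -/
def contrast {d : ℕ} (b : Module.Basis (Fin d) ℝ (Space d)) (κ0 μ0 : ℝ)
    (κ μ : Space d → ℝ) : ℝ≥0∞ :=
  eLpNorm (fun x => max |(d : ℝ) * (κ x - κ0)| |2 * (μ x - μ0)|) ∞ (cellMeasure b)

/-! ### The reconstruction formulae -/

/-- The constant `λ_K⁻¹`. -/
def lamKInv (d : ℕ) (κ0 μ0 : ℝ) : ℝ :=
  2 * μ0 * ((d : ℝ) * κ0 + 2 * ((d : ℝ) - 1) * μ0) /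
    ((d : ℝ) * ((d : ℝ) - 1) * (κ0 + 2 * μ0))

/-- The shear modulus reconstructed from strain values through their deviatoric parts. -/
def shearFromDev {d : ℕ} (κ0 μ0 : ℝ) (ebar ε : Fin (nK d) → Tensor2 d) : ℝ :=
  μ0 + lamKInv d κ0 μ0 / 2 *
    ∑ a, (1 - ddot (dev (ε a)) (dev (ebar a)) / tnorm (ebar a) ^ 2)

/-- The shear modulus reconstructed from strain values through their equivalent strains. -/
def shearFromEq {d : ℕ} (κ0 μ0 : ℝ) (ebar ε : Fin (nK d) → Tensor2 d) : ℝ :=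
  μ0 + lamKInv d κ0 μ0 / 2 * ∑ a, (1 - eqStrain (ε a) / eqStrain (ebar a))

end

/-! Let `δL` be the fluctuation of the elasticity tensor, `δμ = μ - μ0`, and `Γ` the periodic Green
operator of the homogeneous reference medium. Every strain field solves the Lippmann–Schwinger
equation `ε = ebar - A ε` with `A τ = Γ (δL : τ)` (`lippmann_schwinger`), and one substitution gives
`ε = ebar - A ebar + A (A ε)`.

The first-order term determines `δμ`. Since `ebar` is trace-free, `δL : ebar = 2 δμ ebar`, and the
bulk modulus drops out. Contracting `A ebar` with `ebar / ‖ebar‖²` and summing over the basis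
assembles the projector `K`, hence the full contraction of the symbol of `Γ` with `K`. As `K` is
isotropic, this contraction does not depend on the direction of the wave vector; it is the constant
`λ_K` (`sum_devProj_greenSymbol`). So the sum is `2 λ_K δμ` at each nonzero frequency, and `⟨δμ⟩ =
0` settles frequency zero (`sum_green_eq`). The deviatoric formula is therefore exact up to `A (A
ε)`, which is of second order in `L²` because `Γ` is bounded there.

The formula in terms of equivalent strains has in addition the quadratic term in the expansion of a
norm (`abs_norm_add_sub_le`), that is, the square of `A ebar`. Its `L²` norm is the square of an
`L⁴` norm, so `Γ` has to be bounded on `L⁴`. The entries of `Γ` are polynomials in Riesz transforms,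
and these are bounded on `L⁴` (`exists_eLpNorm_riesz_le`): a trigonometric polynomial `F` with
spectrum in an open half space satisfies `∫ F⁴ = 0`, which bounds the multiplier by the sign of a
linear form, and averaging over the direction of the half space produces the Riesz transforms. Both
remainders are thus `O(‖δL‖²)` in `L²`, uniformly in the medium.

For fluctuations of fixed shape, `A = t B` and the second-order term is `t² y`, where `y` solves `y
= f - t B y`. The moduli of the terms of the Neumann series of `y` have, for small `t`, a common
majorant that is summable almost everywhere, so `y` stays bounded at almost every point
(`ae_eventually_bounded_of_eq_sub_smul`). -/

noncomputable section

open scoped ComplexConjugate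

/-! ### Fourier multipliers on `L²` for a complete orthonormal system of characters. -/

lemma norm_ofReal_mul_le {m : ℝ} (hm : |m| ≤ 1) (z : ℂ) : ‖(m : ℂ) * z‖ ≤ ‖z‖ := by
  rw [norm_mul, Complex.norm_real, Real.norm_eq_abs]
  exact mul_le_of_le_one_left (norm_nonneg _) hm

/-- The diagonal operator on `ℓ²` with real entries bounded by one. -/
def lpDiagonal {Λ : Type*} (m : Λ → ℝ) (hm : ∀ n, |m n| ≤ 1) :
    lp (fun _ : Λ => ℂ) 2 →L[ℂ] lp (fun _ : Λ => ℂ) 2 :=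
  LinearMap.mkContinuous
    { toFun := fun g => ⟨fun n => (m n : ℂ) * g n,
        (lp.memℓp g).mono' fun n => norm_ofReal_mul_le (hm n) (g n)⟩
      map_add' := fun f g => by ext n; exact mul_add _ _ _
      map_smul' := fun c g => by ext n; exact mul_left_comm _ _ _ } 1
    (fun g => by
      rw [one_mul]
      exact lp.norm_mono (by norm_num) fun n => norm_ofReal_mul_le (hm n) (g n))

lemma lpDiagonal_apply {Λ : Type*} (m : Λ → ℝ) (hm : ∀ n, |m n| ≤ 1)
    (g : lp (fun _ : Λ => ℂ) 2) (n : Λ) : lpDiagonal m hm g n = m n * g n := rfl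

/-- A system of unimodular characters, indexed by an additive group, that is orthonormal and
complete with respect to a measure. -/
structure FourierSystem {Λ Ω : Type*} [AddCommGroup Λ] [MeasurableSpace Ω] (ν : Measure Ω)
    (E : Λ → Ω → ℂ) : Prop where
  measurable : ∀ n, Measurable (E n)
  norm_eq_one : ∀ n x, ‖E n x‖ = 1
  map_add : ∀ m n x, E (m + n) x = E m x * E n x
  map_neg : ∀ n x, E (-n) x = conj (E n x)
  integral_eq_zero : ∀ n, n ≠ 0 → ∫ x, E n x ∂ν = 0
  dense : ∀ p : ℝ≥0∞, 1 ≤ p → p ≠ ⊤ → ∀ f : Ω → ℂ, MemLp f p ν → ∀ ε : ℝ≥0∞, ε ≠ 0 →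
    ∃ (s : Finset Λ) (a : Λ → ℂ), eLpNorm (f - fun x => ∑ n ∈ s, a n * E n x) p ν ≤ ε

namespace FourierSystem

variable {Λ Ω : Type*} [AddCommGroup Λ] [MeasurableSpace Ω] {ν : Measure Ω}
  {E : Λ → Ω → ℂ}

lemma map_zero (hE : FourierSystem ν E) (x : Ω) : E 0 x = 1 := by
  have h := hE.map_add 0 0 x
  have h0 : E 0 x ≠ 0 := fun h0 => by simpa [h0] using hE.norm_eq_one 0 x
  rw [add_zero] at h
  exact (mul_eq_left₀ h0).1 h.symm

lemma memLp [IsProbabilityMeasure ν] (hE : FourierSystem ν E) (n : Λ) (p : ℝ≥0∞) :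
    MemLp (E n) p ν :=
  MemLp.of_bound (hE.measurable n).aestronglyMeasurable 1
    (ae_of_all _ fun x => (hE.norm_eq_one n x).le)

/-- A character as an element of `L²`. -/
def charLp [IsProbabilityMeasure ν] (hE : FourierSystem ν E) (n : Λ) : Lp ℂ 2 ν :=
  (hE.memLp n 2).toLp

variable [IsProbabilityMeasure ν]

/-- The product of one character with the conjugate of another is the character of the difference,
whose integral vanishes unless the difference is zero. -/
lemma orthonormal (hE : FourierSystem ν E) : Orthonormal ℂ hE.charLp := by
  classical
  rw [orthonormal_iff_ite]
  intro m n
  have h : inner ℂ (hE.charLp m) (hE.charLp n) = ∫ x, E (n - m) x ∂ν := by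
    rw [L2.inner_def]
    refine integral_congr_ae ?_
    filter_upwards [(hE.memLp m 2).coeFn_toLp, (hE.memLp n 2).coeFn_toLp] with x h1 h2
    simp only [charLp, h1, h2, sub_eq_add_neg, hE.map_add, hE.map_neg, RCLike.inner_apply]
  rw [h]
  split_ifs with hmn
  · simp [hmn, hE.map_zero]
  · exact hE.integral_eq_zero _ (sub_ne_zero.2 (Ne.symm hmn))

lemma toLp_sum (hE : FourierSystem ν E) (s : Finset Λ) (a : Λ → ℂ) :
    ((∑ n ∈ s, a n • hE.charLp n : Lp ℂ 2 ν) : Ω → ℂ) =ᵐ[ν] fun x => ∑ n ∈ s, a n * E n x := by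
  have h1 := Lp.coeFn_finsetSum s (fun n => a n • hE.charLp n)
  have h2 : ∀ n ∈ s, ((a n • hE.charLp n : Lp ℂ 2 ν) : Ω → ℂ) =ᵐ[ν] fun x => a n * E n x := by
    intro n _
    filter_upwards [Lp.coeFn_smul (a n) (hE.charLp n), (hE.memLp n 2).coeFn_toLp] with x h1 h2
    rw [h1, Pi.smul_apply, charLp, h2, smul_eq_mul]
  filter_upwards [h1, (s.eventually_all).2 h2] with x h3 h4
  rw [h3, Finset.sum_apply]
  exact Finset.sum_congr rfl h4

lemma span_dense (hE : FourierSystem ν E) :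
    ⊤ ≤ (Submodule.span ℂ (Set.range hE.charLp)).topologicalClosure := by
  intro f _
  rw [← SetLike.mem_coe, Submodule.topologicalClosure_coe, EMetric.mem_closure_iff]
  intro ε hε
  obtain ⟨δ, hδ0, hδ⟩ := exists_between hε
  obtain ⟨s, a, hsa⟩ := hE.dense 2 (by norm_num) (by norm_num) f (Lp.memLp f) δ hδ0.ne'
  refine ⟨∑ n ∈ s, a n • hE.charLp n, ?_, ?_⟩
  · exact Submodule.sum_mem _ fun n _ => Submodule.smul_mem _ _ (Submodule.subset_span ⟨n, rfl⟩)
  · rw [Lp.edist_def]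
    refine lt_of_le_of_lt (le_trans (le_of_eq (eLpNorm_congr_ae ?_)) hsa) hδ
    filter_upwards [hE.toLp_sum s a] with x hx
    rw [Pi.sub_apply, Pi.sub_apply, hx]

/-- The Hilbert basis of characters. -/
def basis (hE : FourierSystem ν E) : HilbertBasis Λ ℂ (Lp ℂ 2 ν) :=
  HilbertBasis.mk hE.orthonormal hE.span_dense

/-- The Fourier coefficient of an `L²` function. -/
def coeff (hE : FourierSystem ν E) (n : Λ) : Lp ℂ 2 ν →L[ℂ] ℂ := innerSL ℂ (hE.charLp n)

lemma basis_repr (hE : FourierSystem ν E) (f : Lp ℂ 2 ν) (n : Λ) :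
    hE.basis.repr f n = hE.coeff n f := by
  rw [HilbertBasis.repr_apply_apply, basis, HilbertBasis.coe_mk]; rfl

lemma coeff_eq_integral (hE : FourierSystem ν E) (f : Lp ℂ 2 ν) (n : Λ) :
    hE.coeff n f = ∫ x, f x * E (-n) x ∂ν := by
  change inner ℂ (hE.charLp n) f = _
  rw [L2.inner_def]
  refine integral_congr_ae ?_
  filter_upwards [(hE.memLp n 2).coeFn_toLp] with x h1
  simp only [charLp, h1, hE.map_neg, RCLike.inner_apply]

lemma coeff_charLp [DecidableEq Λ] (hE : FourierSystem ν E) (m n : Λ) :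
    hE.coeff n (hE.charLp m) = if n = m then 1 else 0 :=
  orthonormal_iff_ite.1 hE.orthonormal n m

lemma ext_coeff (hE : FourierSystem ν E) {f g : Lp ℂ 2 ν}
    (h : ∀ n, hE.coeff n f = hE.coeff n g) : f = g := by
  apply hE.basis.repr.injective
  ext n
  rw [basis_repr, basis_repr, h]

/-- The Fourier multiplier with a real symbol bounded by one. -/
def mult (hE : FourierSystem ν E) (m : Λ → ℝ) (hm : ∀ n, |m n| ≤ 1) :
    Lp ℂ 2 ν →L[ℂ] Lp ℂ 2 ν :=
  hE.basis.repr.symm.toContinuousLinearEquiv.toContinuousLinearMap ∘L lpDiagonal m hm ∘L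
    hE.basis.repr.toContinuousLinearEquiv.toContinuousLinearMap

lemma coeff_mult (hE : FourierSystem ν E) (m : Λ → ℝ) (hm : ∀ n, |m n| ≤ 1) (f : Lp ℂ 2 ν)
    (n : Λ) : hE.coeff n (hE.mult m hm f) = m n * hE.coeff n f := by
  rw [← basis_repr, ← basis_repr]
  simp [mult, lpDiagonal_apply]

lemma mult_charLp (hE : FourierSystem ν E) (m : Λ → ℝ) (hm : ∀ n, |m n| ≤ 1) (k : Λ) :
    hE.mult m hm (hE.charLp k) = (m k : ℂ) • hE.charLp k := by
  classical
  refine hE.ext_coeff fun n => ?_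
  rw [coeff_mult, map_smul, coeff_charLp]
  split_ifs with h <;> simp [h]

end FourierSystem

/-! ### Averaging over directions in the unit ball. -/

section UnitBall

open scoped RealInnerProductSpace

variable (V : Type*) [NormedAddCommGroup V] [InnerProductSpace ℝ V] [FiniteDimensional ℝ V]
  [MeasurableSpace V] [BorelSpace V]

/-- The uniform probability measure on the unit ball. -/
def ballMeasure : Measure V := ProbabilityTheory.cond volume (Metric.ball (0 : V) 1)

instance : IsProbabilityMeasure (ballMeasure V) :=
  ProbabilityTheory.cond_isProbabilityMeasure_of_finite
    (Metric.measure_ball_pos _ _ one_pos).ne' measure_ball_lt_top.ne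

variable {V}

lemma measurePreserving_ballMeasure (Q : V ≃ₗᵢ[ℝ] V) :
    MeasurePreserving Q (ballMeasure V) (ballMeasure V) := by
  have h := (Q.measurePreserving.restrict_preimage
    (Metric.isOpen_ball (x := (0 : V)) (ε := 1)).measurableSet).smul_measure
      (volume (Metric.ball (0 : V) 1))⁻¹
  have h2 : Q ⁻¹' Metric.ball (0 : V) 1 = Metric.ball 0 1 := by
    ext x; simp
  rw [h2] at h
  exact h

lemma ballMeasure_absolutelyContinuous : ballMeasure V ≪ (volume : Measure V) :=
  ProbabilityTheory.cond_absolutelyContinuous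

lemma ae_norm_lt_one_ballMeasure : ∀ᵐ θ ∂ballMeasure V, ‖θ‖ < 1 := by
  filter_upwards [ProbabilityTheory.ae_cond_mem
    (Metric.isOpen_ball (x := (0 : V)) (ε := 1)).measurableSet] with θ hθ
  simpa using hθ

/-- A hyperplane is a null set. Hence for almost every direction no nonzero frequency from a given
finite set lies on the boundary of the half space. -/
lemma ae_inner_ne_zero {ξ : V} (hξ : ξ ≠ 0) : ∀ᵐ θ ∂ballMeasure V, ⟪ξ, θ⟫ ≠ 0 := by
  refine ballMeasure_absolutelyContinuous.ae_le ?_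
  have h := Measure.addHaar_submodule (volume : Measure V) (LinearMap.ker (innerₛₗ ℝ ξ)) (by
    intro h
    have : ξ ∈ LinearMap.ker (innerₛₗ ℝ ξ) := h ▸ Submodule.mem_top
    simp [hξ] at this)
  change volume _ = 0
  convert h using 2
  ext θ
  simp

lemma measurable_realSign : Measurable Real.sign := by
  unfold Real.sign
  exact Measurable.ite measurableSet_Iio measurable_const
    (Measurable.ite measurableSet_Ioi measurable_const measurable_const)

lemma abs_realSign_le (r : ℝ) : |Real.sign r| ≤ 1 := by
  rcases Real.sign_apply_eq r with h | h | h <;> simp [h]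

lemma realSign_mul_self (r : ℝ) : r * Real.sign r = |r| := by
  rcases lt_trichotomy r 0 with h | h | h
  · rw [Real.sign_of_neg h, abs_of_neg h]; ring
  · simp [h]
  · rw [Real.sign_of_pos h, abs_of_pos h]; ring

lemma integrable_inner_mul_sign (ξ w : V) :
    Integrable (fun θ : V => ⟪w, θ⟫ * Real.sign ⟪ξ, θ⟫) (ballMeasure V) := by
  refine Integrable.of_bound (C := ‖w‖) ?_ ?_
  · exact ((by fun_prop : Measurable fun θ : V => ⟪w, θ⟫).mul
      (measurable_realSign.comp (by fun_prop))).aestronglyMeasurable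
  · filter_upwards [ae_norm_lt_one_ballMeasure] with θ hθ
    rw [norm_mul, Real.norm_eq_abs, Real.norm_eq_abs]
    calc |⟪w, θ⟫| * |Real.sign ⟪ξ, θ⟫| ≤ (‖w‖ * ‖θ‖) * 1 := by
          gcongr
          · exact abs_real_inner_le_norm w θ
          · exact abs_realSign_le _
      _ ≤ ‖w‖ := by nlinarith [norm_nonneg w]

/-- The reflection in the hyperplane orthogonal to `w` fixes `ξ` and changes the sign of the
integrand. -/
lemma integral_inner_mul_sign_of_orthogonal {ξ w : V} (h : ⟪ξ, w⟫ = 0) :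
    ∫ θ, ⟪w, θ⟫ * Real.sign ⟪ξ, θ⟫ ∂ballMeasure V = 0 := by
  set Q := (Submodule.span ℝ {w})ᗮ.reflection
  have h1 := (measurePreserving_ballMeasure Q).integral_comp' (f := Q.toMeasurableEquiv)
    (fun θ => ⟪w, θ⟫ * Real.sign ⟪ξ, θ⟫)
  have hw : Q w = -w := by
    exact Submodule.reflection_orthogonalComplement_singleton_eq_neg w
  have hξ : Q ξ = ξ := by
    rw [Submodule.reflection_eq_self_iff, Submodule.mem_orthogonal_singleton_iff_inner_left]
    exact h
  have h2 : ∀ θ, ⟪w, Q θ⟫ = -⟪w, θ⟫ := fun θ => by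
    rw [← Q.inner_map_map w θ, hw, inner_neg_left, neg_neg]
  have h3 : ∀ θ, ⟪ξ, Q θ⟫ = ⟪ξ, θ⟫ := fun θ => by
    conv_rhs => rw [← Q.inner_map_map ξ θ, hξ]
  have h4 : ∀ θ, Q.toMeasurableEquiv θ = Q θ := fun θ => rfl
  simp only [h4, h2, h3, neg_mul, integral_neg] at h1
  linarith

/-- A reflection exchanges two vectors of equal length and preserves the measure. -/
lemma integral_abs_inner_eq {e e' : V} (h : ‖e‖ = ‖e'‖) :
    ∫ θ, |⟪e, θ⟫| ∂ballMeasure V = ∫ θ, |⟪e', θ⟫| ∂ballMeasure V := by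
  set Q := (Submodule.span ℝ {e - e'})ᗮ.reflection
  have hQ : Q e = e' := Submodule.reflection_sub h
  have h1 := (measurePreserving_ballMeasure Q).integral_comp' (f := Q.toMeasurableEquiv)
    (fun θ => |⟪e', θ⟫|)
  rw [← h1]
  refine integral_congr_ae (ae_of_all _ fun θ => ?_)
  change |⟪e, θ⟫| = |⟪e', Q θ⟫|
  rw [← hQ, Q.inner_map_map]

/-- The link between half spaces and Riesz transforms: the average over `θ` of the sign symbols,
with weight `⟪w, θ⟫`, is a multiple of the Riesz symbol. Only the component of `w` along `ξ`
contributes, and by rotation invariance the constant does not depend on `ξ`. -/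
lemma exists_integral_inner_mul_sign [Nontrivial V] : ∃ c : ℝ, 0 < c ∧ ∀ ξ w : V,
    ∫ θ, ⟪w, θ⟫ * Real.sign ⟪ξ, θ⟫ ∂ballMeasure V = c * (⟪ξ, w⟫ / ‖ξ‖) := by
  obtain ⟨e₀, he₀⟩ := exists_norm_eq V (zero_le_one)
  refine ⟨∫ θ, |⟪e₀, θ⟫| ∂ballMeasure V, ?_, fun ξ w => ?_⟩
  · have hint : Integrable (fun θ => |⟪e₀, θ⟫|) (ballMeasure V) := by
      simpa only [realSign_mul_self] using integrable_inner_mul_sign e₀ e₀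
    refine (integral_nonneg fun θ => abs_nonneg _).lt_of_ne' fun h0 => ?_
    rw [integral_eq_zero_iff_of_nonneg (fun θ => abs_nonneg _) hint] at h0
    have hne : e₀ ≠ 0 := by rintro rfl; simp at he₀
    obtain ⟨θ, h1, h2⟩ := (h0.and (ae_inner_ne_zero hne)).exists
    exact h2 (by simpa using h1)
  · rcases eq_or_ne ξ 0 with rfl | hξ
    · simp
    have hn : ‖ξ‖ ≠ 0 := norm_ne_zero_iff.2 hξ
    set t : ℝ := ⟪ξ, w⟫ / ‖ξ‖ ^ 2 with ht
    have hw : w = t • ξ + (w - t • ξ) := by abel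
    have h1 : ⟪ξ, w - t • ξ⟫ = 0 := by
      rw [inner_sub_right, inner_smul_right, real_inner_self_eq_norm_sq, ht]
      field_simp; ring
    have h2 : ∫ θ, ⟪ξ, θ⟫ * Real.sign ⟪ξ, θ⟫ ∂ballMeasure V
        = ‖ξ‖ * ∫ θ, |⟪e₀, θ⟫| ∂ballMeasure V := by
      simp only [realSign_mul_self]
      rw [← integral_const_mul,
        integral_abs_inner_eq (e := ξ) (e' := ‖ξ‖ • e₀) (by rw [norm_smul, he₀]; simp)]
      simp only [inner_smul_left, abs_mul]
      simp
    have h3 : ∀ θ, ⟪w, θ⟫ * Real.sign ⟪ξ, θ⟫ =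
        t * (⟪ξ, θ⟫ * Real.sign ⟪ξ, θ⟫) + ⟪w - t • ξ, θ⟫ * Real.sign ⟪ξ, θ⟫ := fun θ => by
      rw [inner_sub_left, inner_smul_left]; simp; ring
    simp only [h3]
    rw [integral_add ((integrable_inner_mul_sign ξ ξ).const_mul t)
      (integrable_inner_mul_sign ξ _), integral_const_mul, h2,
      integral_inner_mul_sign_of_orthogonal h1, ht]
    field_simp
    ring

end UnitBall

/-! ### M. Riesz's inequality in `L⁴` and the method of rotations. -/

namespace FourierSystem

variable {Λ Ω : Type*} [AddCommGroup Λ] [MeasurableSpace Ω] {ν : Measure Ω}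
  {E : Λ → Ω → ℂ}

lemma measurable_sum (hE : FourierSystem ν E) (s : Finset Λ) (a : Λ → ℂ) :
    Measurable fun x => ∑ n ∈ s, a n * E n x :=
  Finset.measurable_sum _ fun n _ => (hE.measurable n).const_mul _

lemma norm_sum_le (hE : FourierSystem ν E) (s : Finset Λ) (a : Λ → ℂ) (x : Ω) :
    ‖∑ n ∈ s, a n * E n x‖ ≤ ∑ n ∈ s, ‖a n‖ := by
  refine (_root_.norm_sum_le _ _).trans (Finset.sum_le_sum fun n _ => ?_)
  rw [norm_mul, hE.norm_eq_one, mul_one]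

/-- Functions with spectrum in an open half space. -/
def halfSpan (E : Λ → Ω → ℂ) (ℓ : Λ →+ ℝ) : Submodule ℂ (Ω → ℂ) :=
  Submodule.span ℂ (E '' {n | 0 < ℓ n})

/-- Frequencies add under multiplication, and an open half space is closed under addition. -/
lemma mul_mem_halfSpan (hE : FourierSystem ν E) {ℓ : Λ →+ ℝ} {F G : Ω → ℂ}
    (hF : F ∈ halfSpan E ℓ) (hG : G ∈ halfSpan E ℓ) : F * G ∈ halfSpan E ℓ := by
  have h := Submodule.mul_mem_mul hF hG
  rw [halfSpan, Submodule.span_mul_span] at h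
  refine Submodule.span_mono ?_ h
  rintro _ ⟨_, ⟨m, hm, rfl⟩, _, ⟨n, hn, rfl⟩, rfl⟩
  refine ⟨m + n, ?_, funext fun x => hE.map_add m n x⟩
  simp only [Set.mem_ofPred_eq, _root_.map_add] at *
  exact add_pos hm hn

variable [IsProbabilityMeasure ν]

/-- Frequency zero is not in the open half space. -/
lemma integral_eq_zero_of_mem_halfSpan (hE : FourierSystem ν E) {ℓ : Λ →+ ℝ} {F : Ω → ℂ}
    (hF : F ∈ halfSpan E ℓ) : Integrable F ν ∧ ∫ x, F x ∂ν = 0 := by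
  induction hF using Submodule.span_induction with
  | mem F hF =>
    obtain ⟨n, hn, rfl⟩ := hF
    refine ⟨memLp_one_iff_integrable.1 (hE.memLp n 1), hE.integral_eq_zero n ?_⟩
    rintro rfl
    simp at hn
  | zero => exact ⟨integrable_zero _ _ _, by simp⟩
  | add F G _ _ hF hG =>
    refine ⟨hF.1.add hG.1, ?_⟩
    simp only [Pi.add_apply]
    rw [integral_add hF.1 hG.1, hF.2, hG.2, add_zero]
  | smul c F _ hF =>
    refine ⟨hF.1.smul c, ?_⟩
    simp only [Pi.smul_apply]
    rw [integral_smul, hF.2, smul_zero]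

lemma integrable_pow_of_bound {f : Ω → ℝ} (hf : Measurable f) {C : ℝ} (h : ∀ x, |f x| ≤ C)
    (k : ℕ) : Integrable (fun x => f x ^ k) ν := by
  refine Integrable.of_bound (hf.pow_const k).aestronglyMeasurable (C ^ k)
    (ae_of_all _ fun x => ?_)
  rw [norm_pow, Real.norm_eq_abs]
  exact pow_le_pow_left₀ (abs_nonneg _) (h x) k

/-- **M. Riesz's inequality** for the conjugate function with respect to a half space. -/
lemma integral_im_sign_pow_four_le (hE : FourierSystem ν E) (ℓ : Λ →+ ℝ) (s : Finset Λ)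
    (hs : ∀ n ∈ s, ℓ n ≠ 0) (a : Λ → ℂ) :
    ∫ x, (∑ n ∈ s, a n * Real.sign (ℓ n) * E n x).im ^ 4 ∂ν ≤
      34 * ∫ x, (∑ n ∈ s, a n * E n x).re ^ 4 ∂ν := by
  set f : Ω → ℝ := fun x => (∑ n ∈ s, a n * E n x).re with hf
  set h : Ω → ℝ := fun x => (∑ n ∈ s, a n * Real.sign (ℓ n) * E n x).im with hh
  set F : Ω → ℂ := fun x => f x + h x * Complex.I with hFdef
  -- A term of positive frequency contributes itself to `F`; a term of negative frequency
  -- contributes its conjugate, whose frequency is positive.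
  have hF : F ∈ halfSpan E ℓ := by
    have h1 : F = ∑ n ∈ s, if 0 < ℓ n then a n • E n else conj (a n) • E (-n) := by
      ext x
      rw [Finset.sum_apply]
      simp only [hFdef, hf, hh, Complex.re_sum, Complex.im_sum, Complex.ofReal_sum,
        Finset.sum_mul, ← Finset.sum_add_distrib]
      refine Finset.sum_congr rfl fun n hn => ?_
      rcases lt_or_gt_of_ne (hs n hn) with h0 | h0
      · rw [Real.sign_of_neg h0, if_neg h0.not_gt, Pi.smul_apply, smul_eq_mul, hE.map_neg,
          ← _root_.map_mul]
        apply Complex.ext <;> simp [add_comm]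
      · rw [Real.sign_of_pos h0, if_pos h0, Pi.smul_apply, smul_eq_mul]
        apply Complex.ext <;> simp
    rw [h1]
    refine Submodule.sum_mem _ fun n hn => ?_
    split_ifs with h0
    · exact Submodule.smul_mem _ _ (Submodule.subset_span ⟨n, h0, rfl⟩)
    · refine Submodule.smul_mem _ _ (Submodule.subset_span ⟨-n, ?_, rfl⟩)
      have := hs n hn
      simp only [Set.mem_ofPred_eq, _root_.map_neg]
      exact neg_pos.2 (lt_of_le_of_ne (not_lt.1 h0) this)
  have hF4 := hE.integral_eq_zero_of_mem_halfSpan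
    (hE.mul_mem_halfSpan (hE.mul_mem_halfSpan hF hF) (hE.mul_mem_halfSpan hF hF))
  have hfm : Measurable f := Complex.measurable_re.comp (hE.measurable_sum s a)
  have hhm : Measurable h := Complex.measurable_im.comp
    (hE.measurable_sum s fun n => a n * Real.sign (ℓ n))
  have hfi : Integrable (fun x => f x ^ 4) ν := integrable_pow_of_bound hfm
    (fun x => (Complex.abs_re_le_norm _).trans (hE.norm_sum_le s a x)) 4
  have hhi : Integrable (fun x => h x ^ 4) ν := integrable_pow_of_bound hhm
    (fun x => (Complex.abs_im_le_norm _).trans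
      (hE.norm_sum_le s (fun n => a n * Real.sign (ℓ n)) x)) 4
  have hre : ∫ x, ((F * F * (F * F)) x).re ∂ν = 0 := by
    have := integral_re hF4.1
    simp only [RCLike.re_eq_complex_re] at this
    rw [this, hF4.2, Complex.zero_re]
  have hrei : Integrable (fun x => ((F * F * (F * F)) x).re) ν := hF4.1.re
  -- With `Re F⁴ = f⁴ - 6 f² h² + h⁴`, the right side minus the left side is exactly `(6 f² - h²)²`,
  -- which explains the constants 2 and 34.
  have hpt : ∀ x, h x ^ 4 ≤ 2 * ((F * F * (F * F)) x).re + 34 * f x ^ 4 := fun x => by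
    have : ((F * F * (F * F)) x).re = f x ^ 4 - 6 * f x ^ 2 * h x ^ 2 + h x ^ 4 := by
      simp [hFdef]; ring
    rw [this]
    nlinarith [sq_nonneg (6 * f x ^ 2 - h x ^ 2)]
  calc ∫ x, h x ^ 4 ∂ν ≤ ∫ x, (2 * ((F * F * (F * F)) x).re + 34 * f x ^ 4) ∂ν :=
        integral_mono hhi ((hrei.const_mul 2).add (hfi.const_mul 34)) hpt
    _ = 34 * ∫ x, f x ^ 4 ∂ν := by
        rw [integral_add (hrei.const_mul 2) (hfi.const_mul 34), integral_const_mul,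
          integral_const_mul, hre, mul_zero, zero_add]

section Riesz

open scoped RealInnerProductSpace

variable {V : Type*} [NormedAddCommGroup V] [InnerProductSpace ℝ V] [FiniteDimensional ℝ V]
  [MeasurableSpace V] [BorelSpace V]

/-- Jensen's inequality for the fourth power; the weight `⟪w, θ⟫` has modulus at most one on the
ball. -/
lemma integral_inner_mul_pow_four_le {w : V} (hw : ‖w‖ ≤ 1) {h : V → ℝ} (hm : Measurable h)
    {B : ℝ} (hB : ∀ θ, |h θ| ≤ B) :
    (∫ θ, ⟪w, θ⟫ * h θ ∂ballMeasure V) ^ 4 ≤ ∫ θ, h θ ^ 4 ∂ballMeasure V := by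
  have hb : ∀ᵐ θ ∂ballMeasure V, |⟪w, θ⟫ * h θ| ≤ |h θ| := by
    filter_upwards [ae_norm_lt_one_ballMeasure] with θ hθ
    rw [abs_mul]
    refine mul_le_of_le_one_left (abs_nonneg _) ((abs_real_inner_le_norm _ _).trans ?_)
    exact mul_le_one₀ hw (norm_nonneg _) hθ.le
  have hm1 : Measurable fun θ => ⟪w, θ⟫ * h θ :=
    (by fun_prop : Measurable fun θ : V => ⟪w, θ⟫).mul hm
  have hi4 : Integrable (fun θ => (⟪w, θ⟫ * h θ) ^ 4) (ballMeasure V) := by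
    refine Integrable.of_bound (hm1.pow_const 4).aestronglyMeasurable (B ^ 4) ?_
    filter_upwards [hb] with θ hθ
    rw [norm_pow, Real.norm_eq_abs]
    exact pow_le_pow_left₀ (abs_nonneg _) (hθ.trans (hB θ)) 4
  have hi1 : Integrable (fun θ => ⟪w, θ⟫ * h θ) (ballMeasure V) := by
    refine Integrable.of_bound hm1.aestronglyMeasurable B ?_
    filter_upwards [hb] with θ hθ
    exact hθ.trans (hB θ)
  refine (ConvexOn.map_integral_le (g := fun t : ℝ => t ^ 4) (s := Set.univ)
    (Even.convexOn_pow (by decide)) (by fun_prop) isClosed_univ (by simp) hi1 hi4).trans ?_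
  refine integral_mono_ae hi4 (integrable_pow_of_bound hm hB 4) ?_
  filter_upwards [hb] with θ hθ
  have := pow_le_pow_left₀ (abs_nonneg _) hθ 4
  simpa only [Even.pow_abs (show Even 4 by decide)] using this

/-- The conjugate function of a trigonometric polynomial in the direction `θ`. -/
def conjFun (E : Λ → Ω → ℂ) (ξ : Λ →+ V) (s : Finset Λ) (a : Λ → ℂ) (θ : V) (x : Ω) : ℝ :=
  (∑ n ∈ s, a n * Real.sign ⟪ξ n, θ⟫ * E n x).im

/-- The conjugate Riesz transform, in the direction `w`, of a trigonometric polynomial. -/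
def conjRiesz (E : Λ → Ω → ℂ) (ξ : Λ →+ V) (s : Finset Λ) (a : Λ → ℂ) (w : V) (x : Ω) : ℝ :=
  (∑ n ∈ s, a n * ((⟪ξ n, w⟫ / ‖ξ n‖ : ℝ) : ℂ) * E n x).im

omit [IsProbabilityMeasure ν] in
lemma measurable_conjFun (hE : FourierSystem ν E) (ξ : Λ →+ V) (s : Finset Λ) (a : Λ → ℂ) :
    Measurable (Function.uncurry (conjFun E ξ s a)) := by
  refine Complex.measurable_im.comp (Finset.measurable_sum _ fun n _ => ?_)
  refine (measurable_const.mul ?_).mul ((hE.measurable n).comp measurable_snd)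
  exact Complex.measurable_ofReal.comp
    (measurable_realSign.comp (by fun_prop : Measurable fun z : V × Ω => ⟪ξ n, z.1⟫))

omit [IsProbabilityMeasure ν] [FiniteDimensional ℝ V] [MeasurableSpace V] [BorelSpace V] in
lemma abs_conjFun_le (hE : FourierSystem ν E) (ξ : Λ →+ V) (s : Finset Λ) (a : Λ → ℂ) (θ : V)
    (x : Ω) : |conjFun E ξ s a θ x| ≤ ∑ n ∈ s, ‖a n‖ := by
  refine (Complex.abs_im_le_norm _).trans ((_root_.norm_sum_le _ _).trans
    (Finset.sum_le_sum fun n _ => ?_))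
  rw [norm_mul, norm_mul, hE.norm_eq_one, mul_one, Complex.norm_real, Real.norm_eq_abs]
  exact mul_le_of_le_one_right (norm_nonneg _) (abs_realSign_le _)

-- By linearity the averaging identity for symbols passes to trigonometric polynomials.
omit [MeasurableSpace Ω] in
lemma integral_inner_mul_conjFun {c : ℝ} (hc : ∀ ξ w : V,
      ∫ θ, ⟪w, θ⟫ * Real.sign ⟪ξ, θ⟫ ∂ballMeasure V = c * (⟪ξ, w⟫ / ‖ξ‖)) (ξ : Λ →+ V)
    (s : Finset Λ) (a : Λ → ℂ) (w : V) (x : Ω) :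
    ∫ θ, ⟪w, θ⟫ * conjFun E ξ s a θ x ∂ballMeasure V = c * conjRiesz E ξ s a w x := by
  have h1 : ∀ θ, ⟪w, θ⟫ * conjFun E ξ s a θ x =
      ∑ n ∈ s, (⟪w, θ⟫ * Real.sign ⟪ξ n, θ⟫) * (a n * E n x).im := fun θ => by
    simp only [conjFun, Complex.im_sum, Finset.mul_sum]
    refine Finset.sum_congr rfl fun n _ => ?_
    rw [mul_right_comm (a n), Complex.im_mul_ofReal]; ring
  simp only [h1]
  rw [integral_finsetSum _ fun n _ => (integrable_inner_mul_sign _ _).mul_const _, conjRiesz,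
    Complex.im_sum, Finset.mul_sum]
  refine Finset.sum_congr rfl fun n _ => ?_
  rw [integral_mul_const, hc, mul_right_comm (a n), Complex.im_mul_ofReal]; ring

/-- M. Riesz's inequality for the linear form `n ↦ ⟪ξ n, θ⟫`, which for almost every `θ` vanishes at
no frequency in `s`. -/
lemma ae_integral_conjFun_pow_four_le (hE : FourierSystem ν E) (ξ : Λ →+ V)
    (hξ : Function.Injective ξ) (s : Finset Λ) (hs : 0 ∉ s) (a : Λ → ℂ) :
    ∀ᵐ θ ∂ballMeasure V, ∫ x, conjFun E ξ s a θ x ^ 4 ∂ν ≤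
      34 * ∫ x, (∑ n ∈ s, a n * E n x).re ^ 4 ∂ν := by
  have : ∀ᵐ θ ∂ballMeasure V, ∀ n ∈ s, ⟪ξ n, θ⟫ ≠ 0 := by
    refine (s.eventually_all).2 fun n hn => ae_inner_ne_zero ?_
    rw [Ne, map_eq_zero_iff ξ hξ]
    rintro rfl
    exact hs hn
  filter_upwards [this] with θ hθ
  exact hE.integral_im_sign_pow_four_le
    (⟨⟨fun n => ⟪ξ n, θ⟫, by simp⟩, fun m n => by simp [inner_add_left]⟩ : Λ →+ ℝ) s hθ a

/-- Averaging directional conjugate functions gives the Riesz transforms. -/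
lemma exists_integral_conjRiesz_pow_four_le [Nontrivial V] (hE : FourierSystem ν E)
    (ξ : Λ →+ V) (hξ : Function.Injective ξ) : ∃ C : ℝ, 0 ≤ C ∧ ∀ (s : Finset Λ), 0 ∉ s →
      ∀ (a : Λ → ℂ) (w : V), ‖w‖ ≤ 1 →
      ∫ x, conjRiesz E ξ s a w x ^ 4 ∂ν ≤ C * ∫ x, (∑ n ∈ s, a n * E n x).re ^ 4 ∂ν := by
  obtain ⟨c, hc, havg⟩ := exists_integral_inner_mul_sign (V := V)
  refine ⟨34 / c ^ 4, by positivity, fun s hs a w hw => ?_⟩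
  have hHm := hE.measurable_conjFun ξ s a
  have hint : Integrable (Function.uncurry fun (x : Ω) (θ : V) => conjFun E ξ s a θ x ^ 4)
      (ν.prod (ballMeasure V)) := by
    refine Integrable.of_bound ((hHm.comp measurable_swap).pow_const 4).aestronglyMeasurable
      ((∑ n ∈ s, ‖a n‖) ^ 4) (ae_of_all _ fun z => ?_)
    rw [Function.uncurry, norm_pow, Real.norm_eq_abs]
    exact pow_le_pow_left₀ (abs_nonneg _) (hE.abs_conjFun_le ξ s a _ _) 4
  have hgi : Integrable (fun x => conjRiesz E ξ s a w x ^ 4) ν := integrable_pow_of_bound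
    (Complex.measurable_im.comp (hE.measurable_sum s _))
    (fun x => (Complex.abs_im_le_norm _).trans (hE.norm_sum_le s _ x)) 4
  -- At a fixed point `x`, Jensen's inequality in `θ`; below, Fubini's theorem reduces the
  -- `x`-integral to one direction at a time.
  have hpow : ∀ x, c ^ 4 * conjRiesz E ξ s a w x ^ 4 ≤
      ∫ θ, conjFun E ξ s a θ x ^ 4 ∂ballMeasure V := fun x => by
    have hm : Measurable fun θ => conjFun E ξ s a θ x := hHm.of_uncurry_right
    have h1 := integral_inner_mul_pow_four_le hw hm (fun θ => hE.abs_conjFun_le ξ s a θ x)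
    rwa [integral_inner_mul_conjFun havg, mul_pow] at h1
  have key : c ^ 4 * ∫ x, conjRiesz E ξ s a w x ^ 4 ∂ν ≤
      34 * ∫ x, (∑ n ∈ s, a n * E n x).re ^ 4 ∂ν := by
    have h1 : ∫ x, c ^ 4 * conjRiesz E ξ s a w x ^ 4 ∂ν ≤
        ∫ x, ∫ θ, conjFun E ξ s a θ x ^ 4 ∂ballMeasure V ∂ν :=
      integral_mono (hgi.const_mul _) hint.integral_prod_left hpow
    have h2 : ∫ x, ∫ θ, conjFun E ξ s a θ x ^ 4 ∂ballMeasure V ∂ν =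
        ∫ θ, ∫ x, conjFun E ξ s a θ x ^ 4 ∂ν ∂ballMeasure V :=
      integral_integral_swap (f := fun x θ => conjFun E ξ s a θ x ^ 4) hint
    have h3 : ∫ θ, ∫ x, conjFun E ξ s a θ x ^ 4 ∂ν ∂ballMeasure V ≤
        ∫ θ, 34 * ∫ x, (∑ n ∈ s, a n * E n x).re ^ 4 ∂ν ∂ballMeasure V :=
      integral_mono_ae hint.integral_prod_right (integrable_const _)
        (hE.ae_integral_conjFun_pow_four_le ξ hξ s hs a)
    rw [integral_const_mul] at h1
    rw [integral_const, probReal_univ, one_smul] at h3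
    exact h1.trans (h2.le.trans h3)
  rw [div_mul_eq_mul_div, le_div_iff₀ (pow_pos hc 4), mul_comm _ (c ^ 4)]
  exact key

end Riesz
end FourierSystem

/-! ### Boundedness of the Riesz transforms on `L⁴`. -/

namespace FourierSystem

variable {Λ Ω : Type*} [AddCommGroup Λ] [MeasurableSpace Ω] {ν : Measure Ω}
  {E : Λ → Ω → ℂ}

lemma memLp_sum [IsProbabilityMeasure ν] (hE : FourierSystem ν E) (s : Finset Λ) (a : Λ → ℂ)
    (p : ℝ≥0∞) : MemLp (fun x => ∑ n ∈ s, a n * E n x) p ν :=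
  MemLp.of_bound (hE.measurable_sum s a).aestronglyMeasurable _
    (ae_of_all _ (hE.norm_sum_le s a))

variable [IsProbabilityMeasure ν]

lemma integrable_norm_sum_pow (hE : FourierSystem ν E) (s : Finset Λ) (a : Λ → ℂ) (k : ℕ) :
    Integrable (fun x => ‖∑ n ∈ s, a n * E n x‖ ^ k) ν :=
  integrable_pow_of_bound (hE.measurable_sum s a).norm
    (fun x => by rw [abs_norm]; exact hE.norm_sum_le s a x) k

/-- Dropping frequency zero amounts to subtracting the mean, which Jensen's inequality controls. It
is needed because the half-space argument excludes frequency zero. -/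
lemma integral_norm_sub_const_pow_four_le [DecidableEq Λ] (hE : FourierSystem ν E) (s : Finset Λ) (a : Λ → ℂ) :
    ∫ x, ‖∑ n ∈ s.filter (· ≠ 0), a n * E n x‖ ^ 4 ∂ν ≤
      16 * ∫ x, ‖∑ n ∈ s, a n * E n x‖ ^ 4 ∂ν := by
  set p : Ω → ℂ := fun x => ∑ n ∈ s, a n * E n x with hp
  have hpi : Integrable p ν := memLp_one_iff_integrable.1 (hE.memLp_sum s a 1)
  have h1 : ∫ x, p x ∂ν = ∑ n ∈ s.filter (· = 0), a n := by
    simp only [hp]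
    rw [integral_finsetSum _ fun n _ =>
      (memLp_one_iff_integrable.1 (hE.memLp n 1)).const_mul (a n), Finset.sum_filter]
    refine Finset.sum_congr rfl fun n _ => ?_
    rw [integral_const_mul]
    split_ifs with h
    · simp [h, hE.map_zero]
    · rw [hE.integral_eq_zero n h, mul_zero]
  have h2 : ∀ x, ∑ n ∈ s.filter (· ≠ 0), a n * E n x = p x - ∫ y, p y ∂ν := fun x => by
    rw [h1, eq_sub_iff_add_eq]
    simp only [hp]
    rw [← Finset.sum_filter_add_sum_filter_not s (· = 0), add_comm]
    congr 1
    refine Finset.sum_congr rfl fun n hn => ?_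
    rw [(Finset.mem_filter.1 hn).2, hE.map_zero, mul_one]
  have h3 : ‖∫ y, p y ∂ν‖ ^ 4 ≤ ∫ x, ‖p x‖ ^ 4 ∂ν := by
    refine (pow_le_pow_left₀ (norm_nonneg _) (norm_integral_le_integral_norm p) 4).trans ?_
    exact ConvexOn.map_integral_le (g := fun t : ℝ => t ^ 4) (s := Set.univ)
      (Even.convexOn_pow (by decide)) (by fun_prop) isClosed_univ (by simp) hpi.norm
      (hE.integrable_norm_sum_pow s a 4)
  -- Here `(u + v)⁴ ≤ 8 u⁴ + 8 v⁴`; the two eights add up to the constant 16.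
  have h4 : ∀ x, ‖∑ n ∈ s.filter (· ≠ 0), a n * E n x‖ ^ 4 ≤
      8 * ‖p x‖ ^ 4 + 8 * ‖∫ y, p y ∂ν‖ ^ 4 := fun x => by
    rw [h2]
    refine (pow_le_pow_left₀ (norm_nonneg _) (norm_sub_le _ _) 4).trans ?_
    generalize ‖p x‖ = u
    generalize ‖∫ y, p y ∂ν‖ = v
    nlinarith [sq_nonneg (u - v), sq_nonneg (u ^ 2 - v ^ 2), sq_nonneg (u * v),
      mul_nonneg (sq_nonneg (u - v)) (sq_nonneg u), mul_nonneg (sq_nonneg (u - v)) (sq_nonneg v)]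
  have h5 := (hE.integrable_norm_sum_pow s a 4).const_mul 8
  have h6 := integral_mono (hE.integrable_norm_sum_pow (s.filter (· ≠ 0)) a 4)
    (h5.add (integrable_const (8 * ‖∫ y, p y ∂ν‖ ^ 4))) h4
  refine h6.trans ?_
  simp only [Pi.add_apply]
  rw [integral_add h5 (integrable_const _), integral_const, probReal_univ, one_smul,
    integral_const_mul]
  linarith

omit [IsProbabilityMeasure ν] in
lemma eLpNorm_four_pow {f : Ω → ℂ} (hf : MemLp f 4 ν) :
    eLpNorm f 4 ν ^ 4 = ENNReal.ofReal (∫ x, ‖f x‖ ^ 4 ∂ν) := by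
  have h0 : 0 ≤ ∫ x, ‖f x‖ ^ 4 ∂ν := integral_nonneg fun x => by positivity
  have h4 : (4 : ℝ≥0∞).toReal = ((4 : ℕ) : ℝ) := by simp
  rw [hf.eLpNorm_eq_integral_rpow_norm (by norm_num) (by norm_num), h4]
  simp only [Real.rpow_natCast]
  rw [← ENNReal.ofReal_pow (by positivity), Real.rpow_inv_natCast_pow h0 (by norm_num)]

section Riesz

open scoped RealInnerProductSpace

variable {V : Type*} [NormedAddCommGroup V] [InnerProductSpace ℝ V] [FiniteDimensional ℝ V]
  [MeasurableSpace V] [BorelSpace V]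

/-- The Riesz symbol is real, so the transform of a complex polynomial splits into real and
imaginary parts, each of which is a conjugate Riesz transform. -/
lemma exists_integral_riesz_pow_four_le [Nontrivial V] (hE : FourierSystem ν E)
    (ξ : Λ →+ V) (hξ : Function.Injective ξ) : ∃ C : ℝ, 0 ≤ C ∧ ∀ (s : Finset Λ)
      (a : Λ → ℂ) (w : V), ‖w‖ ≤ 1 →
      ∫ x, ‖∑ n ∈ s, a n * ((⟪ξ n, w⟫ / ‖ξ n‖ : ℝ) : ℂ) * E n x‖ ^ 4 ∂ν ≤
        C * ∫ x, ‖∑ n ∈ s, a n * E n x‖ ^ 4 ∂ν := by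
  obtain ⟨C, hC, h⟩ := hE.exists_integral_conjRiesz_pow_four_le ξ hξ
  refine ⟨64 * C, by positivity, fun s a w hw => ?_⟩
  classical
  set s' := s.filter (· ≠ 0)
  have hs' : 0 ∉ s' := by simp [s']
  set r : Λ → ℂ := fun n => ((⟪ξ n, w⟫ / ‖ξ n‖ : ℝ) : ℂ) with hr
  -- Frequency zero may be dropped because its symbol `0 / 0` is zero by convention.
  have hq : ∀ x, ∑ n ∈ s, a n * r n * E n x = ∑ n ∈ s', a n * r n * E n x := fun x => by
    refine (Finset.sum_filter_of_ne fun n _ hn => ?_).symm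
    rintro rfl
    simp [hr] at hn
  have him := h s' hs' a w hw
  -- Multiplying the coefficients by `I` exchanges real and imaginary parts up to sign, which yields
  -- the bound for the other component.
  have hre := h s' hs' (fun n => Complex.I * a n) w hw
  have e1 : ∀ x, conjRiesz E ξ s' (fun n => Complex.I * a n) w x =
      (∑ n ∈ s', a n * r n * E n x).re := fun x => by
    simp only [conjRiesz, Complex.im_sum, Complex.re_sum]
    refine Finset.sum_congr rfl fun n _ => ?_
    rw [mul_assoc, mul_assoc, ← mul_assoc (a n), Complex.I_mul_im]
  have e2 : ∀ x, (∑ n ∈ s', Complex.I * a n * E n x).re =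
      -(∑ n ∈ s', a n * E n x).im := fun x => by
    simp only [mul_assoc, ← Finset.mul_sum]
    simp
  simp only [e1, e2, Even.neg_pow (show Even 4 by decide)] at hre
  have hm := hE.measurable_sum s' a
  have hi1 : Integrable (fun x => (∑ n ∈ s', a n * E n x).re ^ 4) ν := integrable_pow_of_bound
    (Complex.measurable_re.comp hm)
    (fun x => (Complex.abs_re_le_norm _).trans (hE.norm_sum_le s' a x)) 4
  have hi2 : Integrable (fun x => (∑ n ∈ s', a n * E n x).im ^ 4) ν := integrable_pow_of_bound
    (Complex.measurable_im.comp hm)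
    (fun x => (Complex.abs_im_le_norm _).trans (hE.norm_sum_le s' a x)) 4
  have hm' := hE.measurable_sum s' (fun n => a n * r n)
  have hi3 : Integrable (fun x => (∑ n ∈ s', a n * r n * E n x).re ^ 4) ν :=
    integrable_pow_of_bound (Complex.measurable_re.comp hm')
      (fun x => (Complex.abs_re_le_norm _).trans (hE.norm_sum_le s' _ x)) 4
  have hi4 : Integrable (fun x => (∑ n ∈ s', a n * r n * E n x).im ^ 4) ν :=
    integrable_pow_of_bound (Complex.measurable_im.comp hm')
      (fun x => (Complex.abs_im_le_norm _).trans (hE.norm_sum_le s' _ x)) 4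
  have hz1 : ∀ z : ℂ, ‖z‖ ^ 4 ≤ 2 * z.re ^ 4 + 2 * z.im ^ 4 := fun z => by
    have : ‖z‖ ^ 4 = (z.re ^ 2 + z.im ^ 2) ^ 2 := by
      rw [show (4 : ℕ) = 2 * 2 from rfl, pow_mul, Complex.sq_norm, Complex.normSq_apply]; ring
    rw [this]
    nlinarith [sq_nonneg (z.re ^ 2 - z.im ^ 2)]
  have hz2 : ∀ z : ℂ, z.re ^ 4 + z.im ^ 4 ≤ ‖z‖ ^ 4 := fun z => by
    have : ‖z‖ ^ 4 = (z.re ^ 2 + z.im ^ 2) ^ 2 := by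
      rw [show (4 : ℕ) = 2 * 2 from rfl, pow_mul, Complex.sq_norm, Complex.normSq_apply]; ring
    rw [this]
    nlinarith [mul_nonneg (sq_nonneg z.re) (sq_nonneg z.im)]
  have k1 := integral_mono (hE.integrable_norm_sum_pow s' (fun n => a n * r n) 4)
    ((hi3.const_mul 2).add (hi4.const_mul 2)) (fun x => hz1 _)
  have k2 := integral_mono (hi1.add hi2) (hE.integrable_norm_sum_pow s' a 4) (fun x => hz2 _)
  simp only [Pi.add_apply] at k1 k2
  rw [integral_add (hi3.const_mul 2) (hi4.const_mul 2), integral_const_mul,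
    integral_const_mul] at k1
  rw [integral_add hi1 hi2] at k2
  have k3 := hE.integral_norm_sub_const_pow_four_le s a
  have hq' : (fun x => ‖∑ n ∈ s, a n * r n * E n x‖ ^ 4) =
      fun x => ‖∑ n ∈ s', a n * r n * E n x‖ ^ 4 := funext fun x => by rw [hq]
  rw [show (∫ x, ‖∑ n ∈ s, a n * ((⟪ξ n, w⟫ / ‖ξ n‖ : ℝ) : ℂ) * E n x‖ ^ 4 ∂ν) =
    ∫ x, ‖∑ n ∈ s', a n * r n * E n x‖ ^ 4 ∂ν from congrArg (fun g => ∫ x, g x ∂ν) hq']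
  have him' : ∫ x, (∑ n ∈ s', a n * r n * E n x).im ^ 4 ∂ν ≤
      C * ∫ x, (∑ n ∈ s', a n * E n x).re ^ 4 ∂ν := him
  calc _ ≤ 2 * (C * (∫ x, (∑ n ∈ s', a n * E n x).re ^ 4 ∂ν +
          ∫ x, (∑ n ∈ s', a n * E n x).im ^ 4 ∂ν)) := by linarith
    _ ≤ 2 * (C * (16 * ∫ x, ‖∑ n ∈ s, a n * E n x‖ ^ 4 ∂ν)) := by
        gcongr; exact k2.trans k3
    _ ≤ 64 * C * ∫ x, ‖∑ n ∈ s, a n * E n x‖ ^ 4 ∂ν := by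
        have : 0 ≤ C * ∫ x, ‖∑ n ∈ s, a n * E n x‖ ^ 4 ∂ν :=
          mul_nonneg hC (integral_nonneg fun x => by positivity)
        linarith

omit [FiniteDimensional ℝ V] [MeasurableSpace V] [BorelSpace V] in
lemma abs_inner_div_norm_le {w : V} (hw : ‖w‖ ≤ 1) (v : V) : |⟪v, w⟫ / ‖v‖| ≤ 1 := by
  rw [abs_div, abs_norm]
  exact div_le_one_of_le₀ ((abs_real_inner_le_norm v w).trans
    (mul_le_of_le_one_right (norm_nonneg _) hw)) (norm_nonneg _)

/-- The Riesz transform in the direction `w`, with symbol `⟪ξ, w⟫ / ‖ξ‖`. -/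
def riesz (hE : FourierSystem ν E) (ξ : Λ → V) (w : V) (hw : ‖w‖ ≤ 1) :
    Lp ℂ 2 ν →L[ℂ] Lp ℂ 2 ν :=
  hE.mult (fun n => ⟪ξ n, w⟫ / ‖ξ n‖) fun n => abs_inner_div_norm_le hw (ξ n)

/-- The Riesz transforms are bounded on `L⁴`. -/
theorem exists_eLpNorm_riesz_le [Nontrivial V] (hE : FourierSystem ν E)
    (ξ : Λ →+ V) (hξ : Function.Injective ξ) : ∃ C : ℝ, 0 ≤ C ∧ ∀ (w : V) (hw : ‖w‖ ≤ 1)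
      (f : Lp ℂ 2 ν), eLpNorm (hE.riesz ξ w hw f) 4 ν ≤ ENNReal.ofReal C * eLpNorm f 4 ν := by
  obtain ⟨C, hC, h⟩ := hE.exists_integral_riesz_pow_four_le ξ hξ
  -- Since `C ≤ (C + 1) ^ 4`, no fourth root is needed; moreover `C + 1 ≠ 0`, which makes the bound
  -- trivial for `f` outside `L⁴` and allows division by the constant.
  refine ⟨C + 1, by positivity, fun w hw f => ?_⟩
  set D := ENNReal.ofReal (C + 1) with hD
  have hD0 : D ≠ 0 := by rw [hD, Ne, ENNReal.ofReal_eq_zero]; linarith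
  have hDt : D ≠ ⊤ := ENNReal.ofReal_ne_top
  by_cases hf : eLpNorm f 4 ν = ⊤
  · rw [hf, ENNReal.mul_top hD0]; exact le_top
  have hf4 : MemLp f 4 ν := ⟨Lp.aestronglyMeasurable f, lt_top_iff_ne_top.2 hf⟩
  have hpoly : ∀ (s : Finset Λ) (a : Λ → ℂ),
      eLpNorm (hE.riesz ξ w hw (∑ n ∈ s, a n • hE.charLp n)) 4 ν ≤
        D * eLpNorm (fun x => ∑ n ∈ s, a n * E n x) 4 ν := fun s a => by
    have e1 : hE.riesz ξ w hw (∑ n ∈ s, a n • hE.charLp n) =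
        ∑ n ∈ s, (a n * ((⟪ξ n, w⟫ / ‖ξ n‖ : ℝ) : ℂ)) • hE.charLp n := by
      rw [map_sum]
      refine Finset.sum_congr rfl fun n _ => ?_
      rw [map_smul, riesz, mult_charLp, smul_smul]
    rw [e1, eLpNorm_congr_ae (hE.toLp_sum s _)]
    have h4 : eLpNorm (fun x => ∑ n ∈ s, a n * ((⟪ξ n, w⟫ / ‖ξ n‖ : ℝ) : ℂ) * E n x) 4 ν ^ 4 ≤
        (D * eLpNorm (fun x => ∑ n ∈ s, a n * E n x) 4 ν) ^ 4 := by
      rw [mul_pow, eLpNorm_four_pow (hE.memLp_sum s _ 4), eLpNorm_four_pow (hE.memLp_sum s a 4),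
        hD, ← ENNReal.ofReal_pow (by positivity), ← ENNReal.ofReal_mul (by positivity)]
      refine ENNReal.ofReal_le_ofReal ((h s a w hw).trans ?_)
      refine mul_le_mul_of_nonneg_right ?_ (integral_nonneg fun x => by positivity)
      nlinarith [sq_nonneg C, pow_nonneg hC 3, pow_nonneg hC 4]
    exact (ENNReal.pow_le_pow_left_iff (by norm_num)).1 h4
  refine ENNReal.le_of_forall_pos_le_add fun ε hε _ => ?_
  have hε' : (ε : ℝ≥0∞) / D ≠ 0 := ENNReal.div_ne_zero.2 ⟨by simpa using hε.ne', hDt⟩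
  -- The error `ε / D` costs only `ε` after multiplication by `D`; the error `1 / (k + 1)` forces
  -- convergence to `f` in `L²`.
  have hseq : ∀ k : ℕ, ∃ (s : Finset Λ) (a : Λ → ℂ),
      eLpNorm (⇑f - fun x => ∑ n ∈ s, a n * E n x) 4 ν ≤ min ((ε : ℝ≥0∞) / D) (k + 1 : ℝ≥0∞)⁻¹ :=
    fun k => hE.dense 4 (by norm_num) (by norm_num) f hf4 _ (by
      refine (lt_min (pos_iff_ne_zero.2 hε') ?_).ne'
      simp [ENNReal.inv_pos])
  choose s a hsa using hseq
  set g : ℕ → Lp ℂ 2 ν := fun k => ∑ n ∈ s k, a k n • hE.charLp n with hg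
  have hgf : Tendsto g atTop (nhds f) := by
    rw [tendsto_iff_edist_tendsto_0]
    refine tendsto_of_tendsto_of_tendsto_of_le_of_le tendsto_const_nhds
      (h := fun k : ℕ => (k + 1 : ℝ≥0∞)⁻¹) ?_ (fun _ => zero_le) fun k => ?_
    · have := (tendsto_add_atTop_iff_nat 1).2 ENNReal.tendsto_inv_nat_nhds_zero
      simpa using this
    · simp only [edist_comm (g k) f, Lp.edist_def]
      have e1 : (⇑f - ⇑(g k) : Ω → ℂ) =ᵐ[ν] ⇑f - fun x => ∑ n ∈ s k, a k n * E n x := by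
        filter_upwards [hE.toLp_sum (s k) (a k)] with x hx
        rw [Pi.sub_apply, Pi.sub_apply, hg, hx]
      rw [eLpNorm_congr_ae e1]
      refine (eLpNorm_le_eLpNorm_of_exponent_le (q := 4) (by norm_num)
        (by exact (hf4.1.sub (hE.memLp_sum _ _ 4).1))).trans ((hsa k).trans (min_le_right _ _))
  have hR : Tendsto (fun k => hE.riesz ξ w hw (g k)) atTop (nhds (hE.riesz ξ w hw f)) :=
    ((hE.riesz ξ w hw).continuous.tendsto f).comp hgf
  -- The transforms converge in `L²`, hence in measure, and the `L⁴` norm is lower semicontinuous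
  -- for this convergence. So the uniform bound on polynomials passes to the limit.
  have hM := tendstoInMeasure_of_tendsto_Lp hR
  refine eLpNorm_le_of_tendstoInMeasure (u := atTop) (Eventually.of_forall fun k => ?_) hM
    (fun k => Lp.aestronglyMeasurable _)
  refine (hpoly (s k) (a k)).trans ?_
  have e2 : eLpNorm (fun x => ∑ n ∈ s k, a k n * E n x) 4 ν ≤ eLpNorm f 4 ν + ε / D := by
    have e3 : (fun x => ∑ n ∈ s k, a k n * E n x) =
        ⇑f - (⇑f - fun x => ∑ n ∈ s k, a k n * E n x) := by ext x; simp
    rw [e3]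
    refine (eLpNorm_sub_le hf4.1 (hf4.1.sub (hE.memLp_sum _ _ 4).1) (by norm_num)).trans ?_
    gcongr
    exact (hsa k).trans (min_le_left _ _)
  calc D * _ ≤ D * (eLpNorm f 4 ν + ε / D) := by gcongr
    _ = _ := by rw [mul_add, ENNReal.mul_div_cancel hD0 hDt]

end Riesz
end FourierSystem

/-! ### The characters of the period lattice. -/

section Cell

variable {d : ℕ} (b : Module.Basis (Fin d) ℝ (Space d))

/-- Normalized Lebesgue measure on the period cell. -/
def cellProb : Measure (Space d) := ProbabilityTheory.cond volume (ZSpan.fundamentalDomain b)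

lemma volume_cell_ne_zero : volume (ZSpan.fundamentalDomain b) ≠ 0 :=
  ZSpan.measure_fundamentalDomain_ne_zero b

lemma volume_cell_ne_top : volume (ZSpan.fundamentalDomain b) ≠ ⊤ :=
  (ZSpan.fundamentalDomain_isBounded b).measure_lt_top.ne

instance : IsProbabilityMeasure (cellProb b) :=
  ProbabilityTheory.cond_isProbabilityMeasure_of_finite (volume_cell_ne_zero b)
    (volume_cell_ne_top b)

lemma cellProb_eq : cellProb b = (volume (ZSpan.fundamentalDomain b))⁻¹ • cellMeasure b := rfl

lemma cellMeasure_eq : cellMeasure b = volume (ZSpan.fundamentalDomain b) • cellProb b := by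
  rw [cellProb_eq, smul_smul, ENNReal.mul_inv_cancel (volume_cell_ne_zero b)
    (volume_cell_ne_top b), one_smul]

instance : IsFiniteMeasure (cellMeasure b) := by
  rw [cellMeasure_eq]
  exact (cellProb b).smul_finite (volume_cell_ne_top b)

/-- The dual lattice vectors. -/
def dualVec : (Fin d → ℤ) →+ Space d where
  toFun n := WithLp.toLp 2 fun j => ∑ i, (n i : ℝ) * b.repr (EuclideanSpace.single j 1) i
  map_zero' := by ext j; simp
  map_add' m n := by ext j; simp [add_mul, Finset.sum_add_distrib]

lemma sum_dualVec_mul (n : Fin d → ℤ) (x : Space d) :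
    ∑ j, dualVec b n j * x j = ∑ i, (n i : ℝ) * b.repr x i := by
  have hx : x = ∑ j, x j • EuclideanSpace.single j (1 : ℝ) := by
    ext k
    simp [Finset.sum_apply, Pi.single_apply]
  conv_rhs => rw [hx]
  simp only [dualVec, AddMonoidHom.coe_mk, ZeroHom.coe_mk, map_sum, map_smul, Finsupp.coe_finsetSum,
    Finset.sum_apply, Finsupp.smul_apply, smul_eq_mul, Finset.sum_mul, Finset.mul_sum]
  rw [Finset.sum_comm]
  exact Finset.sum_congr rfl fun i _ => Finset.sum_congr rfl fun j _ => by ring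

/-- Pairing with the basis vector `b i` recovers the integer `n i`. -/
lemma dualVec_injective : Function.Injective (dualVec b) := by
  classical
  rw [injective_iff_map_eq_zero]
  intro n hn
  ext i
  have h := sum_dualVec_mul b n (b i)
  rw [hn] at h
  simp [Finsupp.single_apply] at h
  exact_mod_cast h.symm

/-- The phase of a lattice character. -/
def phase (n : Fin d → ℤ) (x : Space d) : ℝ := 2 * Real.pi * ∑ i, (n i : ℝ) * b.repr x i

/-- The characters of the period lattice. -/
def cellChar (n : Fin d → ℤ) (x : Space d) : ℂ := Complex.exp (phase b n x * Complex.I)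

lemma phase_add (m n : Fin d → ℤ) (x : Space d) :
    phase b (m + n) x = phase b m x + phase b n x := by
  simp [phase, add_mul, Finset.sum_add_distrib, mul_add]

lemma phase_neg (n : Fin d → ℤ) (x : Space d) : phase b (-n) x = -phase b n x := by
  simp [phase]

lemma phase_eq (n : Fin d → ℤ) (x : Space d) :
    phase b n x = 2 * Real.pi * ∑ j, dualVec b n j * x j := by
  rw [phase, sum_dualVec_mul]

lemma contDiff_phase (n : Fin d → ℤ) : ContDiff ℝ ∞ (phase b n) := by
  have : phase b n = fun x => 2 * Real.pi * ∑ j, dualVec b n j * x j :=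
    funext (phase_eq b n)
  rw [this]
  fun_prop

/-- The covering map from space to the standard torus. -/
def toTorus (x : Space d) : UnitAddTorus (Fin d) := fun i => (b.repr x i : UnitAddCircle)

lemma mFourier_toTorus (n : Fin d → ℤ) (x : Space d) :
    UnitAddTorus.mFourier n (toTorus b x) = cellChar b n x := by
  simp only [UnitAddTorus.mFourier, ContinuousMap.coe_mk, toTorus, fourier_coe_apply, cellChar,
    phase, ← Complex.exp_sum]
  congr 1
  push_cast
  rw [Finset.mul_sum, Finset.sum_mul]
  exact Finset.sum_congr rfl fun i _ => by ring

/-- The normalized Haar measure of the standard torus. -/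
def torusMeasure (d : ℕ) : Measure (UnitAddTorus (Fin d)) :=
  Measure.pi fun _ => AddCircle.haarAddCircle

/-- The image of Lebesgue measure under the linear coordinates is a Haar measure, hence a multiple
of Lebesgue measure. The multiple is found from the unit box, whose preimage is the cell, and the
normalization of `cellProb` cancels it. -/
lemma measurePreserving_repr : MeasurePreserving (fun x i => b.repr x i) (cellProb b)
    (Measure.pi fun _ : Fin d => (volume : Measure ℝ).restrict (Set.Ico 0 1)) := by
  set L := b.equivFun.toContinuousLinearEquiv
  have hL : ∀ x, L x = fun i => b.repr x i := fun x => by ext i; rfl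
  set box : Set (Fin d → ℝ) := Set.pi Set.univ fun _ => Set.Ico 0 1
  have hbox : MeasurableSet box := MeasurableSet.univ_pi fun _ => measurableSet_Ico
  have hpre : L ⁻¹' box = ZSpan.fundamentalDomain b := by
    ext x
    simp [box, hL, ZSpan.mem_fundamentalDomain]
  have hvol : volume box = 1 := by
    simp [box, volume_pi_pi]
  have hmeas : Measurable L := L.continuous.measurable
  have : Measure.IsAddHaarMeasure (Measure.map L (volume : Measure (Space d))) :=
    L.isAddHaarMeasure_map _
  obtain ⟨c, hc⟩ : ∃ c : NNReal, Measure.map L (volume : Measure (Space d)) = c • volume :=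
    ⟨_, Measure.isAddLeftInvariant_eq_smul _ _⟩
  have hcell : volume (ZSpan.fundamentalDomain b) = c := by
    rw [← hpre, ← Measure.map_apply hmeas hbox, hc]
    simp [hvol]
  refine ⟨by exact hmeas, ?_⟩
  change Measure.map L (cellProb b) = _
  have h0 : (volume : Measure (Fin d → ℝ)).restrict box =
      Measure.pi fun _ : Fin d => (volume : Measure ℝ).restrict (Set.Ico 0 1) := by
    rw [volume_pi, Measure.restrict_pi_pi]
  rw [cellProb_eq, cellMeasure, Measure.map_smul, ← hpre, ← Measure.restrict_map hmeas hbox,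
    hpre, hc, Measure.restrict_smul, hcell, h0, ENNReal.smul_def, smul_smul,
    ENNReal.inv_mul_cancel (hcell ▸ volume_cell_ne_zero b) (hcell ▸ volume_cell_ne_top b),
    one_smul]

lemma measurePreserving_toTorus :
    MeasurePreserving (toTorus b) (cellProb b) (torusMeasure d) := by
  have h1 : MeasurePreserving (fun x : ℝ => (x : UnitAddCircle))
      ((volume : Measure ℝ).restrict (Set.Ico 0 1)) AddCircle.haarAddCircle := by
    have := AddCircle.measurePreserving_mk 1 0
    rw [zero_add, AddCircle.volume_eq_smul_haarAddCircle] at this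
    rw [Measure.restrict_congr_set Ico_ae_eq_Ioc]
    simpa using this
  exact (measurePreserving_pi _ _ fun _ : Fin d => h1).comp (measurePreserving_repr b)

/-- The section of the covering map with values in the period cell. -/
def ofTorus (y : UnitAddTorus (Fin d)) : Space d :=
  b.equivFun.symm fun i => (AddCircle.equivIco 1 0 (y i) : ℝ)

lemma ofTorus_toTorus {x : Space d} (hx : x ∈ ZSpan.fundamentalDomain b) :
    ofTorus b (toTorus b x) = x := by
  apply b.equivFun.injective
  ext i
  have hi := (ZSpan.mem_fundamentalDomain b).1 hx i
  simp only [ofTorus, LinearEquiv.apply_symm_apply, toTorus]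
  rw [AddCircle.coe_equivIco_mk_apply]
  simp [Int.fract_eq_self.2 hi]

lemma ae_ofTorus_toTorus : ∀ᵐ x ∂cellProb b, ofTorus b (toTorus b x) = x := by
  filter_upwards [ProbabilityTheory.ae_cond_mem
    (ZSpan.fundamentalDomain_measurableSet b)] with x hx
  exact ofTorus_toTorus b hx

/-- On the cell this map is a left inverse of `toTorus`, which already carries one measure to the
other. -/
lemma measurePreserving_ofTorus :
    MeasurePreserving (ofTorus b) (torusMeasure d) (cellProb b) := by
  have hm : Measurable (ofTorus b) := by
    refine (b.equivFun.symm.toContinuousLinearEquiv.continuous.measurable).comp ?_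
    refine measurable_pi_lambda _ fun i => ?_
    exact measurable_subtype_coe.comp
      ((AddCircle.measurableEquivIco 1 0).measurable.comp (measurable_pi_apply i))
  refine ⟨hm, ?_⟩
  rw [← (measurePreserving_toTorus b).map_eq,
    Measure.map_map hm (measurePreserving_toTorus b).measurable]
  conv_rhs => rw [← Measure.map_id (μ := cellProb b)]
  exact Measure.map_congr (ae_ofTorus_toTorus b)

/-- The integral factors over the coordinates, and the factor of a coordinate with `n i ≠ 0`
vanishes. -/
lemma integral_mFourier {n : Fin d → ℤ} (hn : n ≠ 0) :
    ∫ y, UnitAddTorus.mFourier n y ∂torusMeasure d = 0 := by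
  obtain ⟨i, hi⟩ := Function.ne_iff.1 hn
  simp only [UnitAddTorus.mFourier, ContinuousMap.coe_mk]
  rw [torusMeasure, integral_fintype_prod_eq_prod (𝕜 := ℂ)
    (fun i (y : UnitAddCircle) => (fourier (n i) y : ℂ))]
  refine Finset.prod_eq_zero (Finset.mem_univ i) ?_
  have h := (orthonormal_iff_ite.1 (orthonormal_fourier (T := 1))) 0 (n i)
  rw [if_neg (fun h => hi h.symm)] at h
  simpa [fourierLp, ContinuousMap.inner_toLp] using h

lemma exists_trig_approx_torus (p : ℝ≥0∞) (hp1 : 1 ≤ p) (hp : p ≠ ⊤)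
    (f : UnitAddTorus (Fin d) → ℂ) (hf : MemLp f p (torusMeasure d)) (ε : ℝ≥0∞) (hε : ε ≠ 0) :
    ∃ (s : Finset (Fin d → ℤ)) (a : (Fin d → ℤ) → ℂ),
      eLpNorm (f - fun y => ∑ n ∈ s, a n * UnitAddTorus.mFourier n y) p (torusMeasure d) ≤ ε := by
  have : Fact (1 ≤ p) := ⟨hp1⟩
  have : IsProbabilityMeasure (torusMeasure d) := by unfold torusMeasure; infer_instance
  have hmem (n : Fin d → ℤ) : MemLp (UnitAddTorus.mFourier n) p (torusMeasure d) :=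
    MemLp.of_bound (UnitAddTorus.mFourier n).continuous.aestronglyMeasurable 1
      (ae_of_all _ fun y => by
        simpa [UnitAddTorus.mFourier_norm] using (UnitAddTorus.mFourier n).norm_coe_le_norm y)
  have hd : (Submodule.span ℂ (Set.range fun n => (hmem n).toLp)).topologicalClosure = ⊤ :=
    UnitAddTorus.span_mFourierLp_closure_eq_top (d := Fin d) hp
  have hfc : hf.toLp ∈ (Submodule.span ℂ
      (Set.range fun n => (hmem n).toLp)).topologicalClosure := hd ▸ Submodule.mem_top
  rw [← SetLike.mem_coe, Submodule.topologicalClosure_coe, EMetric.mem_closure_iff] at hfc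
  obtain ⟨g, hg, hgε⟩ := hfc ε (pos_iff_ne_zero.2 hε)
  obtain ⟨c, rfl⟩ := (Finsupp.mem_span_range_iff_exists_finsupp).1 hg
  refine ⟨c.support, c, le_trans (le_of_eq ?_) hgε.le⟩
  rw [Lp.edist_def]
  refine eLpNorm_congr_ae ?_
  have h2 : ∀ n ∈ c.support, ((c n • (hmem n).toLp : Lp ℂ p (torusMeasure d)) :
      UnitAddTorus (Fin d) → ℂ) =ᵐ[torusMeasure d] fun y => c n * UnitAddTorus.mFourier n y := by
    intro n _
    filter_upwards [Lp.coeFn_smul (c n) (hmem n).toLp, (hmem n).coeFn_toLp] with y h1 h2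
    rw [h1, Pi.smul_apply, h2, smul_eq_mul]
  filter_upwards [hf.coeFn_toLp, Lp.coeFn_finsetSum c.support fun n => c n • (hmem n).toLp,
    (c.support.eventually_all).2 h2] with y h3 h4 h5
  rw [Pi.sub_apply, Pi.sub_apply, h3, Finsupp.sum, h4, Finset.sum_apply,
    Finset.sum_congr rfl h5]

/-- The lattice characters form a Fourier system on the period cell. -/
theorem fourierSystem_cell : FourierSystem (cellProb b) (cellChar b) where
  measurable n := by
    unfold cellChar
    have := (contDiff_phase b n).continuous
    fun_prop
  norm_eq_one n x := Complex.norm_exp_ofReal_mul_I _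
  map_add m n x := by
    simp only [cellChar, phase_add]
    push_cast
    rw [add_mul, Complex.exp_add]
  map_neg n x := by
    simp only [cellChar, phase_neg, ← Complex.exp_conj]
    simp
  integral_eq_zero n hn := by
    rw [← integral_mFourier hn, ← (measurePreserving_toTorus b).map_eq, integral_map
      (measurePreserving_toTorus b).aemeasurable
      (UnitAddTorus.mFourier n).continuous.aestronglyMeasurable]
    simp only [mFourier_toTorus]
  dense p hp1 hp f hf ε hε := by
    -- The approximation is made on the torus and pulled back along `toTorus`, which preserves the
    -- `L^p` error.
    obtain ⟨s, a, hsa⟩ := exists_trig_approx_torus p hp1 hp (f ∘ ofTorus b)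
      (hf.comp_measurePreserving (measurePreserving_ofTorus b)) ε hε
    refine ⟨s, a, le_trans (le_of_eq ?_) hsa⟩
    have hm : AEStronglyMeasurable
        (f ∘ ofTorus b - fun y => ∑ n ∈ s, a n * UnitAddTorus.mFourier n y) (torusMeasure d) := by
      refine (hf.comp_measurePreserving (measurePreserving_ofTorus b)).1.sub ?_
      exact (by fun_prop : Continuous fun y =>
        ∑ n ∈ s, a n * UnitAddTorus.mFourier n y).aestronglyMeasurable
    rw [← eLpNorm_comp_measurePreserving hm (measurePreserving_toTorus b)]
    refine eLpNorm_congr_ae ?_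
    filter_upwards [ae_ofTorus_toTorus b] with x hx
    simp [hx, mFourier_toTorus]

end Cell

/-! ### The algebra of the symbol of the Green operator. -/

section Symbol

variable {d : ℕ}

/-- The symbol of the periodic Green operator in the direction of a wave vector `r`. -/
def greenSymbol (μ0 β : ℝ) (r : Fin d → ℝ) (τ : Fin d → Fin d → ℂ) (i j : Fin d) : ℂ :=
  ((1 / (2 * μ0) : ℝ) : ℂ) * ∑ k, ((r j : ℂ) * (r k * τ i k) + r i * (r k * τ j k)) -
    (β : ℂ) * ∑ k, ∑ l, (r i : ℂ) * (r j * (r k * (r l * τ k l)))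

/-- The definition is expanded so as to match, term by term, compositions of multiplications by the
`r i`; this factored form serves the computations. -/
lemma greenSymbol_eq (μ0 β : ℝ) (r : Fin d → ℝ) (τ : Fin d → Fin d → ℂ) (i j : Fin d) :
    greenSymbol μ0 β r τ i j =
      1 / (2 * μ0) * (r j * ∑ k, r k * τ i k + r i * ∑ k, r k * τ j k) -
        β * (r i * r j * ∑ k, r k * ∑ l, r l * τ k l) := by
  simp only [greenSymbol, Finset.sum_add_distrib, Finset.mul_sum]
  push_cast
  congr 1
  exact Finset.sum_congr rfl fun k _ => Finset.sum_congr rfl fun l _ => by ring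

/-- A compatible strain in equilibrium with the polarization `τ` is given by the Green operator. -/
lemma eq_neg_greenSymbol {lam0 μ0 β : ℝ} (hμ0 : μ0 ≠ 0) (hlam : lam0 + 2 * μ0 ≠ 0)
    (hβ : β = (lam0 + μ0) / (μ0 * (lam0 + 2 * μ0))) {r : Fin d → ℝ} (hr : ∑ j, r j ^ 2 = 1)
    {w : Fin d → ℂ} {e τ : Fin d → Fin d → ℂ} (he : ∀ i j, e i j = (w i * r j + w j * r i) / 2)
    (heq : ∀ i, ∑ j, (r j : ℂ) * ((if i = j then lam0 * ∑ k, e k k else 0) + 2 * μ0 * e i j +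
      τ i j) = 0) (i j : Fin d) : e i j = -greenSymbol μ0 β r τ i j := by
  set s : ℂ := ∑ k, w k * r k with hs
  set q : Fin d → ℂ := fun i => ∑ k, r k * τ i k with hq
  have hr' : ∑ j, (r j : ℂ) * r j = 1 := by
    have := congrArg (fun x : ℝ => (x : ℂ)) hr
    push_cast at this
    simpa only [sq] using this
  have htr : ∑ k, e k k = s := by
    rw [hs]; exact Finset.sum_congr rfl fun k _ => by rw [he]; ring
  -- Equilibrium as a vector equation for the displacement amplitude `w`, where `s` is its
  -- longitudinal component.
  have h1 : ∀ i, lam0 * s * r i + μ0 * (w i + s * r i) + q i = 0 := fun i => by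
    rw [← heq i]
    simp only [mul_add, Finset.sum_add_distrib, htr, hq]
    congr 1
    congr 1
    · simp [mul_comm]
    · have h3 : ∀ j, (r j : ℂ) * (2 * μ0 * e i j) =
          μ0 * (w i * (r j * r j)) + μ0 * r i * (w j * r j) := fun j => by
        rw [he]; ring
      simp only [h3, Finset.sum_add_distrib, ← Finset.mul_sum, hr']
      rw [hs]; ring
  set Q : ℂ := ∑ k, r k * q k with hQ
  -- Contraction with `r` leaves a scalar equation for `s`; putting `s` back into the vector
  -- equation then determines `w`.
  have h2 : (lam0 + 2 * μ0) * s + Q = 0 := by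
    have h3 : ∑ i, (r i : ℂ) * (lam0 * s * r i + μ0 * (w i + s * r i) + q i) = 0 :=
      Finset.sum_eq_zero fun i _ => by rw [h1, mul_zero]
    have h4 : ∀ i, (r i : ℂ) * (lam0 * s * r i + μ0 * (w i + s * r i) + q i) =
        (lam0 * s + μ0 * s) * (r i * r i) + μ0 * (w i * r i) + r i * q i := fun i => by ring
    simp only [h4, Finset.sum_add_distrib, ← Finset.mul_sum, hr', ← hs, ← hQ] at h3
    rw [← h3]; ring
  have hμ : (μ0 : ℂ) ≠ 0 := by exact_mod_cast hμ0
  have hl : (lam0 : ℂ) + 2 * μ0 ≠ 0 := by exact_mod_cast hlam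
  rw [greenSymbol_eq, he, hβ]
  change _ = -(1 / (2 * μ0) * (r j * q i + r i * q j) - _ * (r i * r j * Q))
  have hw : ∀ i, w i = -(q i + (lam0 + μ0) * s * r i) / μ0 := fun i => by
    rw [eq_div_iff hμ]; linear_combination h1 i
  have hs' : s = -Q / (lam0 + 2 * μ0) := by
    rw [eq_div_iff hl]; linear_combination h2
  rw [hw i, hw j, hs']
  push_cast
  field_simp
  ring

/-- The trace of the Green operator on deviatoric tensors is the constant `λ_K`. -/
lemma sum_devProj_greenSymbol {κ0 μ0 β : ℝ} (hd : 2 ≤ d) (hκ0 : 0 < κ0) (hμ0 : 0 < μ0)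
    (hβ : β = ((d : ℝ) * κ0 + (d - 2) * μ0) / (μ0 * (d * κ0 + 2 * (d - 1) * μ0)))
    {r : Fin d → ℝ} (hr : ∑ j, r j ^ 2 = 1) :
    1 / (2 * μ0) * (∑ i, ∑ j, ∑ k, (r j * r k * devProj d i j i k +
      r i * r k * devProj d i j j k)) -
      β * ∑ i, ∑ j, ∑ k, ∑ l, r i * r j * r k * r l * devProj d i j k l =
    1 / lamKInv d κ0 μ0 := by
  have hd' : (2 : ℝ) ≤ d := by exact_mod_cast hd
  have hr' : ∑ j, r j * r j = 1 := by simpa only [sq] using hr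
  have hK : ∀ i j k l : Fin d, devProj d i j k l =
      (1 / 2) * (if i = k then if j = l then 1 else 0 else 0) +
        (1 / 2) * (if i = l then if j = k then 1 else 0 else 0) -
        (1 / d) * (if i = j then if k = l then 1 else 0 else 0) := fun i j k l => by
    simp only [devProj, symId, sphProj, Pi.sub_apply, ite_mul, one_mul, zero_mul]
    ring
  have h1 : ∑ i, ∑ j, ∑ k, r j * r k * devProj d i j i k = (d + 1) / 2 - 1 / d := by
    simp only [hK, mul_sub, mul_add, mul_ite, mul_one, mul_zero, Finset.sum_add_distrib,
      Finset.sum_sub_distrib, Finset.sum_ite_eq, Finset.sum_ite_eq', Finset.mem_univ, if_true,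
      Finset.sum_ite_irrel, Finset.sum_const_zero]
    simp [← Finset.sum_mul, hr']
    ring
  have h2 : ∑ i, ∑ j, ∑ k, r i * r k * devProj d i j j k = (d + 1) / 2 - 1 / d := by
    simp only [hK, mul_sub, mul_add, mul_ite, mul_one, mul_zero, Finset.sum_add_distrib,
      Finset.sum_sub_distrib, Finset.sum_ite_eq, Finset.mem_univ, if_true,
      Finset.sum_ite_irrel, Finset.sum_const_zero]
    simp [← Finset.mul_sum, ← Finset.sum_mul, hr']
    ring
  have h3 : ∑ i, ∑ j, ∑ k, ∑ l, r i * r j * r k * r l * devProj d i j k l = 1 - 1 / d := by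
    simp only [hK, mul_sub, mul_add, mul_ite, mul_one, mul_zero, Finset.sum_add_distrib,
      Finset.sum_sub_distrib, Finset.sum_ite_eq, Finset.mem_univ, if_true,
      Finset.sum_ite_irrel, Finset.sum_const_zero]
    ring_nf
    simp only [← Finset.mul_sum, ← Finset.sum_mul, hr, mul_one]
    ring
  simp only [Finset.sum_add_distrib]
  rw [h1, h2, h3, hβ, lamKInv]
  have hD : 0 < (d : ℝ) * κ0 + 2 * (d - 1) * μ0 := by nlinarith
  have hκμ : 0 < κ0 + 2 * μ0 := by positivity
  have hd1 : (d : ℝ) - 1 ≠ 0 := by linarith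
  have hd0 : (d : ℝ) ≠ 0 := by linarith
  have hDne := hD.ne'
  -- The denominator becomes an independent variable and `κ0` is expressed through it, so that the
  -- remaining identity is one between rational functions with simple denominators.
  generalize hDdef : (d : ℝ) * κ0 + 2 * (d - 1) * μ0 = D at *
  have hκ : κ0 = (D - 2 * (d - 1) * μ0) / d := by
    rw [eq_div_iff hd0]; linear_combination hDdef
  field_simp
  rw [hκ]
  field_simp
  ring

end Symbol

/-! ### Multiplication of tensor fields by isotropic modulus fluctuations. -/

/-- Square-integrable fields of complex second-order tensors. -/
abbrev TensorField {Ω : Type*} [MeasurableSpace Ω] (d : ℕ) (ν : Measure Ω) :=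
  Fin d → Fin d → Lp ℂ 2 ν

section Multiplication

variable {d : ℕ} {Ω : Type*} [MeasurableSpace Ω] {ν : Measure Ω}

/-- The entry of a tensor field. -/
def entry (i j : Fin d) : TensorField d ν →L[ℂ] Lp ℂ 2 ν :=
  ContinuousLinearMap.proj (R := ℂ) (φ := fun _ : Fin d => Lp ℂ 2 ν) j ∘L
    ContinuousLinearMap.proj (R := ℂ) (φ := fun _ : Fin d => Fin d → Lp ℂ 2 ν) i

lemma entry_apply (i j : Fin d) (τ : TensorField d ν) : entry i j τ = τ i j := rfl

lemma norm_entry_le (τ : TensorField d ν) (i j : Fin d) : ‖τ i j‖ ≤ ‖τ‖ :=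
  (norm_le_pi_norm (τ i) j).trans (norm_le_pi_norm τ i)

/-- Multiplication of square-integrable functions by bounded functions. -/
def mulOp : Lp ℂ ⊤ ν →L[ℂ] Lp ℂ 2 ν →L[ℂ] Lp ℂ 2 ν :=
  (ContinuousLinearMap.mul ℂ ℂ).holderL ν ⊤ 2 2

lemma coeFn_mulOp (g : Lp ℂ ⊤ ν) (f : Lp ℂ 2 ν) : mulOp g f =ᵐ[ν] fun x => g x * f x :=
  (ContinuousLinearMap.mul ℂ ℂ).coeFn_holder g f

/-- Contraction with the isotropic tensor field `d k J + 2 m K`. -/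
def isoMul (k m : Lp ℂ ⊤ ν) : TensorField d ν →L[ℂ] TensorField d ν :=
  ContinuousLinearMap.pi fun i => ContinuousLinearMap.pi fun j =>
    (if i = j then mulOp (k - (2 / d : ℂ) • m) ∘L ∑ l, entry l l else 0) +
      mulOp ((2 : ℂ) • m) ∘L entry i j

lemma isoMul_apply (k m : Lp ℂ ⊤ ν) (τ : TensorField d ν) (i j : Fin d) :
    isoMul k m τ i j = (if i = j then mulOp (k - (2 / d : ℂ) • m) (∑ l, τ l l) else 0) +
      mulOp ((2 : ℂ) • m) (τ i j) := by
  simp only [isoMul, ContinuousLinearMap.coe_pi', add_apply,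
    ContinuousLinearMap.comp_apply, entry_apply]
  split_ifs <;> simp only [ContinuousLinearMap.comp_apply, sum_apply, entry_apply, zero_apply]

lemma isoMul_smul (c : ℂ) (k m : Lp ℂ ⊤ ν) :
    isoMul (d := d) (c • k) (c • m) = c • isoMul k m := by
  refine ContinuousLinearMap.ext fun τ => funext fun i => funext fun j => ?_
  have h1 : c • k - (2 / d : ℂ) • c • m = c • (k - (2 / d : ℂ) • m) := by
    rw [smul_sub, smul_comm]
  have h2 : (2 : ℂ) • c • m = c • (2 : ℂ) • m := smul_comm _ _ _
  rw [smul_apply, Pi.smul_apply, Pi.smul_apply, isoMul_apply, isoMul_apply,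
    h1, h2, map_smul, map_smul]
  generalize ∑ l, τ l l = f
  split_ifs <;> simp only [smul_apply, smul_add, zero_add]

lemma exists_norm_isoMul_le : ∃ C : ℝ, 0 < C ∧ ∀ k m : Lp ℂ ⊤ ν,
    ‖isoMul (d := d) k m‖ ≤ C * (‖k‖ + ‖m‖) := by
  obtain ⟨A, hA, hmul⟩ : ∃ A : ℝ, 0 ≤ A ∧ ∀ (g : Lp ℂ ⊤ ν) (f : Lp ℂ 2 ν),
      ‖mulOp g f‖ ≤ A * ‖g‖ * ‖f‖ :=
    ⟨‖ContinuousLinearMap.mul ℂ ℂ‖, ContinuousLinearMap.opNorm_nonneg _, fun g f =>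
      (ContinuousLinearMap.mul ℂ ℂ).norm_holder_apply_apply_le g f⟩
  set D : ℝ := ‖(2 / d : ℂ)‖
  have hD : 0 ≤ D := norm_nonneg _
  refine ⟨A * (1 + D) * d + A * 2 + 1, by positivity, fun k m => ?_⟩
  refine ContinuousLinearMap.opNorm_le_bound _ (by positivity) fun τ => ?_
  rw [pi_norm_le_iff_of_nonneg (by positivity)]
  intro i
  rw [pi_norm_le_iff_of_nonneg (by positivity)]
  intro j
  rw [isoMul_apply]
  have h1 : ‖∑ l, τ l l‖ ≤ d * ‖τ‖ := by
    refine (norm_sum_le _ _).trans ((Finset.sum_le_sum fun l _ => norm_entry_le τ l l).trans ?_)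
    simp
  have h2 : ‖k - (2 / d : ℂ) • m‖ ≤ (1 + D) * (‖k‖ + ‖m‖) := by
    refine (norm_sub_le _ _).trans ?_
    rw [norm_smul]
    nlinarith [norm_nonneg k, norm_nonneg m, mul_nonneg hD (norm_nonneg k)]
  have h3 : ‖(2 : ℂ) • m‖ ≤ 2 * (‖k‖ + ‖m‖) := by
    rw [norm_smul]; simp
  have h4 : ‖if i = j then mulOp (k - (2 / d : ℂ) • m) (∑ l, τ l l) else 0‖ ≤
      A * ((1 + D) * (‖k‖ + ‖m‖)) * (d * ‖τ‖) := by
    split_ifs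
    · refine (hmul _ _).trans ?_
      gcongr
    · rw [norm_zero]; positivity
  have h5 : ‖mulOp ((2 : ℂ) • m) (τ i j)‖ ≤ A * (2 * (‖k‖ + ‖m‖)) * ‖τ‖ := by
    refine (hmul _ _).trans ?_
    gcongr
    exact norm_entry_le τ i j
  have h6 : 0 ≤ (‖k‖ + ‖m‖) * ‖τ‖ := by positivity
  refine (norm_add_le _ _).trans ((add_le_add h4 h5).trans ?_)
  linarith

end Multiplication

/-! ### The periodic Green operator and the Lippmann–Schwinger equation in Fourier space. -/

section Green

variable {d : ℕ} {Λ Ω : Type*} [AddCommGroup Λ] [MeasurableSpace Ω] {ν : Measure Ω}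
  [IsProbabilityMeasure ν] {E : Λ → Ω → ℂ}

namespace FourierSystem

/-- The coordinate Riesz transform. -/
def rieszCoord (hE : FourierSystem ν E) (ξ : Λ → Space d) (j : Fin d) :
    Lp ℂ 2 ν →L[ℂ] Lp ℂ 2 ν :=
  hE.riesz ξ (EuclideanSpace.single j (1 : ℝ)) (by simp)

/-- The direction of a wave vector. -/
def waveDir (ξ : Λ → Space d) (n : Λ) (j : Fin d) : ℝ := ξ n j / ‖ξ n‖

omit [AddCommGroup Λ] in
lemma sum_waveDir_sq {ξ : Λ → Space d} {n : Λ} (h : ξ n ≠ 0) : ∑ j, waveDir ξ n j ^ 2 = 1 := by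
  have hn : ‖ξ n‖ ≠ 0 := norm_ne_zero_iff.2 h
  simp only [waveDir, div_pow, ← Finset.sum_div]
  rw [div_eq_one_iff_eq (pow_ne_zero 2 hn), EuclideanSpace.norm_sq_eq]
  simp

lemma coeff_rieszCoord (hE : FourierSystem ν E) (ξ : Λ → Space d) (j : Fin d) (f : Lp ℂ 2 ν)
    (n : Λ) : hE.coeff n (hE.rieszCoord ξ j f) = waveDir ξ n j * hE.coeff n f := by
  rw [rieszCoord, riesz, coeff_mult]
  congr 2
  simp [waveDir, EuclideanSpace.inner_single_right]

/-- The entries of the periodic Green operator. -/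
def greenEntry (hE : FourierSystem ν E) (ξ : Λ → Space d) (μ0 β : ℝ) (i j : Fin d) :
    TensorField d ν →L[ℂ] Lp ℂ 2 ν :=
  ((1 / (2 * μ0) : ℝ) : ℂ) • ∑ k,
      (hE.rieszCoord ξ j ∘L (hE.rieszCoord ξ k ∘L entry i k) +
        hE.rieszCoord ξ i ∘L (hE.rieszCoord ξ k ∘L entry j k)) -
    (β : ℂ) • ∑ k, ∑ l, hE.rieszCoord ξ i ∘L (hE.rieszCoord ξ j ∘L (hE.rieszCoord ξ k ∘L
      (hE.rieszCoord ξ l ∘L entry k l)))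

/-- The periodic Green operator of an isotropic reference medium. -/
def green (hE : FourierSystem ν E) (ξ : Λ → Space d) (μ0 β : ℝ) :
    TensorField d ν →L[ℂ] TensorField d ν :=
  ContinuousLinearMap.pi fun i => ContinuousLinearMap.pi fun j => hE.greenEntry ξ μ0 β i j

lemma green_apply (hE : FourierSystem ν E) (ξ : Λ → Space d) (μ0 β : ℝ) (τ : TensorField d ν)
    (i j : Fin d) : hE.green ξ μ0 β τ i j = hE.greenEntry ξ μ0 β i j τ := rfl

lemma coeff_green (hE : FourierSystem ν E) (ξ : Λ → Space d) (μ0 β : ℝ) (τ : TensorField d ν)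
    (n : Λ) (i j : Fin d) : hE.coeff n (hE.green ξ μ0 β τ i j) =
      greenSymbol μ0 β (waveDir ξ n) (fun k l => hE.coeff n (τ k l)) i j := by
  rw [green_apply]
  simp only [greenEntry, greenSymbol, sub_apply, smul_apply, sum_apply, add_apply,
    ContinuousLinearMap.comp_apply, entry_apply, _root_.map_sub, _root_.map_smul, _root_.map_sum,
    _root_.map_add, coeff_rieszCoord, smul_eq_mul]

/-- An operator from tensor fields to functions that is bounded for the `L⁴` norms. -/
def IsBoundedFour (T : TensorField d ν →L[ℂ] Lp ℂ 2 ν) : Prop :=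
  ∃ C : ℝ≥0∞, C ≠ ⊤ ∧ ∀ τ, eLpNorm (T τ) 4 ν ≤ C * ∑ k, ∑ l, eLpNorm (τ k l) 4 ν

omit [IsProbabilityMeasure ν] in
lemma isBoundedFour_entry (i j : Fin d) : IsBoundedFour (entry (ν := ν) i j) := by
  refine ⟨1, ENNReal.one_ne_top, fun τ => ?_⟩
  rw [one_mul, entry_apply]
  exact (Finset.single_le_sum (f := fun l => eLpNorm (τ i l) 4 ν) (fun _ _ => zero_le)
    (Finset.mem_univ j)).trans (Finset.single_le_sum
      (f := fun k => ∑ l, eLpNorm (τ k l) 4 ν) (fun _ _ => zero_le) (Finset.mem_univ i))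

omit [IsProbabilityMeasure ν] in
lemma IsBoundedFour.add {S T : TensorField d ν →L[ℂ] Lp ℂ 2 ν} (hS : IsBoundedFour S)
    (hT : IsBoundedFour T) : IsBoundedFour (S + T) := by
  obtain ⟨C, hC, h⟩ := hS
  obtain ⟨D, hD, h'⟩ := hT
  refine ⟨C + D, ENNReal.add_ne_top.2 ⟨hC, hD⟩, fun τ => ?_⟩
  rw [add_apply, eLpNorm_congr_ae (Lp.coeFn_add _ _), add_mul]
  exact (eLpNorm_add_le (Lp.aestronglyMeasurable _) (Lp.aestronglyMeasurable _)
    (by norm_num)).trans (add_le_add (h τ) (h' τ))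

omit [IsProbabilityMeasure ν] in
lemma IsBoundedFour.smul {T : TensorField d ν →L[ℂ] Lp ℂ 2 ν} (hT : IsBoundedFour T) (c : ℂ) :
    IsBoundedFour (c • T) := by
  obtain ⟨C, hC, h⟩ := hT
  refine ⟨‖c‖ₑ * C, ENNReal.mul_ne_top enorm_ne_top hC, fun τ => ?_⟩
  rw [smul_apply, eLpNorm_congr_ae (Lp.coeFn_smul _ _), mul_assoc]
  exact (eLpNorm_const_smul_le).trans (by gcongr; exact h τ)

omit [IsProbabilityMeasure ν] in
lemma IsBoundedFour.sub {S T : TensorField d ν →L[ℂ] Lp ℂ 2 ν} (hS : IsBoundedFour S)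
    (hT : IsBoundedFour T) : IsBoundedFour (S - T) := by
  rw [sub_eq_add_neg, ← neg_one_smul ℂ T]
  exact hS.add (hT.smul _)

omit [IsProbabilityMeasure ν] in
lemma isBoundedFour_sum {ι : Type*} (s : Finset ι) (T : ι → TensorField d ν →L[ℂ] Lp ℂ 2 ν)
    (h : ∀ i ∈ s, IsBoundedFour (T i)) : IsBoundedFour (∑ i ∈ s, T i) := by
  refine Finset.sum_induction T IsBoundedFour (fun _ _ => IsBoundedFour.add) ?_ h
  refine ⟨0, ENNReal.zero_ne_top, fun τ => ?_⟩
  rw [zero_apply, eLpNorm_congr_ae (Lp.coeFn_zero _ _ _)]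
  simp

lemma IsBoundedFour.rieszCoord_comp [Nontrivial (Space d)] (hE : FourierSystem ν E)
    (ξ : Λ →+ Space d) (hξ : Function.Injective ξ) (j : Fin d)
    {T : TensorField d ν →L[ℂ] Lp ℂ 2 ν} (hT : IsBoundedFour T) :
    IsBoundedFour (hE.rieszCoord ξ j ∘L T) := by
  obtain ⟨C, hC, h⟩ := hT
  obtain ⟨D, hD, h'⟩ := hE.exists_eLpNorm_riesz_le ξ hξ
  refine ⟨ENNReal.ofReal D * C, ENNReal.mul_ne_top ENNReal.ofReal_ne_top hC, fun τ => ?_⟩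
  rw [mul_assoc]
  exact (h' _ (by simp) _).trans (mul_le_mul_right (h τ) _)

/-- Each entry is a linear combination of products of two or four Riesz transforms applied to
entries of the field. -/
lemma isBoundedFour_greenEntry [Nontrivial (Space d)] (hE : FourierSystem ν E)
    (ξ : Λ →+ Space d) (hξ : Function.Injective ξ) (μ0 β : ℝ) (i j : Fin d) :
    IsBoundedFour (hE.greenEntry ξ μ0 β i j) := by
  have h := fun j (T : TensorField d ν →L[ℂ] Lp ℂ 2 ν) (hT : IsBoundedFour T) =>
    hT.rieszCoord_comp hE ξ hξ j
  rw [greenEntry]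
  apply IsBoundedFour.sub
  · apply IsBoundedFour.smul
    apply isBoundedFour_sum
    intro k _
    exact (h _ _ (h _ _ (isBoundedFour_entry _ _))).add (h _ _ (h _ _ (isBoundedFour_entry _ _)))
  · apply IsBoundedFour.smul
    apply isBoundedFour_sum
    intro k _
    apply isBoundedFour_sum
    intro l _
    exact h _ _ (h _ _ (h _ _ (h _ _ (isBoundedFour_entry _ _))))

/-- The Lippmann–Schwinger equation in terms of Fourier coefficients. -/
lemma eq_sub_green (hE : FourierSystem ν E) (ξ : Λ →+ Space d) (hξ : Function.Injective ξ)
    {lam0 μ0 β : ℝ} (hμ0 : μ0 ≠ 0) (hlam : lam0 + 2 * μ0 ≠ 0)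
    (hβ : β = (lam0 + μ0) / (μ0 * (lam0 + 2 * μ0))) {v e τ : TensorField d ν}
    (he : ∀ n, n ≠ 0 → ∀ i j, hE.coeff n (e i j) = 0)
    (hcomp : ∀ n, ∃ w : Fin d → ℂ, ∀ i j,
      hE.coeff n (v i j - e i j) = (w i * ξ n j + w j * ξ n i) / 2)
    (heq : ∀ n i, ∑ j, (ξ n j : ℂ) * ((if i = j then lam0 * ∑ k, hE.coeff n (v k k) else 0) +
      2 * μ0 * hE.coeff n (v i j) + hE.coeff n (τ i j)) = 0) :
    v = e - hE.green ξ μ0 β τ := by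
  rw [eq_sub_iff_add_eq, ← eq_sub_iff_add_eq', ← neg_sub, eq_comm, neg_eq_iff_eq_neg]
  funext i j
  refine hE.ext_coeff fun n => ?_
  obtain ⟨w, hw⟩ := hcomp n
  rw [Pi.neg_apply, Pi.neg_apply, _root_.map_neg, coeff_green]
  change hE.coeff n (v i j - e i j) = _
  -- At frequency zero both sides vanish: `ξ 0 = 0` makes the compatible part zero, and `waveDir` is
  -- zero there by the convention `0 / 0 = 0`.
  rcases eq_or_ne n 0 with rfl | hn
  · rw [hw]
    simp [greenSymbol, waveDir]
  have hξn : ξ n ≠ 0 := by rwa [Ne, map_eq_zero_iff ξ hξ]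
  have hnorm : (‖ξ n‖ : ℂ) ≠ 0 := by exact_mod_cast norm_ne_zero_iff.2 hξn
  -- The symbol is written for unit wave vectors, so the length of `ξ n` is absorbed into the
  -- amplitude `w`.
  refine eq_neg_greenSymbol hμ0 hlam hβ (sum_waveDir_sq hξn) (w := fun i => w i * ‖ξ n‖)
    (e := fun i j => hE.coeff n (v i j - e i j)) (fun i j => ?_) (fun i => ?_) i j
  · rw [hw, waveDir, waveDir]
    push_cast
    field_simp
  · have h := heq n i
    simp only [_root_.map_sub, he n hn, sub_zero]
    rw [← mul_right_inj' hnorm, Finset.mul_sum, mul_zero]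
    refine (Finset.sum_congr rfl fun j _ => ?_).trans h
    rw [waveDir]
    push_cast
    field_simp

end FourierSystem

end Green

/-! ### Recovery of the shear modulus from the first-order strain. -/

lemma greenSymbol_sum {d : ℕ} {ι : Type*} (s : Finset ι) (μ0 β : ℝ) (r : Fin d → ℝ) (c : ι → ℂ)
    (τ : ι → Fin d → Fin d → ℂ) (i j : Fin d) :
    ∑ a ∈ s, c a * greenSymbol μ0 β r (τ a) i j =
      greenSymbol μ0 β r (fun k l => ∑ a ∈ s, c a * τ a k l) i j := by
  classical
  induction s using Finset.induction_on with
  | empty => simp [greenSymbol]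
  | insert a s ha ih =>
    rw [Finset.sum_insert ha, ih]
    simp only [greenSymbol_eq, Finset.sum_insert ha, mul_add, Finset.sum_add_distrib]
    have h1 : ∀ i, ∑ k, (r k : ℂ) * (c a * τ a i k) = c a * ∑ k, r k * τ a i k := fun i => by
      rw [Finset.mul_sum]; exact Finset.sum_congr rfl fun k _ => by ring
    have h2 : ∑ k, (r k : ℂ) * (c a * ∑ l, r l * τ a k l) =
        c a * ∑ k, r k * ∑ l, r l * τ a k l := by
      rw [Finset.mul_sum]
      exact Finset.sum_congr rfl fun k _ => by ring
    simp only [h1, h2]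
    ring

/-- The indices `i j` appear both in the tensor acted upon and in the entry that is read off, so
summing over them gives the full contraction of the symbol with `K`. -/
lemma greenSymbol_devProj {d : ℕ} (μ0 β : ℝ) (r : Fin d → ℝ) (z : ℂ) (i j : Fin d) :
    greenSymbol μ0 β r (fun k l => devProj d i j k l * z) i j =
      ((1 / (2 * μ0) * (∑ k, (r j * r k * devProj d i j i k + r i * r k * devProj d i j j k)) -
        β * ∑ k, ∑ l, r i * r j * r k * r l * devProj d i j k l : ℝ) : ℂ) * z := by
  rw [greenSymbol]
  push_cast
  rw [sub_mul, mul_assoc _ _ z, mul_assoc _ _ z]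
  simp only [Finset.sum_mul]
  congr 2
  · exact Finset.sum_congr rfl fun k _ => by ring
  · exact Finset.sum_congr rfl fun k _ => Finset.sum_congr rfl fun l _ => by ring

namespace FourierSystem

variable {d : ℕ} {Λ Ω : Type*} [AddCommGroup Λ] [MeasurableSpace Ω] {ν : Measure Ω}
  [IsProbabilityMeasure ν] {E : Λ → Ω → ℂ}

/-- A constant tensor as a tensor field. -/
def constField (hE : FourierSystem ν E) (τ : Tensor2 d) : TensorField d ν :=
  fun i j => (τ i j : ℂ) • hE.charLp 0

lemma coeFn_constField (hE : FourierSystem ν E) (τ : Tensor2 d) (i j : Fin d) :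
    hE.constField τ i j =ᵐ[ν] fun _ => (τ i j : ℂ) := by
  filter_upwards [Lp.coeFn_smul (τ i j : ℂ) (hE.charLp 0), (hE.memLp 0 2).coeFn_toLp] with x h1 h2
  rw [constField, h1, Pi.smul_apply, charLp, h2, hE.map_zero, smul_eq_mul, mul_one]

lemma coeff_constField (hE : FourierSystem ν E) (τ : Tensor2 d) {n : Λ} (hn : n ≠ 0)
    (i j : Fin d) : hE.coeff n (hE.constField τ i j) = 0 := by
  classical
  rw [constField, map_smul, coeff_charLp, if_neg hn, smul_zero]

/-- The bulk part acts on the trace only. Hence the first-order strain fluctuation under a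
deviatoric load depends on the shear modulus alone. -/
lemma isoMul_constField (hE : FourierSystem ν E) {τ : Tensor2 d} (hτ : τ.trace = 0)
    (k m : Lp ℂ ⊤ ν) : isoMul k m (hE.constField τ) =
      fun i j => (τ i j : ℂ) • ((2 : ℂ) • mulOp m (hE.charLp 0)) := by
  have h : ∑ l, hE.constField τ l l = 0 := by
    simp only [constField]
    rw [← Finset.sum_smul]
    have : (∑ l, (τ l l : ℂ)) = 0 := by
      rw [← Complex.ofReal_sum]
      exact_mod_cast hτ
    rw [this, zero_smul]
  funext i j
  rw [isoMul_apply, h]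
  simp only [constField, _root_.map_smul, smul_apply, _root_.map_zero, ite_self, zero_add]

/-- The contraction of the first-order strain fluctuations with the applied strains recovers the
shear modulus fluctuation. -/
lemma sum_green_eq (hE : FourierSystem ν E) (ξ : Λ →+ Space d) (hξ : Function.Injective ξ)
    {κ0 μ0 β : ℝ} (hd : 2 ≤ d) (hκ0 : 0 < κ0) (hμ0 : 0 < μ0)
    (hβ : β = ((d : ℝ) * κ0 + (d - 2) * μ0) / (μ0 * (d * κ0 + 2 * (d - 1) * μ0)))
    {ebar : Fin (nK d) → Tensor2 d} (hebar : IsDeviatoricBasis ebar) {f : Lp ℂ 2 ν}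
    (hf : hE.coeff 0 f = 0) :
    ∑ i, ∑ j, ∑ a, ((ebar a i j / tnorm (ebar a) ^ 2 : ℝ) : ℂ) •
      hE.green ξ μ0 β (fun k l => (ebar a k l : ℂ) • f) i j =
        ((1 / lamKInv d κ0 μ0 : ℝ) : ℂ) • f := by
  refine hE.ext_coeff fun n => ?_
  simp only [_root_.map_sum, _root_.map_smul, coeff_green, smul_eq_mul]
  rcases eq_or_ne n 0 with rfl | hn
  · simp [hf, greenSymbol]
  have hξn : ξ n ≠ 0 := by rwa [Ne, map_eq_zero_iff ξ hξ]
  set z := hE.coeff n f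
  -- The resolution of `K` over the basis turns the weighted sum of dyads into the projector.
  have hK : ∀ i j k l, ∑ a, ((ebar a i j / tnorm (ebar a) ^ 2 : ℝ) : ℂ) * ((ebar a k l : ℂ) * z) =
      devProj d i j k l * z := fun i j k l => by
    have h := congrFun (congrFun (congrFun (congrFun hebar.sum_eq i) j) k) l
    rw [h]
    simp only [Finset.sum_apply, Pi.smul_apply, tensorProd, smul_eq_mul, Complex.ofReal_sum,
      Finset.sum_mul]
    refine Finset.sum_congr rfl fun a _ => ?_
    push_cast
    ring
  simp only [greenSymbol_sum, hK, greenSymbol_devProj]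
  simp only [← Finset.sum_mul, ← Complex.ofReal_sum]
  congr 2
  rw [← sum_devProj_greenSymbol hd hκ0 hμ0 hβ (sum_waveDir_sq hξn)]
  simp only [Finset.sum_sub_distrib, Finset.mul_sum]

lemma eLpNorm_mulOp_charLp_le (hE : FourierSystem ν E) (m : Lp ℂ ⊤ ν) (p : ℝ≥0∞) :
    eLpNorm (mulOp m (hE.charLp 0)) p ν ≤ ENNReal.ofReal ‖m‖ := by
  have h1 : mulOp m (hE.charLp 0) =ᵐ[ν] m := by
    filter_upwards [coeFn_mulOp m (hE.charLp 0), (hE.memLp 0 2).coeFn_toLp] with x h1 h2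
    rw [h1, charLp, h2, hE.map_zero, mul_one]
  rw [eLpNorm_congr_ae h1, Lp.norm_def, ENNReal.ofReal_toReal (Lp.eLpNorm_ne_top m)]
  exact eLpNorm_le_eLpNorm_of_exponent_le le_top (Lp.aestronglyMeasurable m)

/-- The first-order strain fluctuations are bounded in `L⁴` by the modulus fluctuation. -/
lemma exists_eLpNorm_green_isoMul_constField_le [Nontrivial (Space d)] (hE : FourierSystem ν E)
    (ξ : Λ →+ Space d) (hξ : Function.Injective ξ) (μ0 β : ℝ) {τ : Tensor2 d}
    (hτ : τ.trace = 0) : ∃ C : ℝ, 0 ≤ C ∧ ∀ (k m : Lp ℂ ⊤ ν) (i j : Fin d),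
      eLpNorm (hE.green ξ μ0 β (isoMul k m (hE.constField τ)) i j) 4 ν ≤
        ENNReal.ofReal (C * ‖m‖) := by
  choose C hC h using fun i j => hE.isBoundedFour_greenEntry ξ hξ μ0 β i j
  set D : ℝ≥0∞ := (∑ i, ∑ j, C i j) * ∑ k, ∑ l, ‖(τ k l : ℂ)‖ₑ * ‖(2 : ℂ)‖ₑ with hD
  have hDt : D ≠ ⊤ := by
    refine ENNReal.mul_ne_top ?_ ?_
    · exact ENNReal.sum_ne_top.2 fun i _ => ENNReal.sum_ne_top.2 fun j _ => hC i j
    · exact ENNReal.sum_ne_top.2 fun i _ => ENNReal.sum_ne_top.2 fun j _ =>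
        ENNReal.mul_ne_top enorm_ne_top enorm_ne_top
  refine ⟨D.toReal, ENNReal.toReal_nonneg, fun k m i j => ?_⟩
  rw [ENNReal.ofReal_mul ENNReal.toReal_nonneg, ENNReal.ofReal_toReal hDt, green_apply,
    hE.isoMul_constField hτ, hD, mul_assoc]
  refine (h i j _).trans (mul_le_mul' ?_ ?_)
  · exact (Finset.single_le_sum (f := fun j => C i j) (fun _ _ => zero_le)
      (Finset.mem_univ j)).trans (Finset.single_le_sum
        (f := fun i => ∑ j, C i j) (fun _ _ => zero_le) (Finset.mem_univ i))
  · rw [Finset.sum_mul]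
    refine Finset.sum_le_sum fun k _ => ?_
    rw [Finset.sum_mul]
    refine Finset.sum_le_sum fun l _ => ?_
    rw [eLpNorm_congr_ae (Lp.coeFn_smul _ _), mul_assoc]
    refine (eLpNorm_const_smul_le).trans (mul_le_mul_right ?_ _)
    rw [eLpNorm_congr_ae (Lp.coeFn_smul _ _)]
    exact (eLpNorm_const_smul_le).trans (mul_le_mul_right (hE.eLpNorm_mulOp_charLp_le m 4) _)

end FourierSystem

/-! ### From the weak formulation to Fourier coefficients. -/

section WeakForm

variable {d : ℕ} (b : Module.Basis (Fin d) ℝ (Space d))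

lemma phase_periodic (n : Fin d → ℤ) (i : Fin d) (x : Space d) :
    phase b n (x + b i) = phase b n x + n i * (2 * Real.pi) := by
  classical
  simp only [phase, map_add, Finsupp.add_apply, mul_add, Finset.sum_add_distrib]
  congr 1
  simp [Finsupp.single_apply]
  ring

lemma isTestFunction_cos (n : Fin d → ℤ) : IsTestFunction b fun x => Real.cos (phase b n x) where
  smooth := Real.contDiff_cos.comp (contDiff_phase b n)
  periodic i x := by simp only [phase_periodic, Real.cos_add_int_mul_two_pi]

lemma isTestFunction_sin (n : Fin d → ℤ) : IsTestFunction b fun x => Real.sin (phase b n x) where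
  smooth := Real.contDiff_sin.comp (contDiff_phase b n)
  periodic i x := by simp only [phase_periodic, Real.sin_add_int_mul_two_pi]

lemma hasFDerivAt_phase (n : Fin d → ℤ) (x : Space d) :
    HasFDerivAt (phase b n) ((2 * Real.pi) • innerSL ℝ (dualVec b n)) x := by
  have h : phase b n = ((2 * Real.pi) • innerSL ℝ (dualVec b n) : Space d →L[ℝ] ℝ) := by
    ext y
    rw [phase_eq]
    simp [PiLp.inner_apply, mul_comm]
  rw [h]
  exact ContinuousLinearMap.hasFDerivAt _

lemma partialDeriv_cos (n : Fin d → ℤ) (j : Fin d) (x : Space d) :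
    partialDeriv j (fun x => Real.cos (phase b n x)) x =
      -(2 * Real.pi * dualVec b n j) * Real.sin (phase b n x) := by
  rw [partialDeriv, ((hasFDerivAt_phase b n x).cos).fderiv]
  simp [EuclideanSpace.inner_single_right]
  ring

lemma partialDeriv_sin (n : Fin d → ℤ) (j : Fin d) (x : Space d) :
    partialDeriv j (fun x => Real.sin (phase b n x)) x =
      (2 * Real.pi * dualVec b n j) * Real.cos (phase b n x) := by
  rw [partialDeriv, ((hasFDerivAt_phase b n x).sin).fderiv]
  simp [EuclideanSpace.inner_single_right]
  ring

lemma ae_cellProb : ae (cellProb b) = ae (cellMeasure b) := by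
  rw [cellProb_eq]
  exact Measure.ae_ennreal_smul_measure_eq (ENNReal.inv_ne_zero.2 (volume_cell_ne_top b)) _

lemma integrable_cell_mul_of_abs_le {f φ : Space d → ℝ} (hf : Integrable f (cellMeasure b))
    (hφ : Continuous φ) (h : ∀ x, |φ x| ≤ 1) :
    Integrable (fun x => f x * φ x) (cellMeasure b) :=
  hf.mul_bdd hφ.aestronglyMeasurable (c := 1) (ae_of_all _ h)

lemma integrable_mul_cos {f : Space d → ℝ} (hf : Integrable f (cellMeasure b)) (n : Fin d → ℤ) :
    Integrable (fun x => f x * Real.cos (phase b n x)) (cellMeasure b) :=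
  integrable_cell_mul_of_abs_le b hf (Real.continuous_cos.comp (contDiff_phase b n).continuous)
    fun _ => Real.abs_cos_le_one _

lemma integrable_mul_sin {f : Space d → ℝ} (hf : Integrable f (cellMeasure b)) (n : Fin d → ℤ) :
    Integrable (fun x => f x * Real.sin (phase b n x)) (cellMeasure b) :=
  integrable_cell_mul_of_abs_le b hf (Real.continuous_sin.comp (contDiff_phase b n).continuous)
    fun _ => Real.abs_sin_le_one _

lemma integrable_of_ae_eq {F : Lp ℂ 2 (cellProb b)} {f : Space d → ℝ}
    (h : F =ᵐ[cellProb b] fun x => (f x : ℂ)) : Integrable f (cellMeasure b) := by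
  have h1 : Integrable F (cellProb b) := (Lp.memLp F).integrable (by norm_num)
  have h2 : Integrable f (cellProb b) := by
    refine (h1.re).congr ?_
    filter_upwards [h] with x hx
    rw [hx]; simp
  rw [cellMeasure_eq]
  exact h2.smul_measure (volume_cell_ne_top b)

/-- The Fourier coefficients of a real function in terms of its cosine and sine moments. -/
lemma coeff_eq_cos_sin {F : Lp ℂ 2 (cellProb b)} {f : Space d → ℝ}
    (h : F =ᵐ[cellProb b] fun x => (f x : ℂ)) (n : Fin d → ℤ) :
    (fourierSystem_cell b).coeff n F = ((volume (ZSpan.fundamentalDomain b)).toReal : ℂ)⁻¹ *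
      ((∫ x, f x * Real.cos (phase b n x) ∂cellMeasure b : ℝ) -
        (∫ x, f x * Real.sin (phase b n x) ∂cellMeasure b : ℝ) * Complex.I) := by
  have hf := integrable_of_ae_eq b h
  rw [FourierSystem.coeff_eq_integral]
  have h1 : ∫ x, F x * cellChar b (-n) x ∂cellProb b =
      ∫ x, (((f x * Real.cos (phase b n x) : ℝ) : ℂ) -
        ((f x * Real.sin (phase b n x) : ℝ) : ℂ) * Complex.I) ∂cellProb b := by
    refine integral_congr_ae ?_
    filter_upwards [h] with x hx
    rw [hx, cellChar, phase_neg, Complex.exp_mul_I]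
    push_cast
    rw [Complex.cos_neg, Complex.sin_neg]
    ring
  rw [h1, cellProb_eq, integral_smul_measure, integral_sub
    (integrable_mul_cos b hf n).ofReal ((integrable_mul_sin b hf n).ofReal.mul_const _),
    integral_mul_const, integral_complex_ofReal, integral_complex_ofReal, ENNReal.toReal_inv, Complex.real_smul]
  push_cast
  rfl

variable {b}

/-- The test functions are real, so a character is tested through its cosine and its sine
separately. -/
lemma IsWeakSymGrad.exists_coeff {u : Space d → Space d} {e : Space d → Tensor2 d}
    (hu : ∀ i, MemLp (fun x => u x i) 2 (cellMeasure b)) (h : IsWeakSymGrad b u e)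
    {F : TensorField d (cellProb b)} (hF : ∀ i j, F i j =ᵐ[cellProb b] fun x => (e x i j : ℂ))
    (n : Fin d → ℤ) : ∃ w : Fin d → ℂ, ∀ i j, (fourierSystem_cell b).coeff n (F i j) =
      (w i * dualVec b n j + w j * dualVec b n i) / 2 := by
  have hi : ∀ i, Integrable (fun x => u x i) (cellMeasure b) := fun i =>
    (hu i).integrable (by norm_num)
  set S : Fin d → ℝ := fun i => ∫ x, u x i * Real.sin (phase b n x) ∂cellMeasure b with hS
  set C : Fin d → ℝ := fun i => ∫ x, u x i * Real.cos (phase b n x) ∂cellMeasure b with hC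
  -- This is `2πi` times the Fourier coefficient of the displacement, written in cosine and sine
  -- moments.
  refine ⟨fun i => ((volume (ZSpan.fundamentalDomain b)).toReal : ℂ)⁻¹ *
    (2 * Real.pi * (S i + C i * Complex.I)), fun i j => ?_⟩
  have hc : ∫ x, e x i j * Real.cos (phase b n x) ∂cellMeasure b =
      Real.pi * (dualVec b n j * S i + dualVec b n i * S j) := by
    rw [h _ (isTestFunction_cos b n) i j, ← integral_neg]
    simp only [partialDeriv_cos, hS, ← integral_const_mul]
    rw [← integral_add ((integrable_mul_sin b (hi i) n).const_mul _)
      ((integrable_mul_sin b (hi j) n).const_mul _), ← integral_const_mul]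
    exact integral_congr_ae (ae_of_all _ fun x => by ring)
  have hs : ∫ x, e x i j * Real.sin (phase b n x) ∂cellMeasure b =
      -Real.pi * (dualVec b n j * C i + dualVec b n i * C j) := by
    rw [h _ (isTestFunction_sin b n) i j, ← integral_neg]
    simp only [partialDeriv_sin, hC, ← integral_const_mul]
    rw [← integral_add ((integrable_mul_cos b (hi i) n).const_mul _)
      ((integrable_mul_cos b (hi j) n).const_mul _), ← integral_const_mul]
    exact integral_congr_ae (ae_of_all _ fun x => by ring)
  rw [coeff_eq_cos_sin b (hF i j) n, hc, hs]
  push_cast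
  ring

/-- The gradient of a cosine is a sine along the dual vector, and conversely; each of the two tests
gives one of the real relations that make up the complex one. -/
lemma IsWeakDivFree.sum_coeff_eq_zero {σ : Space d → Tensor2 d} (h : IsWeakDivFree b σ)
    {F : TensorField d (cellProb b)} (hF : ∀ i j, F i j =ᵐ[cellProb b] fun x => (σ x i j : ℂ))
    (n : Fin d → ℤ) (i : Fin d) :
    ∑ j, (dualVec b n j : ℂ) * (fourierSystem_cell b).coeff n (F i j) = 0 := by
  have hi : ∀ j, Integrable (fun x => σ x i j) (cellMeasure b) := fun j =>
    integrable_of_ae_eq b (hF i j)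
  have hpi : (2 * Real.pi) ≠ 0 := by positivity
  have hc : ∑ j, dualVec b n j * ∫ x, σ x i j * Real.sin (phase b n x) ∂cellMeasure b = 0 := by
    have h1 := h _ (isTestFunction_cos b n) i
    simp only [partialDeriv_cos] at h1
    have h2 : ∀ x, ∑ j, σ x i j * (-(2 * Real.pi * dualVec b n j) * Real.sin (phase b n x)) =
        -(2 * Real.pi) * ∑ j, dualVec b n j * (σ x i j * Real.sin (phase b n x)) := fun x => by
      rw [Finset.mul_sum]; exact Finset.sum_congr rfl fun j _ => by ring
    simp only [h2] at h1
    rw [integral_const_mul, integral_finsetSum _ fun j _ =>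
      (integrable_mul_sin b (hi j) n).const_mul _] at h1
    simpa only [integral_const_mul, mul_eq_zero, neg_eq_zero, hpi, false_or] using h1
  have hs : ∑ j, dualVec b n j * ∫ x, σ x i j * Real.cos (phase b n x) ∂cellMeasure b = 0 := by
    have h1 := h _ (isTestFunction_sin b n) i
    simp only [partialDeriv_sin] at h1
    have h2 : ∀ x, ∑ j, σ x i j * ((2 * Real.pi * dualVec b n j) * Real.cos (phase b n x)) =
        (2 * Real.pi) * ∑ j, dualVec b n j * (σ x i j * Real.cos (phase b n x)) := fun x => by
      rw [Finset.mul_sum]; exact Finset.sum_congr rfl fun j _ => by ring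
    simp only [h2] at h1
    rw [integral_const_mul, integral_finsetSum _ fun j _ =>
      (integrable_mul_cos b (hi j) n).const_mul _] at h1
    simpa only [integral_const_mul, mul_eq_zero, hpi, false_or] using h1
  have h3 : ∀ j, (dualVec b n j : ℂ) * (fourierSystem_cell b).coeff n (F i j) =
      ((volume (ZSpan.fundamentalDomain b)).toReal : ℂ)⁻¹ *
      (((dualVec b n j * ∫ x, σ x i j * Real.cos (phase b n x) ∂cellMeasure b : ℝ) : ℂ) -
      ((dualVec b n j * ∫ x, σ x i j * Real.sin (phase b n x) ∂cellMeasure b : ℝ) : ℂ) *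
        Complex.I) := fun j => by
    rw [coeff_eq_cos_sin b (hF i j) n]
    push_cast
    ring
  simp only [h3]
  rw [← Finset.mul_sum, Finset.sum_sub_distrib, ← Finset.sum_mul, ← Complex.ofReal_sum,
    ← Complex.ofReal_sum, hc, hs]
  simp

lemma isoElasticity_app {κ μ : ℝ} {τ : Tensor2 d} (hτ : τ.IsSymm) (hd : d ≠ 0) (i j : Fin d) :
    (isoElasticity d κ μ).app τ i j =
      (if i = j then (κ - 2 / d * μ) * τ.trace else 0) + 2 * μ * τ i j := by
  have hd' : (d : ℝ) ≠ 0 := by exact_mod_cast hd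
  have hK : ∀ k l : Fin d, isoElasticity d κ μ i j k l * τ k l =
      μ * (if i = k then if j = l then τ k l else 0 else 0) +
        μ * (if i = l then if j = k then τ k l else 0 else 0) +
        (κ - 2 / d * μ) * (if k = l then if i = j then τ k l else 0 else 0) := fun k l => by
    simp only [isoElasticity, devProj, symId, sphProj, Pi.sub_apply, Pi.add_apply, Pi.smul_apply,
      smul_eq_mul]
    split_ifs <;> field_simp <;> ring
  simp only [Tensor4.app, Matrix.of_apply, hK, Finset.sum_add_distrib, ← Finset.mul_sum]
  have h1 : ∑ k, ∑ l, (if i = k then if j = l then τ k l else 0 else 0) = τ i j := by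
    simp only [Finset.sum_ite_irrel, Finset.sum_const_zero, Finset.sum_ite_eq, Finset.mem_univ,
      if_true]
  have h2 : ∑ k, ∑ l, (if i = l then if j = k then τ k l else 0 else 0) = τ i j := by
    simp only [Finset.sum_ite_eq, Finset.mem_univ, if_true]
    exact hτ.apply i j
  have h3 : ∑ k, ∑ l, (if k = l then if i = j then τ k l else 0 else 0) =
      if i = j then τ.trace else 0 := by
    simp only [Finset.sum_ite_eq, Finset.mem_univ, if_true, Finset.sum_ite_irrel,
      Finset.sum_const_zero]
    rfl
  rw [h1, h2, h3]
  split_ifs <;> ring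

/-- The constant `β` of the Green operator of the reference medium. -/
def greenConst (d : ℕ) (κ0 μ0 : ℝ) : ℝ :=
  ((d : ℝ) * κ0 + (d - 2) * μ0) / (μ0 * (d * κ0 + 2 * (d - 1) * μ0))

/-- The strain field of a medium solves the Lippmann–Schwinger equation. -/
theorem lippmann_schwinger {κ0 μ0 : ℝ} (hd : 2 ≤ d) (hκ0 : 0 < κ0) (hμ0 : 0 < μ0)
    {κ μ : Space d → ℝ} {ebar : Tensor2 d} {ε : Space d → Tensor2 d}
    (hs : IsStrainSolution b κ μ ebar ε) {K M : Lp ℂ ⊤ (cellProb b)}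
    (hK : K =ᵐ[cellProb b] fun x => ((κ x - κ0 : ℝ) : ℂ))
    (hM : M =ᵐ[cellProb b] fun x => ((μ x - μ0 : ℝ) : ℂ))
    {v : TensorField d (cellProb b)} (hv : ∀ i j, v i j =ᵐ[cellProb b] fun x => (ε x i j : ℂ)) :
    v = (fourierSystem_cell b).constField ebar -
      (fourierSystem_cell b).green (dualVec b) μ0 (greenConst d κ0 μ0) (isoMul K M v) := by
  classical
  set hE := fourierSystem_cell b
  have hd' : (2 : ℝ) ≤ d := by exact_mod_cast hd
  have hd0 : (d : ℝ) ≠ 0 := by linarith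
  -- The first Lamé constant of the reference medium in dimension `d`.
  set lam0 : ℝ := κ0 - 2 / d * μ0 with hlam0
  have hl : lam0 + 2 * μ0 = (d * κ0 + 2 * (d - 1) * μ0) / d := by
    rw [hlam0]; field_simp; ring
  have hlpos : 0 < lam0 + 2 * μ0 := by
    rw [hl]; apply div_pos <;> nlinarith
  refine hE.eq_sub_green (dualVec b) (dualVec_injective b) (lam0 := lam0) hμ0.ne' hlpos.ne' ?_
    (fun n hn i j => hE.coeff_constField ebar hn i j) ?_ ?_
  · have : lam0 + μ0 = (d * κ0 + (d - 2) * μ0) / d := by rw [hlam0]; field_simp; ring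
    rw [this, hl, greenConst]
    field_simp
  · obtain ⟨u, -, hu, hgrad⟩ := hs.compatible
    refine fun n => hgrad.exists_coeff hu (F := fun i j => v i j - hE.constField ebar i j) ?_ n
    intro i j
    filter_upwards [hv i j, hE.coeFn_constField ebar i j,
      Lp.coeFn_sub (v i j) (hE.constField ebar i j)] with x h1 h2 h3
    rw [h3, Pi.sub_apply, h1, h2]
    simp
  -- `F` is the total stress, split into the reference medium acting on the strain and the
  -- polarization `isoMul K M v`.
  · set F : TensorField d (cellProb b) := fun i j =>
      (if i = j then (lam0 : ℂ) • ∑ k, v k k else 0) + (2 * μ0 : ℂ) • v i j + isoMul K M v i j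
    have hF : ∀ i j, F i j =ᵐ[cellProb b]
        fun x => (((isoElasticity d (κ x) (μ x)).app (ε x) i j : ℝ) : ℂ) := by
      intro i j
      have hv' : ∀ᵐ x ∂cellProb b, ∀ i j, v i j x = (ε x i j : ℂ) :=
        ae_all_iff.2 fun i => ae_all_iff.2 fun j => hv i j
      have hsum : (∑ k, v k k : Lp ℂ 2 (cellProb b)) =ᵐ[cellProb b]
          fun x => ((ε x).trace : ℂ) := by
        filter_upwards [Lp.coeFn_finsetSum Finset.univ fun k => v k k, hv'] with x h1 h2
        rw [h1, Finset.sum_apply, Matrix.trace, Complex.ofReal_sum]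
        exact Finset.sum_congr rfl fun k _ => h2 k k
      have hA : (if i = j then (lam0 : ℂ) • ∑ k, v k k else 0 : Lp ℂ 2 (cellProb b))
          =ᵐ[cellProb b] fun x => if i = j then (lam0 : ℂ) * ((ε x).trace : ℂ) else 0 := by
        split_ifs
        · filter_upwards [Lp.coeFn_smul (lam0 : ℂ) (∑ k, v k k : Lp ℂ 2 (cellProb b)), hsum]
            with x h1 h2
          rw [h1, Pi.smul_apply, h2, smul_eq_mul]
        · exact Lp.coeFn_zero _ _ _
      have hB : (if i = j then mulOp (K - (2 / d : ℂ) • M) (∑ l, v l l) else 0 :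
          Lp ℂ 2 (cellProb b)) =ᵐ[cellProb b] fun x => if i = j then
            (((κ x - κ0 : ℝ) : ℂ) - 2 / d * ((μ x - μ0 : ℝ) : ℂ)) * ((ε x).trace : ℂ) else 0 := by
        split_ifs
        · filter_upwards [coeFn_mulOp (K - (2 / d : ℂ) • M) (∑ l, v l l), hsum, hK, hM,
            Lp.coeFn_sub K ((2 / d : ℂ) • M), Lp.coeFn_smul (2 / d : ℂ) M] with x h1 h2 h3 h4 h5 h6
          rw [h1, h2, h5, Pi.sub_apply, h6, Pi.smul_apply, h3, h4, smul_eq_mul]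
        · exact Lp.coeFn_zero _ _ _
      have hC : mulOp ((2 : ℂ) • M) (v i j) =ᵐ[cellProb b]
          fun x => 2 * ((μ x - μ0 : ℝ) : ℂ) * (ε x i j : ℂ) := by
        filter_upwards [coeFn_mulOp ((2 : ℂ) • M) (v i j), hv i j, hM,
          Lp.coeFn_smul (2 : ℂ) M] with x h1 h2 h3 h4
        rw [h1, h2, h4, Pi.smul_apply, h3, smul_eq_mul]
      have hF1 : F i j = ((if i = j then (lam0 : ℂ) • ∑ k, v k k else 0) + (2 * μ0 : ℂ) • v i j) +
          ((if i = j then mulOp (K - (2 / d : ℂ) • M) (∑ l, v l l) else 0) +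
            mulOp ((2 : ℂ) • M) (v i j)) := by
        rw [← isoMul_apply]
      rw [hF1]
      refine (Lp.coeFn_add _ _).trans ?_
      filter_upwards [Lp.coeFn_add (if i = j then (lam0 : ℂ) • ∑ k, v k k else 0)
        ((2 * μ0 : ℂ) • v i j), Lp.coeFn_add
          (if i = j then mulOp (K - (2 / d : ℂ) • M) (∑ l, v l l) else 0)
          (mulOp ((2 : ℂ) • M) (v i j)), Lp.coeFn_smul (2 * μ0 : ℂ) (v i j), hA, hB, hC, hv i j]
        with x h1 h2 h3 h4 h5 h6 h7
      rw [Pi.add_apply, h1, h2, Pi.add_apply, Pi.add_apply, h3, Pi.smul_apply, h4, h5, h6, h7,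
        isoElasticity_app (hs.symm x) (by omega), smul_eq_mul, hlam0]
      split_ifs <;> push_cast <;> ring
    intro n i
    refine (Finset.sum_congr rfl fun j _ => ?_).trans
      (hs.equilibrium.sum_coeff_eq_zero hF n i)
    congr 1
    change _ = hE.coeff n ((if i = j then (lam0 : ℂ) • ∑ k, v k k else 0) +
      (2 * μ0 : ℂ) • v i j + isoMul K M v i j)
    rw [map_add, map_add, map_smul, smul_eq_mul]
    congr 2
    split_ifs
    · rw [map_smul, map_sum, smul_eq_mul]
    · rw [map_zero]

end WeakForm

/-! ### Pointwise expansion of the reconstruction formulae. -/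

section Pointwise

open scoped RealInnerProductSpace in
/-- First-order expansion of the norm, with a rough part and a small part of the increment. -/
lemma abs_norm_add_sub_le {V : Type*} [NormedAddCommGroup V] [InnerProductSpace ℝ V] {x : V}
    (hx : x ≠ 0) (g h : V) :
    |‖x + g + h‖ - ‖x‖ - ⟪g + h, x⟫ / ‖x‖| ≤ ‖g‖ ^ 2 / (2 * ‖x‖) + 2 * ‖h‖ := by
  have hx0 : 0 < ‖x‖ := norm_pos_iff.2 hx
  have h1 : |‖x + g‖ - ‖x‖ - ⟪g, x⟫ / ‖x‖| ≤ ‖g‖ ^ 2 / (2 * ‖x‖) := by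
    have e1 : ‖x + g‖ ^ 2 = ‖x‖ ^ 2 + 2 * ⟪g, x⟫ + ‖g‖ ^ 2 := by
      rw [norm_add_sq_real, real_inner_comm]
    -- An exact identity, so `g` need not be small: the first-order strain fluctuation is controlled
    -- in `L⁴`, not uniformly.
    have e2 : ‖x + g‖ - ‖x‖ - ⟪g, x⟫ / ‖x‖ =
        (‖g‖ ^ 2 - (‖x + g‖ - ‖x‖) ^ 2) / (2 * ‖x‖) := by
      field_simp
      linarith
    have e3 : (‖x + g‖ - ‖x‖) ^ 2 ≤ ‖g‖ ^ 2 := by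
      rw [sq_le_sq, abs_norm]
      simpa using abs_norm_sub_norm_le (x + g) x
    rw [e2, abs_of_nonneg (div_nonneg (by linarith) (by positivity))]
    gcongr
    nlinarith [sq_nonneg (‖x + g‖ - ‖x‖)]
  -- Only the Lipschitz property is used for `h`, which is controlled in `L²` only and must not be
  -- squared.
  have h2 : |‖x + g + h‖ - ‖x + g‖| ≤ ‖h‖ := by
    simpa using abs_norm_sub_norm_le (x + g + h) (x + g)
  have h3 : |⟪h, x⟫ / ‖x‖| ≤ ‖h‖ := by
    rw [abs_div, abs_norm, div_le_iff₀ hx0]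
    exact abs_real_inner_le_norm h x
  have e : ‖x + g + h‖ - ‖x‖ - ⟪g + h, x⟫ / ‖x‖ = (‖x + g‖ - ‖x‖ - ⟪g, x⟫ / ‖x‖) +
      (‖x + g + h‖ - ‖x + g‖) - ⟪h, x⟫ / ‖x‖ := by
    rw [inner_add_left]; ring
  rw [e]
  calc _ ≤ |‖x + g‖ - ‖x‖ - ⟪g, x⟫ / ‖x‖| + |‖x + g + h‖ - ‖x + g‖| + |⟪h, x⟫ / ‖x‖| :=
        (abs_sub _ _).trans (add_le_add_left (abs_add_le _ _) _)
    _ ≤ _ := by linarith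

variable {d : ℕ}

/-- A second-order tensor as a vector. -/
def tensorVec : Tensor2 d →ₗ[ℝ] EuclideanSpace ℝ (Fin d × Fin d) where
  toFun τ := WithLp.toLp 2 fun p => τ p.1 p.2
  map_add' _ _ := rfl
  map_smul' _ _ := rfl

lemma tensorVec_apply (τ : Tensor2 d) (i j : Fin d) : tensorVec τ (i, j) = τ i j := rfl

open scoped RealInnerProductSpace in
lemma inner_tensorVec (σ τ : Tensor2 d) : ⟪tensorVec σ, tensorVec τ⟫ = ddot σ τ := by
  simp [tensorVec_apply, PiLp.inner_apply, ddot, Fintype.sum_prod_type, mul_comm]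

lemma norm_tensorVec (τ : Tensor2 d) : ‖tensorVec τ‖ = tnorm τ := by
  rw [tnorm, ← inner_tensorVec, norm_eq_sqrt_real_inner]

lemma tnorm_sq (τ : Tensor2 d) : tnorm τ ^ 2 = ∑ i, ∑ j, τ i j ^ 2 := by
  rw [tnorm, Real.sq_sqrt]
  · simp only [ddot, sq]
  · exact Finset.sum_nonneg fun i _ => Finset.sum_nonneg fun j _ => mul_self_nonneg _

lemma tnorm_nonneg (τ : Tensor2 d) : 0 ≤ tnorm τ := Real.sqrt_nonneg _

lemma tnorm_pos {τ : Tensor2 d} (h : τ ≠ 0) : 0 < tnorm τ := by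
  rw [← norm_tensorVec, norm_pos_iff]
  intro h0
  apply h
  ext i j
  exact congrFun (congrArg WithLp.ofLp h0) (i, j)

lemma tnorm_le_sum (τ : Tensor2 d) : tnorm τ ≤ ∑ i, ∑ j, |τ i j| := by
  have h0 : 0 ≤ ∑ i, ∑ j, |τ i j| :=
    Finset.sum_nonneg fun i _ => Finset.sum_nonneg fun j _ => abs_nonneg _
  refine le_of_sq_le_sq ?_ h0
  rw [tnorm_sq]
  simp only [← Fintype.sum_prod_type' (f := fun i j => τ i j ^ 2),
    ← Fintype.sum_prod_type' (f := fun i j => |τ i j|)]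
  refine le_trans (le_of_eq ?_) (Finset.sum_sq_le_sq_sum_of_nonneg fun p _ => abs_nonneg _)
  exact Finset.sum_congr rfl fun p _ => (sq_abs _).symm

lemma dev_of_trace_eq_zero {τ : Tensor2 d} (h : τ.trace = 0) : dev τ = τ := by
  simp [dev, h]

lemma dev_add (σ τ : Tensor2 d) : dev (σ + τ) = dev σ + dev τ := by
  simp only [dev, Matrix.trace_add, add_div, add_smul]
  abel

lemma ddot_one_left (τ : Tensor2 d) : ddot 1 τ = τ.trace := by
  simp [ddot, Matrix.one_apply, Matrix.trace]

lemma ddot_add_left (σ τ ρ : Tensor2 d) : ddot (σ + τ) ρ = ddot σ ρ + ddot τ ρ := by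
  simp only [← inner_tensorVec, map_add, inner_add_left]

lemma ddot_comm (σ τ : Tensor2 d) : ddot σ τ = ddot τ σ := by
  simp only [ddot, mul_comm]

lemma ddot_dev_left (σ τ : Tensor2 d) :
    ddot (dev σ) τ = ddot σ τ - σ.trace / d * τ.trace := by
  rw [← ddot_one_left τ]
  simp only [← inner_tensorVec, dev, map_sub, map_smul, inner_sub_left, inner_smul_left]
  simp

lemma ddot_dev_dev {σ τ : Tensor2 d} (h : τ.trace = 0) : ddot (dev σ) (dev τ) = ddot σ τ := by
  rw [dev_of_trace_eq_zero h, ddot_dev_left, h, mul_zero, sub_zero]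

/-- `dev` is an orthogonal projection: `dev τ : dev τ = τ : τ - (tr τ)² / d`. -/
lemma tnorm_dev_le (hd : d ≠ 0) (τ : Tensor2 d) : tnorm (dev τ) ≤ tnorm τ := by
  have hd' : (0 : ℝ) < d := by positivity
  refine Real.sqrt_le_sqrt ?_
  have h1 : (dev τ).trace = 0 := by
    simp only [dev, Matrix.trace_sub, Matrix.trace_smul, Matrix.trace_one, Fintype.card_fin,
      smul_eq_mul]
    field_simp
    ring
  rw [ddot_dev_left, h1, mul_zero, sub_zero, ddot_comm, ddot_dev_left]
  have : 0 ≤ τ.trace / d * τ.trace := by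
    rw [div_mul_eq_mul_div]; exact div_nonneg (mul_self_nonneg _) hd'.le
  linarith

/-- The factor `(d - 1) / d` cancels, so equivalent strains enter only through a ratio of tensor
norms. -/
lemma eqStrain_div (hd : 2 ≤ d) {σ τ : Tensor2 d} (h : τ.trace = 0) :
    eqStrain σ / eqStrain τ = tnorm (dev σ) / tnorm τ := by
  have hd' : (2 : ℝ) ≤ d := by exact_mod_cast hd
  have hc : (0 : ℝ) < ((d : ℝ) - 1) / d := div_pos (by linarith) (by linarith)
  rw [eqStrain, eqStrain, Real.sqrt_mul hc.le, Real.sqrt_mul hc.le, dev_of_trace_eq_zero h,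
    mul_div_mul_left _ _ (Real.sqrt_ne_zero'.2 hc)]
  rfl

lemma abs_trace_le (τ : Tensor2 d) : |τ.trace| ≤ ∑ i, ∑ j, |τ i j| := by
  refine (Finset.abs_sum_le_sum_abs _ _).trans (Finset.sum_le_sum fun i _ => ?_)
  exact Finset.single_le_sum (f := fun j => |τ i j|) (fun _ _ => abs_nonneg _) (Finset.mem_univ i)

/-- Pointwise bounds for the remainders of the reconstruction formulae. -/
lemma exists_remainder_le (hd : 2 ≤ d) (κ0 μ0 : ℝ) {ebar : Fin (nK d) → Tensor2 d}
    (hebar : IsDeviatoricBasis ebar) : ∃ C : ℝ, 0 ≤ C ∧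
      ∀ (μ : ℝ) (ε g h : Fin (nK d) → Tensor2 d), (∀ a, ε a = ebar a + g a + h a) →
        μ - μ0 = -(lamKInv d κ0 μ0 / 2 * ∑ a, ddot (g a) (ebar a) / tnorm (ebar a) ^ 2) →
        |μ - shearFromDev κ0 μ0 ebar ε| ≤ C * ∑ a, ∑ i, ∑ j, (|h a i j| + |g a i j| ^ 2) ∧
        |μ - shearFromEq κ0 μ0 ebar ε| ≤ C * ∑ a, ∑ i, ∑ j, (|h a i j| + |g a i j| ^ 2) ∧
        ∀ a, |hydroStrain (ε a)| ≤ C * ∑ a, ∑ i, ∑ j, (|g a i j| + |h a i j|) := by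
  have hd' : (2 : ℝ) ≤ d := by exact_mod_cast hd
  set N : Fin (nK d) → ℝ := fun a => tnorm (ebar a) with hN
  have hNpos : ∀ a, 0 < N a := fun a => tnorm_pos (hebar.ne_zero a)
  set L : ℝ := |lamKInv d κ0 μ0 / 2|
  have hL : 0 ≤ L := abs_nonneg _
  -- After division by `N a`, the norm expansion contributes `1 / (2 N²)` from the square of `g` and
  -- `2 / N` from `h`; the linear term in `h` contributes another `1 / N`.
  set D : ℝ := ∑ a, (3 / N a + 1 / (2 * N a ^ 2)) with hD
  have hDa : ∀ a, 0 ≤ 3 / N a + 1 / (2 * N a ^ 2) := fun a => by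
    have := hNpos a; positivity
  have hD0 : 0 ≤ D := Finset.sum_nonneg fun a _ => hDa a
  -- The added 1 serves the hydrostatic bound, whose constant is not related to `L * D`.
  refine ⟨L * D + 1, by positivity, fun μ ε g h hε hμ => ?_⟩
  set T := ∑ a, ∑ i, ∑ j, (|h a i j| + |g a i j| ^ 2) with hT
  set U := ∑ a, ∑ i, ∑ j, (|g a i j| + |h a i j|) with hU
  have hT0 : 0 ≤ T := Finset.sum_nonneg fun a _ => Finset.sum_nonneg fun i _ =>
    Finset.sum_nonneg fun j _ => by positivity
  have hU0 : 0 ≤ U := Finset.sum_nonneg fun a _ => Finset.sum_nonneg fun i _ =>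
    Finset.sum_nonneg fun j _ => by positivity
  have hTa : ∀ a, ∑ i, ∑ j, (|h a i j| + |g a i j| ^ 2) ≤ T := fun a =>
    Finset.single_le_sum (f := fun a => ∑ i, ∑ j, (|h a i j| + |g a i j| ^ 2))
      (fun a _ => Finset.sum_nonneg fun i _ => Finset.sum_nonneg fun j _ => by positivity)
      (Finset.mem_univ a)
  have hUa : ∀ a, ∑ i, ∑ j, (|g a i j| + |h a i j|) ≤ U := fun a =>
    Finset.single_le_sum (f := fun a => ∑ i, ∑ j, (|g a i j| + |h a i j|))
      (fun a _ => Finset.sum_nonneg fun i _ => Finset.sum_nonneg fun j _ => by positivity)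
      (Finset.mem_univ a)
  have hh : ∀ a, tnorm (h a) ≤ T := fun a => by
    refine (tnorm_le_sum _).trans (le_trans ?_ (hTa a))
    exact Finset.sum_le_sum fun i _ => Finset.sum_le_sum fun j _ =>
      le_add_of_nonneg_right (by positivity)
  have hg : ∀ a, tnorm (g a) ^ 2 ≤ T := fun a => by
    rw [tnorm_sq]
    refine le_trans ?_ (hTa a)
    exact Finset.sum_le_sum fun i _ => Finset.sum_le_sum fun j _ => by
      rw [sq_abs]; exact le_add_of_nonneg_left (abs_nonneg _)
  have hee : ∀ a, ddot (ebar a) (ebar a) = N a ^ 2 := fun a => by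
    rw [tnorm_sq]; simp only [ddot, sq]
  have h1 : ∀ a, ddot (dev (ε a)) (dev (ebar a)) / N a ^ 2 =
      1 + ddot (g a) (ebar a) / N a ^ 2 + ddot (h a) (ebar a) / N a ^ 2 := fun a => by
    have := (hNpos a).ne'
    rw [ddot_dev_dev (hebar.trace_eq_zero a), hε, ddot_add_left, ddot_add_left, hee]
    field_simp
  have hhe : ∀ a, |ddot (h a) (ebar a) / N a ^ 2| ≤ 1 / N a * T := fun a => by
    have hp := hNpos a
    have : |ddot (h a) (ebar a)| ≤ tnorm (h a) * N a := by
      simp only [hN, ← inner_tensorVec, ← norm_tensorVec]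
      exact abs_real_inner_le_norm _ _
    rw [abs_div, abs_of_pos (pow_pos hp 2), div_le_iff₀ (pow_pos hp 2)]
    calc _ ≤ tnorm (h a) * N a := this
      _ ≤ T * N a := by gcongr; exact hh a
      _ = _ := by field_simp
  have hsum : ∀ (f : Fin (nK d) → ℝ), (∀ a, |f a| ≤ (3 / N a + 1 / (2 * N a ^ 2)) * T) →
      |lamKInv d κ0 μ0 / 2 * ∑ a, f a| ≤ (L * D + 1) * T := fun f hf => by
    rw [abs_mul]
    calc L * |∑ a, f a| ≤ L * ∑ a, (3 / N a + 1 / (2 * N a ^ 2)) * T := by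
          gcongr
          exact (Finset.abs_sum_le_sum_abs _ _).trans (Finset.sum_le_sum fun a _ => hf a)
      _ = L * D * T := by rw [← Finset.sum_mul, mul_assoc]
      _ ≤ _ := by linarith
  refine ⟨?_, ?_, fun a => ?_⟩
  · have e : μ - shearFromDev κ0 μ0 ebar ε =
        lamKInv d κ0 μ0 / 2 * ∑ a, ddot (h a) (ebar a) / N a ^ 2 := by
      have : ∑ a, (1 - ddot (dev (ε a)) (dev (ebar a)) / N a ^ 2) =
          -(∑ a, ddot (g a) (ebar a) / N a ^ 2) - ∑ a, ddot (h a) (ebar a) / N a ^ 2 := by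
        rw [← Finset.sum_neg_distrib, ← Finset.sum_sub_distrib]
        exact Finset.sum_congr rfl fun a _ => by rw [h1]; ring
      rw [shearFromDev, this, ← sub_sub, hμ]
      ring
    rw [e]
    refine hsum _ fun a => (hhe a).trans ?_
    have hp := hNpos a
    gcongr
    have : 1 / N a ≤ 3 / N a := by gcongr; norm_num
    have h2 : 0 ≤ 1 / (2 * N a ^ 2) := by positivity
    linarith
  · have e : μ - shearFromEq κ0 μ0 ebar ε = lamKInv d κ0 μ0 / 2 *
        ∑ a, (tnorm (dev (ε a)) / N a - 1 - ddot (g a) (ebar a) / N a ^ 2) := by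
      have : ∑ a, (1 - eqStrain (ε a) / eqStrain (ebar a)) =
          -(∑ a, ddot (g a) (ebar a) / N a ^ 2) -
            ∑ a, (tnorm (dev (ε a)) / N a - 1 - ddot (g a) (ebar a) / N a ^ 2) := by
        rw [← Finset.sum_neg_distrib, ← Finset.sum_sub_distrib]
        exact Finset.sum_congr rfl fun a _ => by
          rw [eqStrain_div hd (hebar.trace_eq_zero a)]; ring
      rw [shearFromEq, this, ← sub_sub, hμ]
      ring
    rw [e]
    refine hsum _ fun a => ?_
    have hp := hNpos a
    have hne : tensorVec (ebar a) ≠ 0 := by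
      rw [← norm_pos_iff, norm_tensorVec]; exact hp
    have k1 := abs_norm_add_sub_le hne (tensorVec (dev (g a))) (tensorVec (dev (h a)))
    rw [← map_add, ← map_add, ← map_add, inner_tensorVec] at k1
    simp only [norm_tensorVec] at k1
    have k2 : ebar a + dev (g a) + dev (h a) = dev (ε a) := by
      rw [hε, dev_add, dev_add, dev_of_trace_eq_zero (hebar.trace_eq_zero a)]
    have k3 : ddot (dev (g a) + dev (h a)) (ebar a) =
        ddot (g a) (ebar a) + ddot (h a) (ebar a) := by
      rw [ddot_add_left, ddot_dev_left, ddot_dev_left, hebar.trace_eq_zero a]; ring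
    rw [k2, k3] at k1
    change |tnorm (dev (ε a)) - N a - (ddot (g a) (ebar a) + ddot (h a) (ebar a)) / N a| ≤
      tnorm (dev (g a)) ^ 2 / (2 * N a) + 2 * tnorm (dev (h a)) at k1
    have k4 : tnorm (dev (g a)) ^ 2 ≤ T :=
      (pow_le_pow_left₀ (tnorm_nonneg _) (tnorm_dev_le (by omega) _) 2).trans (hg a)
    have k5 : tnorm (dev (h a)) ≤ T := (tnorm_dev_le (by omega) _).trans (hh a)
    -- The linear term of the norm expansion contains `g + h`, whereas the formula subtracts only
    -- the part in `g`; the part in `h` is added back.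
    have k6 : tnorm (dev (ε a)) / N a - 1 - ddot (g a) (ebar a) / N a ^ 2 =
        (tnorm (dev (ε a)) - N a - (ddot (g a) (ebar a) + ddot (h a) (ebar a)) / N a) / N a +
          ddot (h a) (ebar a) / N a ^ 2 := by
      field_simp
      ring
    rw [k6]
    refine (abs_add_le _ _).trans ?_
    rw [abs_div, abs_of_pos hp]
    calc _ ≤ (T / (2 * N a) + 2 * T) / N a + 1 / N a * T := by
          refine add_le_add ?_ (hhe a)
          gcongr
          refine k1.trans ?_
          gcongr
      _ = _ := by field_simp; ring
  · have e : hydroStrain (ε a) = ((g a).trace + (h a).trace) / d := by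
      rw [hydroStrain, hε, Matrix.trace_add, Matrix.trace_add, hebar.trace_eq_zero, zero_add]
    have k1 : |(g a).trace + (h a).trace| ≤ U := by
      refine (abs_add_le _ _).trans (le_trans ?_ (hUa a))
      simp only [Finset.sum_add_distrib]
      exact add_le_add (abs_trace_le _) (abs_trace_le _)
    rw [e, abs_div, abs_of_pos (by linarith : (0 : ℝ) < d)]
    calc _ ≤ U / d := by gcongr
      _ ≤ U := div_le_self hU0 (by linarith)
      _ ≤ _ := by
        have : 0 ≤ L * D * U := by positivity
        linarith

end Pointwise

/-! ### From tensor fields to almost everywhere bounds for a medium. -/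

lemma coeFn_sum_smul {ι Ω : Type*} [MeasurableSpace Ω] {ν : Measure Ω} (s : Finset ι) (c : ι → ℂ)
    (F : ι → Lp ℂ 2 ν) : ((∑ p ∈ s, c p • F p : Lp ℂ 2 ν) : Ω → ℂ) =ᵐ[ν]
      fun x => ∑ p ∈ s, c p * F p x := by
  have h2 : ∀ p ∈ s, ((c p • F p : Lp ℂ 2 ν) : Ω → ℂ) =ᵐ[ν] fun x => c p * F p x := by
    intro p _
    filter_upwards [Lp.coeFn_smul (c p) (F p)] with x h1
    rw [h1, Pi.smul_apply, smul_eq_mul]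
  filter_upwards [Lp.coeFn_finsetSum s fun p => c p • F p, (s.eventually_all).2 h2] with x h3 h4
  rw [h3, Finset.sum_apply]
  exact Finset.sum_congr rfl h4

lemma lamKInv_pos {d : ℕ} (hd : 2 ≤ d) {κ0 μ0 : ℝ} (hκ0 : 0 < κ0) (hμ0 : 0 < μ0) :
    0 < lamKInv d κ0 μ0 := by
  have hd' : (2 : ℝ) ≤ d := by exact_mod_cast hd
  have h1 : (0 : ℝ) < (d : ℝ) - 1 := by linarith
  have h2 : (0 : ℝ) < d := by linarith
  unfold lamKInv
  positivity

section Medium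

variable {d : ℕ} {b : Module.Basis (Fin d) ℝ (Space d)}

/-- The essential supremum depends only on the null sets, not on the normalization of the measure.
-/
lemma contrast_eq (κ0 μ0 : ℝ) (κ μ : Space d → ℝ) : contrast b κ0 μ0 κ μ =
    eLpNorm (fun x => max |(d : ℝ) * (κ x - κ0)| |2 * (μ x - μ0)|) ⊤ (cellProb b) := by
  rw [contrast, eLpNorm_exponent_top, eLpNorm_exponent_top, eLpNormEssSup, eLpNormEssSup,
    essSup, essSup, ae_cellProb]

lemma memLp_cellProb {p : ℝ≥0∞} {f : Space d → ℝ} (h : MemLp f p (cellMeasure b)) :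
    MemLp f p (cellProb b) := by
  rw [cellProb_eq]
  exact h.smul_measure (ENNReal.inv_ne_top.2 (volume_cell_ne_zero b))

lemma IsMedium.contrast_ne_top {κ μ : Space d → ℝ} (h : IsMedium b κ μ) (κ0 μ0 : ℝ) :
    contrast b κ0 μ0 κ μ ≠ ⊤ := by
  have h1 : MemLp (fun x => (d : ℝ) * (κ x - κ0)) ⊤ (cellMeasure b) :=
    (h.memLp_bulk.sub (memLp_const κ0)).const_mul _
  have h2 : MemLp (fun x => 2 * (μ x - μ0)) ⊤ (cellMeasure b) :=
    (h.memLp_shear.sub (memLp_const μ0)).const_mul _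
  refine ((eLpNorm_mono fun x => ?_).trans_lt (h1.norm.add h2.norm).2).ne
  simp only [Pi.add_apply, Real.norm_eq_abs]
  rw [abs_of_nonneg (le_max_of_le_left (abs_nonneg _))]
  exact (max_le (le_add_of_nonneg_right (abs_nonneg _))
    (le_add_of_nonneg_left (abs_nonneg _))).trans (le_abs_self _)

/-- The modulus fluctuations of a medium as essentially bounded functions. -/
lemma IsMedium.exists_fluctuation (hd : 2 ≤ d) {κ0 μ0 : ℝ} {κ μ : Space d → ℝ}
    (h : IsMedium b κ μ) (hmean : ⨍ x, μ x ∂cellMeasure b = μ0) :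
    ∃ K M : Lp ℂ ⊤ (cellProb b), (K =ᵐ[cellProb b] fun x => ((κ x - κ0 : ℝ) : ℂ)) ∧
      (M =ᵐ[cellProb b] fun x => ((μ x - μ0 : ℝ) : ℂ)) ∧
      ‖K‖ ≤ (contrast b κ0 μ0 κ μ).toReal ∧ ‖M‖ ≤ (contrast b κ0 μ0 κ μ).toReal ∧
      (fourierSystem_cell b).coeff 0 (mulOp M ((fourierSystem_cell b).charLp 0)) = 0 := by
  have hd' : (2 : ℝ) ≤ d := by exact_mod_cast hd
  set c := (contrast b κ0 μ0 κ μ).toReal with hc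
  have hKm : MemLp (fun x => ((κ x - κ0 : ℝ) : ℂ)) ⊤ (cellProb b) :=
    ((memLp_cellProb h.memLp_bulk).sub (memLp_const κ0)).ofReal
  have hMm : MemLp (fun x => ((μ x - μ0 : ℝ) : ℂ)) ⊤ (cellProb b) :=
    ((memLp_cellProb h.memLp_shear).sub (memLp_const μ0)).ofReal
  have hbound : ∀ᵐ x ∂cellProb b, max |(d : ℝ) * (κ x - κ0)| |2 * (μ x - μ0)| ≤ c := by
    have h1 := ae_le_eLpNormEssSup (μ := cellProb b)
      (f := fun x => max |(d : ℝ) * (κ x - κ0)| |2 * (μ x - μ0)|)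
    rw [← eLpNorm_exponent_top, ← contrast_eq] at h1
    filter_upwards [h1] with x hx
    rw [hc, ← ENNReal.ofReal_le_iff_le_toReal (h.contrast_ne_top κ0 μ0)]
    rwa [Real.enorm_of_nonneg (le_max_of_le_left (abs_nonneg _))] at hx
  have hK : ∀ᵐ x ∂cellProb b, ‖((κ x - κ0 : ℝ) : ℂ)‖ ≤ c := by
    filter_upwards [hbound] with x hx
    rw [Complex.norm_real, Real.norm_eq_abs]
    have := (le_max_left _ _).trans hx
    rw [abs_mul, abs_of_pos (by linarith : (0 : ℝ) < d)] at this
    nlinarith [abs_nonneg (κ x - κ0)]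
  have hM : ∀ᵐ x ∂cellProb b, ‖((μ x - μ0 : ℝ) : ℂ)‖ ≤ c := by
    filter_upwards [hbound] with x hx
    rw [Complex.norm_real, Real.norm_eq_abs]
    have := (le_max_right _ _).trans hx
    rw [abs_mul, abs_of_pos (by norm_num : (0 : ℝ) < 2)] at this
    nlinarith [abs_nonneg (μ x - μ0)]
  refine ⟨hKm.toLp, hMm.toLp, hKm.coeFn_toLp, hMm.coeFn_toLp, ?_, ?_, ?_⟩
  · rw [Lp.norm_toLp]
    refine ENNReal.toReal_le_of_le_ofReal ENNReal.toReal_nonneg ?_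
    rw [eLpNorm_exponent_top]
    exact eLpNormEssSup_le_of_ae_bound hK
  · rw [Lp.norm_toLp]
    refine ENNReal.toReal_le_of_le_ofReal ENNReal.toReal_nonneg ?_
    rw [eLpNorm_exponent_top]
    exact eLpNormEssSup_le_of_ae_bound hM
  -- The mean condition enters here: the Green operator annihilates means, so the mean of the shear
  -- modulus cannot be read off the strain fluctuations.
  · have hE := fourierSystem_cell b
    have hμi : Integrable μ (cellProb b) := (memLp_cellProb h.memLp_shear).integrable (by simp)
    have hmean' : ∫ x, μ x ∂cellProb b = μ0 := by
      rw [← hmean, average_eq, cellProb_eq, integral_smul_measure]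
      simp [cellMeasure, Measure.real, ENNReal.toReal_inv]
    rw [FourierSystem.coeff_eq_integral]
    have h1 : ∫ x, mulOp hMm.toLp (hE.charLp 0) x * cellChar b (-0) x ∂cellProb b =
        ∫ x, ((μ x - μ0 : ℝ) : ℂ) ∂cellProb b := by
      refine integral_congr_ae ?_
      filter_upwards [coeFn_mulOp hMm.toLp (hE.charLp 0), (hE.memLp 0 2).coeFn_toLp,
        hMm.coeFn_toLp] with x h1 h2 h3
      rw [h1, FourierSystem.charLp, h2, h3, neg_zero, hE.map_zero, mul_one, mul_one]
    rw [h1, integral_complex_ofReal, integral_sub hμi (integrable_const _), hmean']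
    simp

/-- Almost everywhere bounds for the remainders in terms of a decomposition of the strain field
into its zeroth-order, first-order and remaining parts. -/
lemma exists_ae_remainder_le (hd : 2 ≤ d) {κ0 μ0 : ℝ} (hκ0 : 0 < κ0) (hμ0 : 0 < μ0)
    {ebar : Fin (nK d) → Tensor2 d} (hebar : IsDeviatoricBasis ebar) : ∃ C : ℝ, 0 ≤ C ∧
      ∀ (μ : Space d → ℝ) (ε : Fin (nK d) → Space d → Tensor2 d) (K M : Lp ℂ ⊤ (cellProb b))
        (v G H : Fin (nK d) → TensorField d (cellProb b)),
        (M =ᵐ[cellProb b] fun x => ((μ x - μ0 : ℝ) : ℂ)) →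
        (fourierSystem_cell b).coeff 0 (mulOp M ((fourierSystem_cell b).charLp 0)) = 0 →
        (∀ a i j, v a i j =ᵐ[cellProb b] fun x => (ε a x i j : ℂ)) →
        (∀ a, G a = -(fourierSystem_cell b).green (dualVec b) μ0 (greenConst d κ0 μ0)
          (isoMul K M ((fourierSystem_cell b).constField (ebar a)))) →
        (∀ a, v a = (fourierSystem_cell b).constField (ebar a) + G a + H a) →
        ∀ᵐ x ∂cellProb b,
          |μ x - shearFromDev κ0 μ0 ebar (fun a => ε a x)| ≤
            C * ∑ a, ∑ i, ∑ j, (‖H a i j x‖ + ‖G a i j x‖ ^ 2) ∧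
          |μ x - shearFromEq κ0 μ0 ebar (fun a => ε a x)| ≤
            C * ∑ a, ∑ i, ∑ j, (‖H a i j x‖ + ‖G a i j x‖ ^ 2) ∧
          ∀ a, |hydroStrain (ε a x)| ≤ C * ∑ a, ∑ i, ∑ j, (‖G a i j x‖ + ‖H a i j x‖) := by
  obtain ⟨C, hC, hrem⟩ := exists_remainder_le hd κ0 μ0 hebar
  refine ⟨C, hC, fun μ ε K M v G H hM hM0 hv hG hvd => ?_⟩
  set hE := fourierSystem_cell b
  set lam := lamKInv d κ0 μ0 with hlam
  have hlpos : 0 < lam := lamKInv_pos hd hκ0 hμ0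
  set f : Lp ℂ 2 (cellProb b) := (2 : ℂ) • mulOp M (hE.charLp 0) with hf
  have hf0 : hE.coeff 0 f = 0 := by rw [hf, map_smul, hM0, smul_zero]
  have hsum := hE.sum_green_eq (dualVec b) (dualVec_injective b) hd hκ0 hμ0
    (β := greenConst d κ0 μ0) rfl hebar hf0
  set c : Fin d × Fin d × Fin (nK d) → ℝ :=
    fun p => ebar p.2.2 p.1 p.2.1 / tnorm (ebar p.2.2) ^ 2 with hc
  -- The triple sum over two tensor indices and the basis is written as one sum over a product type,
  -- and the sign comes from `G = -Γ (δL : ebar)`.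
  have hGsum : ∑ p, ((c p : ℝ) : ℂ) • G p.2.2 p.1 p.2.1 = (((-1 / lam : ℝ) : ℂ)) • f := by
    have e1 : (((-1 / lam : ℝ) : ℂ)) • f = -((((1 / lam : ℝ) : ℂ)) • f) := by
      rw [← neg_smul]; push_cast; ring_nf
    rw [e1, ← hsum, Fintype.sum_prod_type, ← Finset.sum_neg_distrib]
    refine Finset.sum_congr rfl fun i _ => ?_
    rw [Fintype.sum_prod_type, ← Finset.sum_neg_distrib]
    refine Finset.sum_congr rfl fun j _ => ?_
    rw [← Finset.sum_neg_distrib]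
    refine Finset.sum_congr rfl fun a _ => ?_
    rw [hG, hE.isoMul_constField (hebar.trace_eq_zero a), Pi.neg_apply, Pi.neg_apply, smul_neg]
  have hae1 := coeFn_sum_smul Finset.univ (fun p => ((c p : ℝ) : ℂ))
    (fun p : Fin d × Fin d × Fin (nK d) => G p.2.2 p.1 p.2.1)
  rw [hGsum] at hae1
  have hfx : f =ᵐ[cellProb b] fun x => 2 * ((μ x - μ0 : ℝ) : ℂ) := by
    filter_upwards [Lp.coeFn_smul (2 : ℂ) (mulOp M (hE.charLp 0)),
      coeFn_mulOp M (hE.charLp 0), (hE.memLp 0 2).coeFn_toLp, hM] with x h1 h2 h3 h4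
    rw [hf, h1, Pi.smul_apply, h2, FourierSystem.charLp, h3, h4, hE.map_zero, smul_eq_mul, mul_one]
  have hdec : ∀ᵐ x ∂cellProb b, ∀ a i j, (ε a x i j : ℂ) = ebar a i j + G a i j x + H a i j x := by
    refine ae_all_iff.2 fun a => ae_all_iff.2 fun i => ae_all_iff.2 fun j => ?_
    have e1 : v a i j = hE.constField (ebar a) i j + G a i j + H a i j := by rw [hvd]; rfl
    filter_upwards [hv a i j, Lp.coeFn_add (hE.constField (ebar a) i j + G a i j) (H a i j),
      Lp.coeFn_add (hE.constField (ebar a) i j) (G a i j),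
      hE.coeFn_constField (ebar a) i j] with x h1 h2 h3 h4
    rw [← h1, e1, h2, Pi.add_apply, h3, Pi.add_apply, h4]
  filter_upwards [hae1, hfx, hdec, Lp.coeFn_smul ((-1 / lam : ℝ) : ℂ) f] with x h1 h2 h3 h4
  -- The strain is real, so the decomposition survives taking real parts, and the real parts are
  -- dominated by the complex moduli.
  set g : Fin (nK d) → Tensor2 d := fun a => Matrix.of fun i j => (G a i j x).re with hgd
  set h : Fin (nK d) → Tensor2 d := fun a => Matrix.of fun i j => (H a i j x).re with hhd
  have hε : ∀ a, ε a x = ebar a + g a + h a := fun a => by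
    ext i j
    have := congrArg Complex.re (h3 a i j)
    simpa [hgd, hhd] using this
  have hμ : μ x - μ0 = -(lam / 2 * ∑ a, ddot (g a) (ebar a) / tnorm (ebar a) ^ 2) := by
    rw [h4, Pi.smul_apply, h2] at h1
    have h5 := congrArg Complex.re h1
    have h6 : ∑ p, c p * (G p.2.2 p.1 p.2.1 x).re =
        ∑ a, ddot (g a) (ebar a) / tnorm (ebar a) ^ 2 := by
      simp only [Fintype.sum_prod_type, ddot, Finset.sum_div, hc, hgd, Matrix.of_apply]
      rw [Finset.sum_congr rfl fun i _ => Finset.sum_comm, Finset.sum_comm]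
      exact Finset.sum_congr rfl fun a _ => Finset.sum_congr rfl fun i _ =>
        Finset.sum_congr rfl fun j _ => by ring
    simp only [Complex.re_sum, Complex.re_ofReal_mul, h6, smul_eq_mul] at h5
    rw [← h5]
    simp
    field_simp
  obtain ⟨r1, r2, r3⟩ := hrem (μ x) (fun a => ε a x) g h hε hμ
  have hgn : ∀ a i j, |g a i j| ≤ ‖G a i j x‖ := fun a i j => Complex.abs_re_le_norm _
  have hhn : ∀ a i j, |h a i j| ≤ ‖H a i j x‖ := fun a i j => Complex.abs_re_le_norm _
  have hT : ∑ a, ∑ i, ∑ j, (|h a i j| + |g a i j| ^ 2) ≤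
      ∑ a, ∑ i, ∑ j, (‖H a i j x‖ + ‖G a i j x‖ ^ 2) :=
    Finset.sum_le_sum fun a _ => Finset.sum_le_sum fun i _ => Finset.sum_le_sum fun j _ =>
      add_le_add (hhn a i j) (pow_le_pow_left₀ (abs_nonneg _) (hgn a i j) 2)
  have hU : ∑ a, ∑ i, ∑ j, (|g a i j| + |h a i j|) ≤
      ∑ a, ∑ i, ∑ j, (‖G a i j x‖ + ‖H a i j x‖) :=
    Finset.sum_le_sum fun a _ => Finset.sum_le_sum fun i _ => Finset.sum_le_sum fun j _ =>
      add_le_add (hgn a i j) (hhn a i j)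
  exact ⟨r1.trans (mul_le_mul_of_nonneg_left hT hC), r2.trans (mul_le_mul_of_nonneg_left hT hC),
    fun a => (r3 a).trans (mul_le_mul_of_nonneg_left hU hC)⟩

end Medium

/-! ### Mean-square estimates, uniform in the medium. -/

lemma eLpNorm_two_le_of_abs_le_sum {ι Ω : Type*} [Fintype ι] [MeasurableSpace Ω] {ν : Measure Ω}
    {R : Ω → ℝ} {F : ι → Ω → ℝ} {C B : ℝ} (hC : 0 ≤ C)
    (hF : ∀ p, AEStronglyMeasurable (F p) ν) (hB : ∀ p, eLpNorm (F p) 2 ν ≤ ENNReal.ofReal B)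
    (h : ∀ᵐ x ∂ν, |R x| ≤ C * ∑ p, F p x) :
    eLpNorm R 2 ν ≤ ENNReal.ofReal (C * Fintype.card ι * B) := by
  have h1 : eLpNorm R 2 ν ≤ eLpNorm (C • ∑ p, F p) 2 ν := by
    refine eLpNorm_mono_ae ?_
    filter_upwards [h] with x hx
    rw [Real.norm_eq_abs, Real.norm_eq_abs, Pi.smul_apply, Finset.sum_apply, smul_eq_mul]
    exact hx.trans (le_abs_self _)
  refine h1.trans (eLpNorm_const_smul_le.trans ?_)
  rw [Real.enorm_of_nonneg hC, mul_assoc, ENNReal.ofReal_mul hC]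
  gcongr
  refine (eLpNorm_sum_le (fun p _ => hF p) (by norm_num)).trans
    ((Finset.sum_le_sum fun p _ => hB p).trans ?_)
  rw [Finset.sum_const, Finset.card_univ, nsmul_eq_mul, ENNReal.ofReal_mul (Nat.cast_nonneg _),
    ENNReal.ofReal_natCast]

/-- This is where `L⁴` enters: the quadratic term of the norm expansion has to be estimated in `L²`.
-/
lemma eLpNorm_norm_sq_two {Ω : Type*} [MeasurableSpace Ω] {ν : Measure Ω} (f : Ω → ℂ) :
    eLpNorm (fun x => ‖f x‖ ^ 2) 2 ν = eLpNorm f 4 ν ^ 2 := by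
  have h := eLpNorm_norm_rpow (μ := ν) (p := 2) f (q := 2) (by norm_num)
  have e : (2 : ℝ≥0∞) * ENNReal.ofReal 2 = 4 := by
    rw [ENNReal.ofReal_ofNat]; norm_num
  rw [e] at h
  simpa using h

/-- The equation is substituted once into itself; no inverse of `1 + A` is used. -/
lemma eq_add_neg_add_of_eq_sub {X : Type*} [NormedAddCommGroup X] [NormedSpace ℂ X]
    (A : X →L[ℂ] X) {v e : X} (h : v = e - A v) : v = e + -A e + A (A v) := by
  have : A v = A e - A (A v) := by
    conv_lhs => rw [h]
    exact map_sub A _ _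
  conv_lhs => rw [h, this]
  abel

/-- When `‖A‖ ≤ 1/2` the term `A v` is absorbed, giving the a priori bound `‖v‖ ≤ 2 ‖e‖`. -/
lemma norm_apply_apply_le_of_eq_sub {X : Type*} [NormedAddCommGroup X] [NormedSpace ℂ X]
    {A : X →L[ℂ] X} {v e : X} (h : v = e - A v) {r : ℝ} (hA : ‖A‖ ≤ r) (hr : r ≤ 1 / 2) :
    ‖A (A v)‖ ≤ 2 * r ^ 2 * ‖e‖ := by
  have hr0 : 0 ≤ r := (norm_nonneg _).trans hA
  have hAle : ∀ w, ‖A w‖ ≤ r * ‖w‖ := fun w =>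
    (A.le_opNorm w).trans (mul_le_mul_of_nonneg_right hA (norm_nonneg w))
  have hv : ‖v‖ ≤ 2 * ‖e‖ := by
    have h1 : ‖v‖ ≤ ‖e‖ + ‖A v‖ := by
      conv_lhs => rw [h]
      exact norm_sub_le _ _
    have h2 : r * ‖v‖ ≤ 1 / 2 * ‖v‖ := mul_le_mul_of_nonneg_right hr (norm_nonneg _)
    linarith [hAle v]
  calc ‖A (A v)‖ ≤ r * (r * (2 * ‖e‖)) := (hAle _).trans (mul_le_mul_of_nonneg_left
        ((hAle _).trans (mul_le_mul_of_nonneg_left hv hr0)) hr0)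
    _ = _ := by ring

section Expansion

variable {d : ℕ} {b : Module.Basis (Fin d) ℝ (Space d)}

/-- A strain field as an element of the space of square-integrable tensor fields. -/
lemma IsStrainSolution.exists_tensorField {κ μ : Space d → ℝ} {ebar : Tensor2 d}
    {ε : Space d → Tensor2 d} (h : IsStrainSolution b κ μ ebar ε) :
    ∃ v : TensorField d (cellProb b), ∀ i j, v i j =ᵐ[cellProb b] fun x => (ε x i j : ℂ) :=
  ⟨fun i j => (memLp_cellProb (h.memLp i j)).ofReal.toLp, fun _ _ => MemLp.coeFn_toLp _⟩

/-- The operator of the Lippmann–Schwinger equation. -/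
def scatter (b : Module.Basis (Fin d) ℝ (Space d)) (κ0 μ0 : ℝ) (K M : Lp ℂ ⊤ (cellProb b)) :
    TensorField d (cellProb b) →L[ℂ] TensorField d (cellProb b) :=
  (fourierSystem_cell b).green (dualVec b) μ0 (greenConst d κ0 μ0) ∘L isoMul K M

lemma scatter_smul (κ0 μ0 : ℝ) (c : ℂ) (K M : Lp ℂ ⊤ (cellProb b)) :
    scatter b κ0 μ0 (c • K) (c • M) = c • scatter b κ0 μ0 K M := by
  rw [scatter, scatter, isoMul_smul, ContinuousLinearMap.comp_smul]

lemma exists_norm_scatter_le (b : Module.Basis (Fin d) ℝ (Space d)) (κ0 μ0 : ℝ) :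
    ∃ C : ℝ, 0 < C ∧ ∀ (K M : Lp ℂ ⊤ (cellProb b)) (c : ℝ), ‖K‖ ≤ c → ‖M‖ ≤ c →
      ‖scatter b κ0 μ0 K M‖ ≤ C * c := by
  obtain ⟨C, hC, h⟩ := exists_norm_isoMul_le (d := d) (ν := cellProb b)
  set g := ‖(fourierSystem_cell b).green (dualVec b) μ0 (greenConst d κ0 μ0)‖
  have hg : 0 ≤ g := norm_nonneg _
  refine ⟨(g + 1) * (C * 2), by positivity, fun K M c hK hM => ?_⟩
  refine (ContinuousLinearMap.opNorm_comp_le _ _).trans ?_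
  rw [mul_assoc]
  refine mul_le_mul (by linarith) ((h K M).trans ?_) (norm_nonneg _) (by linarith)
  nlinarith

/-- In mean square, the remainders are of second order and the hydrostatic strains are of first
order in the contrast, uniformly in the medium. -/
theorem exists_eLpNorm_remainder_le [Nontrivial (Space d)] (hd : 2 ≤ d) {κ0 μ0 : ℝ} (hκ0 : 0 < κ0)
    (hμ0 : 0 < μ0) {ebar : Fin (nK d) → Tensor2 d} (hebar : IsDeviatoricBasis ebar) :
    ∃ C : ℝ, 0 < C ∧ ∃ δ : ℝ, 0 < δ ∧
      ∀ (κ μ : Space d → ℝ) (ε : Fin (nK d) → Space d → Tensor2 d),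
        IsMedium b κ μ → ⨍ x, μ x ∂(cellMeasure b) = μ0 →
        (∀ a, IsStrainSolution b κ μ (ebar a) (ε a)) →
        (contrast b κ0 μ0 κ μ).toReal ≤ δ →
          eLpNorm (fun x => μ x - shearFromDev κ0 μ0 ebar (fun a => ε a x)) 2 (cellProb b)
              ≤ ENNReal.ofReal (C * (contrast b κ0 μ0 κ μ).toReal ^ 2) ∧
          eLpNorm (fun x => μ x - shearFromEq κ0 μ0 ebar (fun a => ε a x)) 2 (cellProb b)
              ≤ ENNReal.ofReal (C * (contrast b κ0 μ0 κ μ).toReal ^ 2) ∧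
          ∀ a, eLpNorm (fun x => hydroStrain (ε a x)) 2 (cellProb b)
              ≤ ENNReal.ofReal (C * (contrast b κ0 μ0 κ μ).toReal) := by
  obtain ⟨C0, hC0, hrem⟩ := exists_ae_remainder_le (b := b) hd hκ0 hμ0 hebar
  obtain ⟨C1, hC1, hA⟩ := exists_norm_scatter_le b κ0 μ0
  choose C4 hC4 h4 using fun a => (fourierSystem_cell b).exists_eLpNorm_green_isoMul_constField_le
    (dualVec b) (dualVec_injective b) μ0 (greenConst d κ0 μ0) (hebar.trace_eq_zero a)
  set hE := fourierSystem_cell b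
  set e : Fin (nK d) → TensorField d (cellProb b) := fun a => hE.constField (ebar a) with he
  set S : ℝ := ∑ a, ‖e a‖ with hS
  have hSa : ∀ a, ‖e a‖ ≤ S := fun a =>
    Finset.single_le_sum (f := fun a => ‖e a‖) (fun _ _ => norm_nonneg _) (Finset.mem_univ a)
  have hS0 : 0 ≤ S := Finset.sum_nonneg fun _ _ => norm_nonneg _
  set D : ℝ := ∑ a, C4 a with hD
  have hDa : ∀ a, C4 a ≤ D := fun a =>
    Finset.single_le_sum (f := C4) (fun a _ => hC4 a) (Finset.mem_univ a)
  have hD0 : 0 ≤ D := Finset.sum_nonneg fun a _ => hC4 a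
  set N : ℝ := (Fintype.card (Fin (nK d) × Fin d × Fin d) : ℝ) with hN
  have hN0 : 0 ≤ N := Nat.cast_nonneg _
  -- `B2` collects the `L²` bound of `H` and the squared `L⁴` bound of `G`; `B1` collects the
  -- first-order bounds of both.
  set B2 : ℝ := C1 ^ 2 * (2 * S) + D ^ 2 with hB2
  set B1 : ℝ := D + C1 * S with hB1
  -- The radius `1 / (2 C1)` makes the norm of the scattering operator at most `1/2`.
  refine ⟨C0 * N * B2 + C0 * N * B1 + 1, by positivity, 1 / (2 * C1), by positivity,
    fun κ μ ε hmed hmean hsol hc => ?_⟩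
  obtain ⟨K, M, hK, hM, hKn, hMn, hM0⟩ := hmed.exists_fluctuation hd (κ0 := κ0) hmean
  set c := (contrast b κ0 μ0 κ μ).toReal
  have hc0 : 0 ≤ c := ENNReal.toReal_nonneg
  choose v hv using fun a => (hsol a).exists_tensorField
  set A := scatter b κ0 μ0 K M with hAdef
  have hAn : ‖A‖ ≤ C1 * c := hA K M c hKn hMn
  have hAc : C1 * c ≤ 1 / 2 := by
    calc C1 * c ≤ C1 * (1 / (2 * C1)) := by gcongr
      _ = 1 / 2 := by field_simp
  have hls : ∀ a, v a = e a - A (v a) := fun a =>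
    lippmann_schwinger hd hκ0 hμ0 (hsol a) hK hM (hv a)
  set G : Fin (nK d) → TensorField d (cellProb b) := fun a => -A (e a) with hG
  set H : Fin (nK d) → TensorField d (cellProb b) := fun a => A (A (v a)) with hH
  have hdec : ∀ a, v a = e a + G a + H a := fun a => eq_add_neg_add_of_eq_sub A (hls a)
  have hHn : ∀ a i j, eLpNorm (H a i j) 2 (cellProb b) ≤
      ENNReal.ofReal (C1 ^ 2 * (2 * S) * c ^ 2) := fun a i j => by
    rw [← ENNReal.ofReal_toReal (Lp.eLpNorm_ne_top (H a i j)), ← Lp.norm_def]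
    refine ENNReal.ofReal_le_ofReal ((norm_entry_le _ i j).trans
      ((norm_apply_apply_le_of_eq_sub (hls a) hAn hAc).trans ?_))
    have := mul_le_mul_of_nonneg_left (hSa a) (by positivity : 0 ≤ 2 * (C1 * c) ^ 2)
    linarith
  have hG4 : ∀ a i j, eLpNorm (G a i j) 4 (cellProb b) ≤ ENNReal.ofReal (D * c) := fun a i j => by
    have h1 : G a i j = -(A (e a) i j) := rfl
    rw [h1, eLpNorm_congr_ae (Lp.coeFn_neg _), eLpNorm_neg]
    exact (h4 a K M i j).trans (ENNReal.ofReal_le_ofReal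
      (mul_le_mul (hDa a) hMn (norm_nonneg _) hD0))
  have hGsq : ∀ a i j, eLpNorm (fun x => ‖G a i j x‖ ^ 2) 2 (cellProb b) ≤
      ENNReal.ofReal (D ^ 2 * c ^ 2) := fun a i j => by
    rw [eLpNorm_norm_sq_two, ← mul_pow, ENNReal.ofReal_pow (by positivity)]
    exact pow_le_pow_left₀ zero_le (hG4 a i j) 2
  have hGn : ∀ a i j, eLpNorm (G a i j) 2 (cellProb b) ≤ ENNReal.ofReal (D * c) := fun a i j =>
    (eLpNorm_le_eLpNorm_of_exponent_le (by norm_num) (Lp.aestronglyMeasurable _)).trans (hG4 a i j)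
  have hHm : ∀ a i j, AEStronglyMeasurable (fun x => ‖H a i j x‖) (cellProb b) := fun a i j =>
    (Lp.aestronglyMeasurable _).norm
  have hGm : ∀ a i j, AEStronglyMeasurable (fun x => ‖G a i j x‖) (cellProb b) := fun a i j =>
    (Lp.aestronglyMeasurable _).norm
  have hGm2 : ∀ a i j, AEStronglyMeasurable (fun x => ‖G a i j x‖ ^ 2) (cellProb b) :=
    fun a i j => (hGm a i j).pow 2
  have hae := hrem μ ε K M v G H hM hM0 hv (fun _ => rfl) hdec
  have hsum : ∀ F : Fin (nK d) → Fin d → Fin d → ℝ,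
      ∑ a, ∑ i, ∑ j, F a i j = ∑ p : Fin (nK d) × Fin d × Fin d, F p.1 p.2.1 p.2.2 := fun F => by
    simp only [Fintype.sum_prod_type]
  simp only [hsum] at hae
  have hb2 : ∀ p : Fin (nK d) × Fin d × Fin d,
      eLpNorm (fun x => ‖H p.1 p.2.1 p.2.2 x‖ + ‖G p.1 p.2.1 p.2.2 x‖ ^ 2) 2 (cellProb b) ≤
        ENNReal.ofReal (B2 * c ^ 2) := fun p => by
    refine (eLpNorm_add_le (hHm _ _ _) (hGm2 _ _ _) (by norm_num)).trans ?_
    rw [eLpNorm_norm, hB2, add_mul, ENNReal.ofReal_add (by positivity) (by positivity)]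
    exact add_le_add (hHn _ _ _) (hGsq _ _ _)
  have hb1 : ∀ p : Fin (nK d) × Fin d × Fin d,
      eLpNorm (fun x => ‖G p.1 p.2.1 p.2.2 x‖ + ‖H p.1 p.2.1 p.2.2 x‖) 2 (cellProb b) ≤
        ENNReal.ofReal (B1 * c) := fun p => by
    refine (eLpNorm_add_le (hGm _ _ _) (hHm _ _ _) (by norm_num)).trans ?_
    rw [eLpNorm_norm, eLpNorm_norm, hB1, add_mul,
      ENNReal.ofReal_add (by positivity) (by positivity)]
    refine add_le_add (hGn _ _ _) ((hHn _ _ _).trans (ENNReal.ofReal_le_ofReal ?_))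
    -- The second-order bound of `H` is weakened to first order by means of `C1 * c ≤ 1/2`.
    have : C1 * S * c * (2 * (C1 * c)) ≤ C1 * S * c * 1 := by
      gcongr
      linarith
    nlinarith
  have hP2 : 0 ≤ C0 * N * B2 := by positivity
  have hP1 : 0 ≤ C0 * N * B1 := by positivity
  have hc2 : C0 * N * (B2 * c ^ 2) ≤ (C0 * N * B2 + C0 * N * B1 + 1) * c ^ 2 := by
    rw [← mul_assoc]
    exact mul_le_mul_of_nonneg_right (by linarith) (sq_nonneg c)
  have hc1 : C0 * N * (B1 * c) ≤ (C0 * N * B2 + C0 * N * B1 + 1) * c := by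
    rw [← mul_assoc]
    exact mul_le_mul_of_nonneg_right (by linarith) hc0
  have hm2 := fun p : Fin (nK d) × Fin d × Fin d =>
    (hHm p.1 p.2.1 p.2.2).add (hGm2 p.1 p.2.1 p.2.2)
  have hm1 := fun p : Fin (nK d) × Fin d × Fin d =>
    (hGm p.1 p.2.1 p.2.2).add (hHm p.1 p.2.1 p.2.2)
  refine ⟨?_, ?_, fun a => ?_⟩
  · exact (eLpNorm_two_le_of_abs_le_sum hC0 hm2 hb2 (hae.mono fun x hx => hx.1)).trans
      (ENNReal.ofReal_le_ofReal hc2)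
  · exact (eLpNorm_two_le_of_abs_le_sum hC0 hm2 hb2 (hae.mono fun x hx => hx.2.1)).trans
      (ENNReal.ofReal_le_ofReal hc2)
  · exact (eLpNorm_two_le_of_abs_le_sum hC0 hm1 hb1 (hae.mono fun x hx => hx.2.2 a)).trans
      (ENNReal.ofReal_le_ofReal hc1)

lemma eLpNorm_cellMeasure (f : Space d → ℝ) : eLpNorm f 2 (cellMeasure b) =
    ENNReal.ofReal (Real.sqrt (volume (ZSpan.fundamentalDomain b)).toReal) *
      eLpNorm f 2 (cellProb b) := by
  rw [cellMeasure_eq, eLpNorm_smul_measure_of_ne_top (by norm_num), smul_eq_mul]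
  congr 1
  rw [← ENNReal.ofReal_toReal (volume_cell_ne_top b), ENNReal.ofReal_rpow_of_nonneg
    ENNReal.toReal_nonneg (by norm_num), ENNReal.toReal_ofReal ENNReal.toReal_nonneg,
    Real.sqrt_eq_rpow]
  norm_num

end Expansion

/-! ### Almost everywhere boundedness through the Neumann series. -/

section Neumann

variable {X Ω : Type*} [NormedAddCommGroup X] [NormedSpace ℂ X] [MeasurableSpace Ω] {ν : Measure Ω}

lemma eq_neumann_partial_sum (A : X →L[ℂ] X) {f y : X} {s : ℂ} (h : y = f - s • A y) (N : ℕ) :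
    y = ∑ k ∈ Finset.range N, (-s) ^ k • (A ^ k) f + (-s) ^ N • (A ^ N) y := by
  induction N with
  | zero => simp
  | succ N ih =>
    have h1 : (A ^ N) y = (A ^ N) f + (-s) • (A ^ (N + 1)) y := by
      conv_lhs => rw [h]
      rw [map_sub, map_smul, pow_succ, mul_apply_eq_comp, neg_smul, sub_eq_add_neg]
    rw [Finset.sum_range_succ, add_assoc, pow_succ (-s) N, mul_smul, ← smul_add, ← h1]
    exact ih

lemma norm_pow_apply_le (A : X →L[ℂ] X) (k : ℕ) (x : X) : ‖(A ^ k) x‖ ≤ ‖A‖ ^ k * ‖x‖ := by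
  induction k with
  | zero => simp
  | succ k ih =>
    rw [pow_succ', mul_apply_eq_comp, pow_succ', mul_assoc]
    exact (A.le_opNorm _).trans (mul_le_mul_of_nonneg_left ih (norm_nonneg _))

/-- Solutions of `y = f - t A y` in a space of tensor fields are, almost everywhere, bounded as
`t → 0`: they are dominated by the absolutely convergent Neumann series. -/
lemma ae_eventually_bounded_of_eq_sub_smul [IsProbabilityMeasure ν] (π : X →L[ℂ] Lp ℂ 2 ν)
    (A : X →L[ℂ] X) (f : X) {t : ℕ → ℝ} (ht : Tendsto t atTop (nhds 0)) {y : ℕ → X}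
    (hy : ∀ n, y n = f - (t n : ℂ) • A (y n)) :
    ∀ᵐ x ∂ν, ∃ C : ℝ, ∀ᶠ n in atTop, ‖π (y n) x‖ ≤ C := by
  -- With this choice `‖A‖ / ρ ≤ 1/2`, so for `|t| ≤ 1 / ρ` the Neumann series is dominated by a
  -- geometric series of ratio `1/2`.
  set ρ : ℝ := 2 * (‖A‖ + 1) with hρ
  have hρ0 : 0 < ρ := by positivity
  set w : ℕ → Lp ℂ 2 ν := fun k => π ((A ^ k) f) with hw
  -- A majorant independent of `n`. The `L¹` norms of its terms are summable, so it is finite almost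
  -- everywhere.
  set W : Ω → ℝ≥0∞ := fun x => ∑' k, ENNReal.ofReal (ρ⁻¹ ^ k) * ‖w k x‖ₑ with hW
  have hq : ‖A‖ * ρ⁻¹ ≤ 1 / 2 := by
    rw [← div_eq_mul_inv, div_le_iff₀ hρ0, hρ]
    linarith
  have hWfin : ∀ᵐ x ∂ν, W x < ⊤ := by
    have hmeas : ∀ k, AEMeasurable (fun x => ENNReal.ofReal (ρ⁻¹ ^ k) * ‖w k x‖ₑ) ν := fun k =>
      (Lp.aestronglyMeasurable (w k)).enorm.const_mul _
    refine ae_lt_top' (AEMeasurable.tsum hmeas) ?_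
    rw [lintegral_tsum hmeas]
    have hle : ∀ k, ∫⁻ x, ENNReal.ofReal (ρ⁻¹ ^ k) * ‖w k x‖ₑ ∂ν ≤
        ENNReal.ofReal (‖π‖ * ‖f‖ * (1 / 2) ^ k) := fun k => by
      rw [lintegral_const_mul'' _ (Lp.aestronglyMeasurable (w k)).enorm,
        ← eLpNorm_one_eq_lintegral_enorm]
      have h1 : eLpNorm (w k) 1 ν ≤ ENNReal.ofReal ‖w k‖ := by
        rw [Lp.norm_def, ENNReal.ofReal_toReal (Lp.eLpNorm_ne_top _)]
        exact eLpNorm_le_eLpNorm_of_exponent_le (by norm_num) (Lp.aestronglyMeasurable _)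
      refine (mul_le_mul_right h1 _).trans ?_
      rw [← ENNReal.ofReal_mul (by positivity)]
      refine ENNReal.ofReal_le_ofReal ?_
      calc ρ⁻¹ ^ k * ‖w k‖ ≤ ρ⁻¹ ^ k * (‖π‖ * (‖A‖ ^ k * ‖f‖)) := by
            gcongr
            exact (π.le_opNorm _).trans
              (mul_le_mul_of_nonneg_left (norm_pow_apply_le A k f) (norm_nonneg _))
        _ = ‖π‖ * ‖f‖ * (‖A‖ * ρ⁻¹) ^ k := by rw [mul_pow]; ring
        _ ≤ _ := by gcongr
    have hs : Summable fun k : ℕ => ‖π‖ * ‖f‖ * (1 / 2 : ℝ) ^ k :=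
      (summable_geometric_of_lt_one (by norm_num) (by norm_num)).mul_left _
    exact ne_top_of_le_ne_top hs.tsum_ofReal_ne_top (ENNReal.tsum_le_tsum hle)
  have hbound : ∀ᵐ x ∂ν, ∀ n, |t n| ≤ ρ⁻¹ → ‖π (y n) x‖ₑ ≤ W x := by
    refine ae_all_iff.2 fun n => ?_
    by_cases hn : |t n| ≤ ρ⁻¹
    swap
    · exact ae_of_all _ fun x h => absurd h hn
    set s : ℂ := -(t n : ℂ) with hs
    have hsn : ‖s‖ = |t n| := by rw [hs, norm_neg, Complex.norm_real, Real.norm_eq_abs]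
    set S : ℕ → Lp ℂ 2 ν := fun N => ∑ k ∈ Finset.range N, s ^ k • w k with hS
    have hlim : Tendsto S atTop (nhds (π (y n))) := by
      rw [tendsto_iff_norm_sub_tendsto_zero]
      have hg : Tendsto (fun N : ℕ => ‖π‖ * ‖y n‖ * (1 / 2 : ℝ) ^ N) atTop (nhds 0) := by
        simpa using (tendsto_pow_atTop_nhds_zero_of_lt_one (by norm_num : (0 : ℝ) ≤ 1 / 2)
          (by norm_num)).const_mul (‖π‖ * ‖y n‖)
      refine squeeze_zero (fun _ => norm_nonneg _) (fun N => ?_) hg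
      have h1 : S N - π (y n) = -(s ^ N • π ((A ^ N) (y n))) := by
        conv_lhs => rw [eq_neumann_partial_sum A (hy n) N]
        rw [map_add, map_smul, map_sum]
        simp only [map_smul, hS, hw, hs]
        abel
      rw [h1, norm_neg, norm_smul, norm_pow, hsn]
      calc |t n| ^ N * ‖π ((A ^ N) (y n))‖ ≤ ρ⁻¹ ^ N * (‖π‖ * (‖A‖ ^ N * ‖y n‖)) := by
            gcongr
            exact (π.le_opNorm _).trans
              (mul_le_mul_of_nonneg_left (norm_pow_apply_le A N _) (norm_nonneg _))
        _ = ‖π‖ * ‖y n‖ * (‖A‖ * ρ⁻¹) ^ N := by rw [mul_pow]; ring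
        _ ≤ _ := by gcongr
    -- Convergence in `L²` gives pointwise convergence along a subsequence only, which suffices
    -- because `W` dominates every partial sum.
    obtain ⟨N, -, hN⟩ := (tendstoInMeasure_of_tendsto_Lp hlim).exists_seq_tendsto_ae
    have hSx : ∀ᵐ x ∂ν, ∀ N, ‖S N x‖ₑ ≤ W x := by
      refine ae_all_iff.2 fun N => ?_
      filter_upwards [coeFn_sum_smul (Finset.range N) (fun k => s ^ k) w] with x hx
      rw [hx]
      refine (enorm_sum_le _ _).trans ((Finset.sum_le_sum fun k _ => ?_).trans
        (ENNReal.sum_le_tsum (Finset.range N)))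
      rw [enorm_mul]
      gcongr
      rw [← ofReal_norm, norm_pow, hsn]
      exact ENNReal.ofReal_le_ofReal (pow_le_pow_left₀ (abs_nonneg _) hn k)
    filter_upwards [hN, hSx] with x h1 h2 _
    exact le_of_tendsto h1.enorm (Eventually.of_forall fun j => h2 (N j))
  have hev : ∀ᶠ n in atTop, |t n| ≤ ρ⁻¹ := by
    have := ht.abs
    rw [abs_zero] at this
    exact this.eventually_le_const (by positivity)
  filter_upwards [hWfin, hbound] with x h1 h2
  refine ⟨(W x).toReal, hev.mono fun n hn => ?_⟩
  have h3 := ENNReal.toReal_mono h1.ne (h2 n hn)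
  rwa [toReal_enorm] at h3

end Neumann

/-! ### From the period cell to the whole space. -/

section Transfer

variable {d : ℕ} {b : Module.Basis (Fin d) ℝ (Space d)}

/-- A periodic property that holds almost everywhere in the period cell holds almost everywhere. -/
lemma ae_volume_of_ae_cellMeasure {P : Space d → Prop} (hP : ∀ i x, P (x + b i) ↔ P x)
    (h : ∀ᵐ x ∂cellMeasure b, P x) : ∀ᵐ x, P x := by
  -- Periodicity in the basis vectors extends to the whole lattice. An invariant set that is null in
  -- a fundamental domain of a countable group is null.
  have hinv : ∀ g ∈ Submodule.span ℤ (Set.range b), ∀ x, P (x + g) ↔ P x := by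
    intro g hg
    induction hg using Submodule.span_induction with
    | mem g hg =>
      obtain ⟨i, rfl⟩ := hg
      exact hP i
    | zero => simp
    | add g g' _ _ h1 h2 => intro x; rw [← add_assoc, h2, h1]
    | smul c g _ h1 =>
      intro x
      induction c using Int.induction_on generalizing x with
      | zero => simp
      | succ n ih => rw [add_smul, one_smul, ← add_assoc, h1, ih]
      | pred n ih =>
        rw [← h1, sub_smul, one_smul, add_assoc, sub_add_cancel]
        exact ih x
  rw [ae_iff]
  have : Countable (Submodule.span ℤ (Set.range b)).toAddSubgroup :=
    inferInstanceAs (Countable (Submodule.span ℤ (Set.range b)))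
  refine (ZSpan.isAddFundamentalDomain' b volume).measure_zero_of_invariant _ (fun g => ?_) ?_
  · ext x
    rw [Set.mem_vadd_set_iff_neg_vadd_mem]
    simp only [Set.mem_ofPred_eq]
    rw [not_iff_not]
    have := hinv g g.2 (-g +ᵥ x)
    rw [← this]
    congr!
    rw [Submodule.vadd_def]
    simp
  · rw [cellMeasure, ae_iff, Measure.restrict_apply' (ZSpan.fundamentalDomain_measurableSet b)] at h
    exact h

end Transfer

/-! ### Pointwise estimates for fluctuations of fixed shape. -/

lemma mul_sum_le_of_le {α β γ : Type*} [Fintype α] [Fintype β] [Fintype γ] {C r : ℝ} (hC : 0 ≤ C)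
    {F G : α → β → γ → ℝ} (h : ∀ a i j, F a i j ≤ G a i j * r) :
    C * ∑ a, ∑ i, ∑ j, F a i j ≤ C * (∑ a, ∑ i, ∑ j, G a i j) * r := by
  rw [mul_assoc]
  refine mul_le_mul_of_nonneg_left ?_ hC
  simp only [Finset.sum_mul]
  exact Finset.sum_le_sum fun a _ => Finset.sum_le_sum fun i _ => Finset.sum_le_sum fun j _ =>
    h a i j

lemma ae_norm_smul_tensorField {d : ℕ} {ι Ω : Type*} [Countable ι] [MeasurableSpace Ω]
    {ν : Measure Ω} (c : ℂ) (τ : ι → TensorField d ν) :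
    ∀ᵐ x ∂ν, ∀ a i j, ‖(c • τ a : TensorField d ν) i j x‖ = ‖c‖ * ‖τ a i j x‖ := by
  refine ae_all_iff.2 fun a => ae_all_iff.2 fun i => ae_all_iff.2 fun j => ?_
  filter_upwards [Lp.coeFn_smul c (τ a i j)] with x h
  rw [Pi.smul_apply, Pi.smul_apply, h, Pi.smul_apply, norm_smul]

section Pointwise

variable {d : ℕ} {b : Module.Basis (Fin d) ℝ (Space d)}

/-- The bounds for the remainders when the modulus fluctuations are multiples of fixed ones. -/
lemma exists_ae_scaled_remainder_le (hd : 2 ≤ d) {κ0 μ0 : ℝ} (hκ0 : 0 < κ0) (hμ0 : 0 < μ0)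
    {ebar : Fin (nK d) → Tensor2 d} (hebar : IsDeviatoricBasis ebar) : ∃ C : ℝ, 0 ≤ C ∧
      ∀ (κ μ : Space d → ℝ) (ε : Fin (nK d) → Space d → Tensor2 d) (s : ℝ)
        (K M : Lp ℂ ⊤ (cellProb b)), (∀ a, IsStrainSolution b κ μ (ebar a) (ε a)) →
        (((s : ℂ) • K : Lp ℂ ⊤ (cellProb b)) =ᵐ[cellProb b] fun x => ((κ x - κ0 : ℝ) : ℂ)) →
        (((s : ℂ) • M : Lp ℂ ⊤ (cellProb b)) =ᵐ[cellProb b] fun x => ((μ x - μ0 : ℝ) : ℂ)) →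
        (fourierSystem_cell b).coeff 0
          (mulOp ((s : ℂ) • M) ((fourierSystem_cell b).charLp 0)) = 0 →
        ∃ v : Fin (nK d) → TensorField d (cellProb b),
          (∀ a, v a = (fourierSystem_cell b).constField (ebar a) -
            (s : ℂ) • scatter b κ0 μ0 K M (v a)) ∧
          ∀ᵐ x ∂cellProb b,
            |μ x - shearFromDev κ0 μ0 ebar (fun a => ε a x)| ≤ C * ∑ a, ∑ i, ∑ j,
              (s ^ 2 * ‖scatter b κ0 μ0 K M (scatter b κ0 μ0 K M (v a)) i j x‖ + s ^ 2 *
                ‖scatter b κ0 μ0 K M ((fourierSystem_cell b).constField (ebar a)) i j x‖ ^ 2) ∧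
            |μ x - shearFromEq κ0 μ0 ebar (fun a => ε a x)| ≤ C * ∑ a, ∑ i, ∑ j,
              (s ^ 2 * ‖scatter b κ0 μ0 K M (scatter b κ0 μ0 K M (v a)) i j x‖ + s ^ 2 *
                ‖scatter b κ0 μ0 K M ((fourierSystem_cell b).constField (ebar a)) i j x‖ ^ 2) ∧
            ∀ a, |hydroStrain (ε a x)| ≤ C * ∑ a, ∑ i, ∑ j,
              (|s| * ‖scatter b κ0 μ0 K M ((fourierSystem_cell b).constField (ebar a)) i j x‖ +
                s ^ 2 * ‖scatter b κ0 μ0 K M (scatter b κ0 μ0 K M (v a)) i j x‖) := by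
  obtain ⟨C, hC, hrem⟩ := exists_ae_remainder_le (b := b) hd hκ0 hμ0 hebar
  refine ⟨C, hC, fun κ μ ε s K M hsol hK hM hM0 => ?_⟩
  choose v hv using fun a => (hsol a).exists_tensorField
  have hls : ∀ a, v a = (fourierSystem_cell b).constField (ebar a) -
      scatter b κ0 μ0 ((s : ℂ) • K) ((s : ℂ) • M) (v a) := fun a =>
    lippmann_schwinger hd hκ0 hμ0 (hsol a) hK hM (hv a)
  have hdec : ∀ a, v a = (fourierSystem_cell b).constField (ebar a) +
      -scatter b κ0 μ0 ((s : ℂ) • K) ((s : ℂ) • M) ((fourierSystem_cell b).constField (ebar a)) +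
      scatter b κ0 μ0 ((s : ℂ) • K) ((s : ℂ) • M)
        (scatter b κ0 μ0 ((s : ℂ) • K) ((s : ℂ) • M) (v a)) :=
    fun a => eq_add_neg_add_of_eq_sub _ (hls a)
  have h := hrem μ ε ((s : ℂ) • K) ((s : ℂ) • M) v
    (fun a => -scatter b κ0 μ0 ((s : ℂ) • K) ((s : ℂ) • M)
      ((fourierSystem_cell b).constField (ebar a)))
    (fun a => scatter b κ0 μ0 ((s : ℂ) • K) ((s : ℂ) • M)
      (scatter b κ0 μ0 ((s : ℂ) • K) ((s : ℂ) • M) (v a)))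
    hM hM0 hv (fun _ => rfl) hdec
  simp only [scatter_smul, smul_apply, map_smul, smul_smul, ← neg_smul] at h hls
  refine ⟨v, hls, ?_⟩
  have nG : ‖-(s : ℂ)‖ = |s| := by rw [norm_neg, Complex.norm_real, Real.norm_eq_abs]
  have nH : ‖(s : ℂ) * s‖ = s ^ 2 := by
    rw [← sq, norm_pow, Complex.norm_real, Real.norm_eq_abs, sq_abs]
  have hG := ae_norm_smul_tensorField (-(s : ℂ)) fun a =>
    scatter b κ0 μ0 K M ((fourierSystem_cell b).constField (ebar a))
  have hH := ae_norm_smul_tensorField ((s : ℂ) * s) fun a =>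
    scatter b κ0 μ0 K M (scatter b κ0 μ0 K M (v a))
  simp only [nG] at hG
  simp only [nH] at hH
  filter_upwards [h, hG, hH] with x h1 h2 h3
  simpa only [h2, h3, mul_pow, sq_abs] using h1

/-- Pointwise bounds for the remainders of media whose fluctuations are multiples of fixed ones. -/
lemma ae_eventually_remainder_le (hd : 2 ≤ d) {κ0 μ0 : ℝ} (hκ0 : 0 < κ0) (hμ0 : 0 < μ0)
    {ebar : Fin (nK d) → Tensor2 d} (hebar : IsDeviatoricBasis ebar) {κ μ : ℕ → Space d → ℝ}
    {ε : ℕ → Fin (nK d) → Space d → Tensor2 d}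
    (hsol : ∀ n a, IsStrainSolution b (κ n) (μ n) (ebar a) (ε n a)) {s : ℕ → ℝ}
    (hs : Tendsto s atTop (nhds 0)) (K M : Lp ℂ ⊤ (cellProb b))
    (hK : ∀ n, ((s n : ℂ) • K : Lp ℂ ⊤ (cellProb b)) =ᵐ[cellProb b]
      fun x => ((κ n x - κ0 : ℝ) : ℂ))
    (hM : ∀ n, ((s n : ℂ) • M : Lp ℂ ⊤ (cellProb b)) =ᵐ[cellProb b]
      fun x => ((μ n x - μ0 : ℝ) : ℂ))
    (hM0 : ∀ n, (fourierSystem_cell b).coeff 0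
      (mulOp ((s n : ℂ) • M) ((fourierSystem_cell b).charLp 0)) = 0) :
    ∀ᵐ x ∂cellProb b, ∃ C : ℝ, ∀ᶠ n in atTop,
      |μ n x - shearFromDev κ0 μ0 ebar (fun a => ε n a x)| ≤ C * s n ^ 2 ∧
      |μ n x - shearFromEq κ0 μ0 ebar (fun a => ε n a x)| ≤ C * s n ^ 2 ∧
      ∀ a, |hydroStrain (ε n a x)| ≤ C * |s n| := by
  obtain ⟨C0, hC0, hrem⟩ := exists_ae_scaled_remainder_le (b := b) hd hκ0 hμ0 hebar
  choose v hls hae using fun n => hrem (κ n) (μ n) (ε n) (s n) K M (hsol n) (hK n) (hM n) (hM0 n)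
  rw [← ae_all_iff] at hae
  set e : Fin (nK d) → TensorField d (cellProb b) :=
    fun a => (fourierSystem_cell b).constField (ebar a) with he
  set A := scatter b κ0 μ0 K M with hA
  -- The second-order term solves the same equation with the fixed source `A (A (e a))`, so it too
  -- is bounded almost everywhere as `s n → 0`.
  have hls2 : ∀ n a, A (A (v n a)) = A (A (e a)) - (s n : ℂ) • A (A (A (v n a))) := fun n a => by
    conv_lhs => rw [hls n a]
    rw [map_sub, map_sub, map_smul, map_smul]
  have hbd : ∀ᵐ x ∂cellProb b, ∀ a i j, ∃ C : ℝ, ∀ᶠ n in atTop, ‖A (A (v n a)) i j x‖ ≤ C :=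
    ae_all_iff.2 fun a => ae_all_iff.2 fun i => ae_all_iff.2 fun j => by
      have h := ae_eventually_bounded_of_eq_sub_smul (entry i j) A (A (A (e a))) hs
        (y := fun n => A (A (v n a))) fun n => hls2 n a
      simpa only [entry_apply] using h
  have hs1 : ∀ᶠ n in atTop, |s n| ≤ 1 := by
    have := hs.abs
    rw [abs_zero] at this
    exact this.eventually_le_const one_pos
  filter_upwards [hae, hbd] with x h1 h2
  choose D hD using h2
  have hDn : ∀ᶠ n in atTop, ∀ a i j, ‖A (A (v n a)) i j x‖ ≤ D a i j :=
    eventually_all.2 fun a => eventually_all.2 fun i => eventually_all.2 fun j => hD a i j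
  refine ⟨C0 * ∑ a, ∑ i, ∑ j, (|D a i j| + ‖A (e a) i j x‖ ^ 2 + ‖A (e a) i j x‖), ?_⟩
  filter_upwards [hDn, hs1] with n h3 h4
  have hs2 : s n ^ 2 ≤ |s n| := by
    rw [← sq_abs]
    nlinarith [abs_nonneg (s n)]
  have key2 : ∀ a i j, s n ^ 2 * ‖A (A (v n a)) i j x‖ + s n ^ 2 * ‖A (e a) i j x‖ ^ 2 ≤
      (|D a i j| + ‖A (e a) i j x‖ ^ 2 + ‖A (e a) i j x‖) * s n ^ 2 := fun a i j => by
    have := mul_le_mul_of_nonneg_left ((h3 a i j).trans (le_abs_self _)) (sq_nonneg (s n))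
    have := mul_nonneg (norm_nonneg (A (e a) i j x)) (sq_nonneg (s n))
    linarith
  have key1 : ∀ a i j, |s n| * ‖A (e a) i j x‖ + s n ^ 2 * ‖A (A (v n a)) i j x‖ ≤
      (|D a i j| + ‖A (e a) i j x‖ ^ 2 + ‖A (e a) i j x‖) * |s n| := fun a i j => by
    have := mul_le_mul hs2 ((h3 a i j).trans (le_abs_self _)) (norm_nonneg _) (abs_nonneg _)
    have := mul_nonneg (sq_nonneg ‖A (e a) i j x‖) (abs_nonneg (s n))
    linarith
  exact ⟨(h1 n).1.trans (mul_sum_le_of_le hC0 key2),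
    (h1 n).2.1.trans (mul_sum_le_of_le hC0 key2),
    fun a => ((h1 n).2.2 a).trans (mul_sum_le_of_le hC0 key1)⟩

lemma contrast_scaled (κ0 μ0 t : ℝ) (k m : Space d → ℝ) :
    (contrast b κ0 μ0 (fun x => κ0 + t * k x) (fun x => μ0 + t * m x)).toReal =
      |t| * (eLpNorm (fun x => max |(d : ℝ) * k x| |2 * m x|) ⊤ (cellMeasure b)).toReal := by
  have h : (fun x => max |(d : ℝ) * (κ0 + t * k x - κ0)| |2 * (μ0 + t * m x - μ0)|) =
      |t| • fun x => max |(d : ℝ) * k x| |2 * m x| := by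
    funext x
    rw [Pi.smul_apply, smul_eq_mul, mul_max_of_nonneg _ _ (abs_nonneg t), ← abs_mul, ← abs_mul]
    congr 2 <;> ring
  rw [contrast, h, eLpNorm_const_smul, ENNReal.toReal_mul]
  simp

/-- Fluctuations of fixed shape are multiples of fixed bounded functions, with coefficients that
are controlled by the contrast. -/
lemma exists_scaled_fluctuation (hd : 2 ≤ d) {κ0 μ0 : ℝ} {k m : Space d → ℝ} {t : ℕ → ℝ}
    (ht : Tendsto t atTop (nhds 0))
    (hmed : ∀ n, IsMedium b (fun x => κ0 + t n * k x) (fun x => μ0 + t n * m x))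
    (hmean : ∀ n, ⨍ x, (μ0 + t n * m x) ∂(cellMeasure b) = μ0) :
    ∃ (s : ℕ → ℝ) (K M : Lp ℂ ⊤ (cellProb b)) (B : ℝ), Tendsto s atTop (nhds 0) ∧
      (∀ n, ((s n : ℂ) • K : Lp ℂ ⊤ (cellProb b)) =ᵐ[cellProb b]
        fun x => ((κ0 + t n * k x - κ0 : ℝ) : ℂ)) ∧
      (∀ n, ((s n : ℂ) • M : Lp ℂ ⊤ (cellProb b)) =ᵐ[cellProb b]
        fun x => ((μ0 + t n * m x - μ0 : ℝ) : ℂ)) ∧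
      (∀ n, (fourierSystem_cell b).coeff 0
        (mulOp ((s n : ℂ) • M) ((fourierSystem_cell b).charLp 0)) = 0) ∧
      ∀ n, |s n| ≤ B * (contrast b κ0 μ0 (fun x => κ0 + t n * k x)
        (fun x => μ0 + t n * m x)).toReal := by
  choose K M hK hM hKn hMn hM0 using fun n => (hmed n).exists_fluctuation hd (hmean n) (κ0 := κ0)
  set L := (eLpNorm (fun x => max |(d : ℝ) * k x| |2 * m x|) ⊤ (cellMeasure b)).toReal
  simp only [contrast_scaled] at hKn hMn ⊢
  -- If all contrasts vanish, for instance because every `t n` is zero, then `k` and `m` need not be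
  -- measurable or bounded. The actual fluctuations are then zero and the scale `s = 0` represents
  -- them.
  by_cases h : ∀ n, |t n| * L = 0
  · refine ⟨fun _ => 0, 0, 0, 0, tendsto_const_nhds, fun n => ?_, fun n => ?_, fun n => ?_,
      fun n => by simp⟩
    · have : K n = 0 := norm_le_zero_iff.1 ((hKn n).trans (h n).le)
      rw [smul_zero, ← this]
      exact hK n
    · have : M n = 0 := norm_le_zero_iff.1 ((hMn n).trans (h n).le)
      rw [smul_zero, ← this]
      exact hM n
    · have : M n = 0 := norm_le_zero_iff.1 ((hMn n).trans (h n).le)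
      rw [smul_zero, ← this]
      exact hM0 n
  · push Not at h
    obtain ⟨N, hN⟩ := h
    have htN : (t N : ℂ) ≠ 0 := fun h0 => hN (by rw [Complex.ofReal_eq_zero.1 h0]; simp)
    have hL : L ≠ 0 := right_ne_zero_of_mul hN
    -- Otherwise a single index with `t N ≠ 0` determines the shape almost everywhere, and `|t n|`
    -- is the contrast divided by `L`.
    refine ⟨t, (t N : ℂ)⁻¹ • K N, (t N : ℂ)⁻¹ • M N, L⁻¹, ht, fun n => ?_, fun n => ?_,
      fun n => ?_, fun n => ?_⟩
    · rw [smul_smul]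
      filter_upwards [hK N, Lp.coeFn_smul ((t n : ℂ) * (t N : ℂ)⁻¹) (K N)] with x h1 h2
      rw [h2, Pi.smul_apply, h1, smul_eq_mul]
      push_cast
      field_simp
      ring
    · rw [smul_smul]
      filter_upwards [hM N, Lp.coeFn_smul ((t n : ℂ) * (t N : ℂ)⁻¹) (M N)] with x h1 h2
      rw [h2, Pi.smul_apply, h1, smul_eq_mul]
      push_cast
      field_simp
      ring
    · rw [smul_smul, map_smul, smul_apply, map_smul, hM0 N, smul_zero]
    · rw [mul_comm, mul_assoc, mul_inv_cancel₀ hL, mul_one]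

end Pointwise

end

/-! ### The final estimates. -/

section MainResults

variable {d : ℕ} {b : Module.Basis (Fin d) ℝ (Space d)}

lemma nontrivial_space (hd : 2 ≤ d) : Nontrivial (Space d) :=
  Module.nontrivial_of_finrank_pos (R := ℝ) (by simp; omega)

/-- The estimates in mean square over the period cell. -/
theorem exists_eLpNorm_cell_remainder_le (hd : 2 ≤ d) {κ0 μ0 : ℝ} (hκ0 : 0 < κ0) (hμ0 : 0 < μ0)
    {ebar : Fin (nK d) → Tensor2 d} (hebar : IsDeviatoricBasis ebar) :
    ∃ C : ℝ, 0 < C ∧ ∃ δ : ℝ, 0 < δ ∧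
      ∀ (κ μ : Space d → ℝ) (ε : Fin (nK d) → Space d → Tensor2 d) (c : ℝ), 0 ≤ c → c ≤ δ →
        IsMedium b κ μ → ⨍ x, μ x ∂(cellMeasure b) = μ0 →
        (∀ a, IsStrainSolution b κ μ (ebar a) (ε a)) →
        contrast b κ0 μ0 κ μ = ENNReal.ofReal c →
          eLpNorm (fun x => μ x - shearFromDev κ0 μ0 ebar (fun a => ε a x)) 2 (cellMeasure b)
              ≤ ENNReal.ofReal (C * c ^ 2) ∧
          eLpNorm (fun x => μ x - shearFromEq κ0 μ0 ebar (fun a => ε a x)) 2 (cellMeasure b)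
              ≤ ENNReal.ofReal (C * c ^ 2) ∧
          ∀ a, eLpNorm (fun x => hydroStrain (ε a x)) 2 (cellMeasure b)
              ≤ ENNReal.ofReal (C * c) := by
  have := nontrivial_space hd
  obtain ⟨C, hC, δ, hδ, h⟩ := exists_eLpNorm_remainder_le (b := b) hd hκ0 hμ0 hebar
  set V := Real.sqrt (volume (ZSpan.fundamentalDomain b)).toReal with hV
  have hV0 : 0 ≤ V := Real.sqrt_nonneg _
  refine ⟨(V + 1) * C, by positivity, δ, hδ, fun κ μ ε c hc hcδ hmed hmean hsol hcon => ?_⟩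
  have htr : ∀ (f : Space d → ℝ) (r : ℝ), 0 ≤ r → eLpNorm f 2 (cellProb b) ≤ ENNReal.ofReal r →
      eLpNorm f 2 (cellMeasure b) ≤ ENNReal.ofReal ((V + 1) * r) := fun f r hr hf => by
    rw [eLpNorm_cellMeasure, ENNReal.ofReal_mul (by positivity)]
    exact mul_le_mul' (ENNReal.ofReal_le_ofReal (by linarith)) hf
  have hcr : (contrast b κ0 μ0 κ μ).toReal = c := by rw [hcon, ENNReal.toReal_ofReal hc]
  obtain ⟨h1, h2, h3⟩ := h κ μ ε hmed hmean hsol (hcr.le.trans hcδ)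
  rw [hcr] at h1 h2 h3
  simp only [mul_assoc]
  exact ⟨htr _ _ (by positivity) h1, htr _ _ (by positivity) h2,
    fun a => htr _ _ (by positivity) (h3 a)⟩

/-- The estimates at almost every point for fluctuations of fixed shape. -/
theorem ae_remainder_isLittleO (hd : 2 ≤ d) {κ0 μ0 : ℝ} (hκ0 : 0 < κ0) (hμ0 : 0 < μ0)
    {ebar : Fin (nK d) → Tensor2 d} (hebar : IsDeviatoricBasis ebar)
    {k m : Space d → ℝ} {t : ℕ → ℝ} {ε : ℕ → Fin (nK d) → Space d → Tensor2 d}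
    (ht : Tendsto t atTop (nhds 0))
    (hmed : ∀ n, IsMedium b (fun x => κ0 + t n * k x) (fun x => μ0 + t n * m x))
    (hmean : ∀ n, ⨍ x, (μ0 + t n * m x) ∂(cellMeasure b) = μ0)
    (hsol : ∀ n a, IsStrainSolution b (fun x => κ0 + t n * k x) (fun x => μ0 + t n * m x)
      (ebar a) (ε n a)) :
    ∀ᵐ x,
      ((fun n => (μ0 + t n * m x) - shearFromDev κ0 μ0 ebar (fun a => ε n a x)) =o[atTop]
        fun n => (contrast b κ0 μ0 (fun y => κ0 + t n * k y)
          (fun y => μ0 + t n * m y)).toReal) ∧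
      ((fun n => (μ0 + t n * m x) - shearFromEq κ0 μ0 ebar (fun a => ε n a x)) =o[atTop]
        fun n => (contrast b κ0 μ0 (fun y => κ0 + t n * k y)
          (fun y => μ0 + t n * m y)).toReal) ∧
      ∀ a, (fun n => hydroStrain (ε n a x)) =O[atTop]
        fun n => (contrast b κ0 μ0 (fun y => κ0 + t n * k y)
          (fun y => μ0 + t n * m y)).toReal := by
  obtain ⟨s, K, M, B, hs, hK, hM, hM0, hB⟩ := exists_scaled_fluctuation hd ht hmed hmean
  set c : ℕ → ℝ := fun n => (contrast b κ0 μ0 (fun y => κ0 + t n * k y)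
    (fun y => μ0 + t n * m y)).toReal with hc
  have hsc : s =O[atTop] c := IsBigO.of_bound B (Eventually.of_forall fun n => by
    rw [Real.norm_eq_abs, Real.norm_eq_abs, abs_of_nonneg (ENNReal.toReal_nonneg : 0 ≤ c n)]
    exact hB n)
  -- One factor `s n` tends to zero and the other is bounded by a multiple of the contrast. This
  -- includes indices at which the contrast is zero.
  have hs2 : (fun n => s n ^ 2) =o[atTop] c := by
    have h1 : (fun n => s n * s n) =o[atTop] fun n => (1 : ℝ) * c n :=
      ((isLittleO_one_iff ℝ).2 hs).mul_isBigO hsc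
    simpa only [one_mul, ← sq] using h1
  refine ae_volume_of_ae_cellMeasure (b := b) (fun i x => ?_) ?_
  · have e1 : ∀ n, μ0 + t n * m (x + b i) = μ0 + t n * m x := fun n =>
      (hmed n).periodic_shear i x
    have e2 : ∀ n a, ε n a (x + b i) = ε n a x := fun n a => (hsol n a).periodic i x
    simp only [e1, e2]
  · have h := ae_eventually_remainder_le hd hκ0 hμ0 hebar hsol hs K M hK hM hM0
    rw [ae_cellProb] at h
    filter_upwards [h] with x hx
    obtain ⟨C, hx⟩ := hx
    refine ⟨IsBigO.trans_isLittleO (IsBigO.of_bound C ?_) hs2,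
      IsBigO.trans_isLittleO (IsBigO.of_bound C ?_) hs2, fun a => (IsBigO.of_bound C ?_).trans hsc⟩
    · filter_upwards [hx] with n hn
      rw [Real.norm_eq_abs, Real.norm_eq_abs, abs_of_nonneg (sq_nonneg (s n))]
      exact hn.1
    · filter_upwards [hx] with n hn
      rw [Real.norm_eq_abs, Real.norm_eq_abs, abs_of_nonneg (sq_nonneg (s n))]
      exact hn.2.1
    · filter_upwards [hx] with n hn
      exact hn.2.2 a

end MainResults

theorem proposition2 (d : ℕ) (hd : d = 2 ∨ d = 3)
    (b : Module.Basis (Fin d) ℝ (Space d)) (κ0 μ0 : ℝ) (hκ0 : 0 < κ0) (hμ0 : 0 < μ0)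
    (ebar : Fin (nK d) → Tensor2 d) (hebar : IsDeviatoricBasis ebar) :
    -- the two reconstruction formulae, in mean square and uniformly in the medium
    (∀ η : ℝ, 0 < η → ∃ δ : ℝ, 0 < δ ∧
      ∀ (κ μ : Space d → ℝ) (ε : Fin (nK d) → Space d → Tensor2 d),
        IsMedium b κ μ → ⨍ x, μ x ∂(cellMeasure b) = μ0 →
        (∀ a, IsStrainSolution b κ μ (ebar a) (ε a)) →
        contrast b κ0 μ0 κ μ ≤ ENNReal.ofReal δ →
          eLpNorm (fun x => μ x - shearFromDev κ0 μ0 ebar (fun a => ε a x)) 2 (cellMeasure b)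
              ≤ ENNReal.ofReal η * contrast b κ0 μ0 κ μ ∧
          eLpNorm (fun x => μ x - shearFromEq κ0 μ0 ebar (fun a => ε a x)) 2 (cellMeasure b)
              ≤ ENNReal.ofReal η * contrast b κ0 μ0 κ μ) ∧
    -- the hydrostatic strains, in mean square and uniformly in the medium
    (∃ C : ℝ, 0 < C ∧ ∃ δ : ℝ, 0 < δ ∧
      ∀ (κ μ : Space d → ℝ) (ε : Fin (nK d) → Space d → Tensor2 d),
        IsMedium b κ μ → ⨍ x, μ x ∂(cellMeasure b) = μ0 →
        (∀ a, IsStrainSolution b κ μ (ebar a) (ε a)) →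
        contrast b κ0 μ0 κ μ ≤ ENNReal.ofReal δ →
          ∀ a, eLpNorm (fun x => hydroStrain (ε a x)) 2 (cellMeasure b)
              ≤ ENNReal.ofReal C * contrast b κ0 μ0 κ μ) ∧
    -- the same three claims at almost every point, for fluctuations of fixed shape
    (∀ (k m : Space d → ℝ) (t : ℕ → ℝ) (ε : ℕ → Fin (nK d) → Space d → Tensor2 d),
      Tendsto t atTop (nhds 0) →
      (∀ n, IsMedium b (fun x => κ0 + t n * k x) (fun x => μ0 + t n * m x)) →
      (∀ n, ⨍ x, (μ0 + t n * m x) ∂(cellMeasure b) = μ0) →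
      (∀ n a, IsStrainSolution b (fun x => κ0 + t n * k x) (fun x => μ0 + t n * m x)
        (ebar a) (ε n a)) →
      ∀ᵐ x,
        ((fun n => (μ0 + t n * m x) - shearFromDev κ0 μ0 ebar (fun a => ε n a x)) =o[atTop]
          fun n => (contrast b κ0 μ0 (fun y => κ0 + t n * k y)
            (fun y => μ0 + t n * m y)).toReal) ∧
        ((fun n => (μ0 + t n * m x) - shearFromEq κ0 μ0 ebar (fun a => ε n a x)) =o[atTop]
          fun n => (contrast b κ0 μ0 (fun y => κ0 + t n * k y)
            (fun y => μ0 + t n * m y)).toReal) ∧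
        ∀ a, (fun n => hydroStrain (ε n a x)) =O[atTop]
          fun n => (contrast b κ0 μ0 (fun y => κ0 + t n * k y)
            (fun y => μ0 + t n * m y)).toReal) := by
  have hd2 : 2 ≤ d := by omega
  obtain ⟨C, hC, δ, hδ, h⟩ := exists_eLpNorm_cell_remainder_le (b := b) hd2 hκ0 hμ0 hebar
  -- For a contrast `c ≤ η / C` the quadratic bound `C c²` is at most `η c`.
  refine ⟨fun η hη => ⟨min δ (η / C), by positivity, fun κ μ ε hmed hmean hsol hcon => ?_⟩,
    ⟨C, hC, δ, hδ, fun κ μ ε hmed hmean hsol hcon a => ?_⟩,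
    fun k m t ε ht hmed hmean hsol => ae_remainder_isLittleO hd2 hκ0 hμ0 hebar ht hmed hmean hsol⟩
  · have hc := ENNReal.toReal_le_of_le_ofReal (by positivity) hcon
    have hc0 : 0 ≤ (contrast b κ0 μ0 κ μ).toReal := ENNReal.toReal_nonneg
    have hce := (ENNReal.ofReal_toReal (hmed.contrast_ne_top κ0 μ0)).symm
    obtain ⟨h1, h2, -⟩ := h κ μ ε _ hc0 (hc.trans (min_le_left _ _)) hmed hmean hsol hce
    have hle : ENNReal.ofReal (C * (contrast b κ0 μ0 κ μ).toReal ^ 2) ≤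
        ENNReal.ofReal η * contrast b κ0 μ0 κ μ := by
      conv_rhs => rw [hce]
      rw [← ENNReal.ofReal_mul hη.le, sq, ← mul_assoc]
      refine ENNReal.ofReal_le_ofReal (mul_le_mul_of_nonneg_right ?_ hc0)
      rw [mul_comm, ← le_div_iff₀ hC]
      exact hc.trans (min_le_right _ _)
    exact ⟨h1.trans hle, h2.trans hle⟩
  · have hc := ENNReal.toReal_le_of_le_ofReal hδ.le hcon
    have hce := (ENNReal.ofReal_toReal (hmed.contrast_ne_top κ0 μ0)).symm
    have h3 := (h κ μ ε _ ENNReal.toReal_nonneg hc hmed hmean hsol hce).2.2 a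
    rwa [ENNReal.ofReal_mul hC.le, ← hce] at h3
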